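/- **Setting.** Let $D\subset\mathbb R^3$ be a bounded open set, $B_R=\{|x|<R\}$ with $\overline D\subset B_R$, $\mu>0$, $\lambda+2\mu>0$, $\kappa>0$, $\kappa_s=\kappa/\sqrt\mu$, $\kappa_p=\kappa/\sqrt{\lambda+2\mu}$. Let $\sigma_1,\sigma_2,\sigma_3\ge 0$ be functions on $\mathbb R^3$ whose supports are contained in $D$, with $\sigma_j^2\in H^1(D)$; write $\boldsymbol\sigma=\mathrm{diag}(\sigma_1,\sigma_2,\sigma_3)$ and $\boldsymbol\sigma^2=(\sigma_1^2,\sigma_2^2,\sigma_3^2)^\top$. For each of $N_s\ge1$ independent samples of a three-dimensional white noise $\dot{\boldsymbol W}$ on $\mathbb R^3$ (three independent components) let $$\boldsymbol u(x)=\int_D \mathbf G(x,y)\boldsymbol\sigma(y)\,d\boldsymbol W_y\quad\text{a.s.},$$ $$\mathbf G(x,y)=\tfrac1\mu g(x,y;\kappa_s)\mathbf I+\tfrac1{\kappa^2}\nabla_x\nabla_x^\top\big(g(x,y;\kappa_s)-g(x,y;\kappa_p)\big),\quad g(x,y;k)=-\frac{e^{\mathrm i k|x-y|}}{4\pi|x-y|},$$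 be the mild solution of $\mu\Delta\boldsymbol u+(\lambda+\mu)\nabla\nabla\cdot\boldsymbol u+\kappa^2\boldsymbol u=\boldsymbol\sigma\dot{\boldsymbol W}$, in a version with $C^1$ sample paths outside $\overline D$, and let $D\boldsymbol u=\mu\,\partial_\nu\boldsymbol u+(\lambda+\mu)(\nabla\cdot\boldsymbol u)\nu$ on $\partial B_R$. The data are jointly measurable random fields $\boldsymbol u^\delta$, $D\boldsymbol u^\delta$ on $\partial B_R$, one pair per sample. **Algorithm 1** (with exact boundary integrals and exact inverse Fourier transform). For $\boldsymbol\xi\ne0$, $|\boldsymbol\xi|<2\kappa_s$, $k=1,2,3$ and indices of components taken cyclically, let $\boldsymbol\alpha^{(k)}$ have the components $\alpha_k=0$ and $$(\alpha_{k+1},\alpha_{k+2})=\frac{(-\xi_{k+2},\xi_{k+1})}{\sqrt{\xi_{k+1}^2+\xi_{k+2}^2}},$$ or $(\alpha_{k+1},\alpha_{k+2})=(\sin\theta_k,\cos\theta_k)$ with an arbitrary fixed $\theta_k$ if $\xi_{k+1}=\xi_{k+2}=0$. For $l=1,2$ (sign $+$ for $l=1$ and $-$ for $l=2$) let $\boldsymbol\zeta_l^{(k)}=\boldsymbol\xi/2\pm\sqrt{\kappa_s^2-|\boldsymbol\xi|^2/4}\,\boldsymbol\alpha^{(k)}$,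 $z=\boldsymbol\zeta_l^{(k)}/\kappa_s$, and let $\boldsymbol\eta_l^{(k)}$ have $k$-th component $\sqrt{1-z_k^2}$ and $m$-th component $-z_kz_m/\sqrt{1-z_k^2}$ for $m\ne k$. Put $\boldsymbol U_l^{(k)}(x)=\boldsymbol\eta_l^{(k)}e^{\mathrm i\boldsymbol\zeta_l^{(k)}\cdot x}$ and let $A=A(\boldsymbol\xi)$ be the $3\times3$ matrix with entries $A_{kj}=\eta^{(k)}_{1j}\eta^{(k)}_{2j}$. For each sample compute $I_l^{(k)}=\int_{\partial B_R}(D\boldsymbol u^\delta\cdot\boldsymbol U_l^{(k)}-D\boldsymbol U_l^{(k)}\cdot\boldsymbol u^\delta)\,ds$, let $b_k(\boldsymbol\xi)$ be the average of $I_1^{(k)}I_2^{(k)}$ over the $N_s$ samples, and define the reconstructed Fourier transform $\boldsymbol h$ by $A(\boldsymbol\xi)\boldsymbol h(-\boldsymbol\xi)=\boldsymbol b(\boldsymbol\xi)$. The reconstructed variance with cutoff frequency $|\boldsymbol\xi|_{\max}$ is $$\boldsymbol\sigma_r^2(x)=(2\pi)^{-3}\int_{|\boldsymbol\xi|\le|\boldsymbol\xi|_{\max}}\boldsymbol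 h(\boldsymbol\xi)e^{\mathrm i x\cdot\boldsymbol\xi}\,d\boldsymbol\xi .$$ **Theorem (Error estimate for Algorithm 1).** For every $\beta\in(0,2)$ the matrices $A(\boldsymbol\xi)$, $0<|\boldsymbol\xi|\le\beta\kappa_s$, are invertible, and $$C_1=C_1(\beta)=\sup\Big\{\frac{\mathrm{cond}(A(\boldsymbol\xi))}{\|A(\boldsymbol\xi)\|_2}:\ 0<|\boldsymbol\xi|\le\beta\kappa_s\Big\},$$ the supremum being taken over all $\kappa_s>0$, $\boldsymbol\xi$ and $\theta_k$ (2-norm condition number, spectral norm), is finite and depends only on $\beta$. For given $D$ there is a constant $C_2$ depending only on $M,\kappa_s$, and for given $D$, $\mu$ and $\varepsilon_0$ there is a constant $C_3$ depending only on $M,\kappa_s$, such that the following holds. If $\|\sigma_j^2\|_{H^1(D)}\le M$ for $j=1,2,3$, if almost surely, for every sample, $$\|\boldsymbol u^\delta-\boldsymbol u\|_{L^1(\partial B_R)}\le\varepsilon,\qquad\|D\boldsymbol u^\delta-D\boldsymbol u\|_{L^1(\partial B_R)}\le\varepsilon,\qquad 0\le\varepsilon\le\varepsilon_0,$$ and if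 $|\boldsymbol\xi|_{\max}=\beta\kappa_s$ with $\beta\in(0,2)$, then $$\mathbb E\big[\|\boldsymbol\sigma_r^2-\boldsymbol\sigma^2\|_{L^2(D)}\big]\le\sqrt{\tfrac{4\pi}{3}}\,|\boldsymbol\xi|_{\max}^{3/2}\,C_1\Big(\frac{C_2}{\sqrt{N_s}}+C_3\varepsilon\Big)+\frac{\sqrt3\,M}{\sqrt{1+|\boldsymbol\xi|_{\max}^2}} .$$ -/

import Mathlib

open MeasureTheory ProbabilityTheory
open scoped Matrix

noncomputable section

namespace RandomSource

/-- The physical space `ℝ³`. -/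
abbrev E3 := EuclideanSpace ℝ (Fin 3)

/-- The space `ℂ³` of displacement values, with its Hermitian norm. -/
abbrev C3 := EuclideanSpace ℂ (Fin 3)

/-- Standard unit vector of `ℝ³`. -/
def unitVec (j : Fin 3) : E3 := EuclideanSpace.single j 1

/-- The surface measure `ds` of the sphere `∂B_R`, as a measure on `ℝ³`: the image of the surface
measure of the unit sphere under `ω ↦ R ω`, times `R ^ 2`. -/
def surfaceMeasure (R : ℝ) : Measure E3 :=
  ENNReal.ofReal (R ^ 2) •
    ((volume : Measure E3).toSphere).map (fun w : Metric.sphere (0 : E3) 1 => R • (w : E3))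

/-! ### The Sobolev norm -/

/-- `w` is the weak gradient of `v` in the open set `D`. -/
def IsWeakGradient (D : Set E3) (v : E3 → ℝ) (w : Fin 3 → E3 → ℝ) : Prop :=
  ∀ i : Fin 3, ∀ φ : E3 → ℝ, ContDiff ℝ (⊤ : ℕ∞) φ → HasCompactSupport φ → tsupport φ ⊆ D →
    ∫ x in D, v x * fderiv ℝ φ x (unitVec i) = - ∫ x in D, w i x * φ x

/-- `v ∈ H¹(D)` and `‖v‖_{H¹(D)} ≤ M`. -/
def H1NormLE (D : Set E3) (v : E3 → ℝ) (M : ℝ) : Prop :=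
  MemLp v 2 (volume.restrict D) ∧
    ∃ w : Fin 3 → E3 → ℝ, (∀ i, MemLp (w i) 2 (volume.restrict D)) ∧ IsWeakGradient D v w ∧
      √((∫ x in D, v x ^ 2) + ∑ i, ∫ x in D, w i x ^ 2) ≤ M

/-! ### White noise and the Wiener integral -/

section Noise

variable {Ω : Type*} [MeasurableSpace Ω]

/-- Three independent real white noises on `ℝ³`, given through their Wiener integrals
`W j h = ∫ h dW_j`, `h ∈ L²(ℝ³)`: a centred Gaussian family with the Itô isometry.
(Up to sign `x ↦ W j 1_{[0, x]}` are three independent three-parameter Brownian sheets.) -/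
structure IsWhiteNoise (W : Fin 3 → Lp ℝ 2 (volume : Measure E3) → Ω → ℝ) (P : Measure Ω) :
    Prop where
  gaussian : IsGaussianProcess
    (fun (p : Fin 3 × Lp ℝ 2 (volume : Measure E3)) (ω : Ω) => W p.1 p.2 ω) P
  mean_zero : ∀ j h, ∫ ω, W j h ω ∂P = 0
  isometry : ∀ i j h k, ∫ ω, W i h ω * W j k ω ∂P = if i = j then inner ℝ h k else 0

open Classical in
/-- The Wiener integral `∫ h dW` of a complex square integrable function. -/
def wienerIntegral (W : Lp ℝ 2 (volume : Measure E3) → Ω → ℝ) (h : E3 → ℂ) (ω : Ω) : ℂ :=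
  if hh : MemLp h 2 (volume : Measure E3) then
    (W hh.re.toLp ω : ℂ) + (W hh.im.toLp ω : ℂ) * Complex.I
  else 0

end Noise

/-! ### The direct problem -/

/-- Fundamental solution of the Helmholtz equation. -/
def helmholtz (k : ℝ) (x y : E3) : ℂ :=
  -(1 / (4 * (Real.pi : ℂ))) * (Complex.exp (Complex.I * ((k * ‖x - y‖ : ℝ) : ℂ)) / (‖x - y‖ : ℂ))

/-- Compressional wavenumber. -/
def kappaP (lam mu κ : ℝ) : ℝ := κ / √(lam + 2 * mu)

/-- Shear wavenumber. -/
def kappaS (mu κ : ℝ) : ℝ := κ / √mu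

/-- The entry `(i, j)` of the Green tensor
`μ⁻¹ g(x,y;κ_s) I + κ⁻² ∇ₓ∇ₓᵀ (g(x,y;κ_s) - g(x,y;κ_p))`. -/
def greenTensor (lam mu κ : ℝ) (x y : E3) (i j : Fin 3) : ℂ :=
  (1 / (mu : ℂ)) * (if i = j then helmholtz (kappaS mu κ) x y else 0) +
    (1 / (κ : ℂ) ^ 2) *
      fderiv ℝ (fun z : E3 => fderiv ℝ
        (fun z' : E3 => helmholtz (kappaS mu κ) z' y - helmholtz (kappaP lam mu κ) z' y)
          z (unitVec j)) x (unitVec i)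

/-- `u` is the mild solution `u(x) = ∫_D G(x,y) σ(y) dW_y` a.s., `x ∈ ℝ³`, of the stochastic Navier
equation, in a version whose sample paths are continuously differentiable in the exterior of `D`
(where `u` solves the homogeneous equation), so that `∇u` makes sense there pathwise. -/
structure IsMildSolution {Ω : Type*} [MeasurableSpace Ω] (P : Measure Ω)
    (lam mu κ : ℝ) (D : Set E3) (σ : Fin 3 → E3 → ℝ)
    (W : Fin 3 → Lp ℝ 2 (volume : Measure E3) → Ω → ℝ) (u : E3 → Ω → C3) : Prop where
  mild : ∀ x : E3, ∀ᵐ ω ∂P, ∀ i : Fin 3,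
    u x ω i = ∑ j, wienerIntegral (W j)
      (D.indicator fun y => greenTensor lam mu κ x y i j * (σ j y : ℂ)) ω
  regular : ∀ᵐ ω ∂P, ContDiffOn ℝ 1 (fun x => u x ω) (closure D)ᶜ

/-- The boundary operator `Dv = μ ∂_ν v + (λ + μ) (∇ · v) ν` on a sphere centred at `0`,
`ν = x / |x|`. -/
def boundaryOp (lam mu : ℝ) (v : E3 → C3) (x : E3) : C3 :=
  (mu : ℂ) • fderiv ℝ v x (‖x‖⁻¹ • x) +
    (((lam + mu : ℝ) : ℂ) * ∑ j, fderiv ℝ v x (unitVec j) j) •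
      WithLp.toLp 2 (fun j => ((‖x‖⁻¹ * x j : ℝ) : ℂ))

/-! ### The reconstruction algorithm -/

/-- The direction `α^{(k)}`. Its `k`-th component is `0`; the two others, in cyclic order, are
`(-ξ_{k+2}, ξ_{k+1}) / √(ξ_{k+1}² + ξ_{k+2}²)`, or `(sin θ_k, cos θ_k)` with an arbitrary angle `θ_k`
if `ξ_{k+1} = ξ_{k+2} = 0`. -/
def alphaVec (θ : Fin 3 → ℝ) (ξ : E3) (k : Fin 3) : E3 :=
  WithLp.toLp 2 fun m =>
    if m = k then 0
    else if ξ (k + 1) = 0 ∧ ξ (k + 2) = 0 then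
      (if m = k + 1 then Real.sin (θ k) else Real.cos (θ k))
    else
      (if m = k + 1 then -ξ (k + 2) else ξ (k + 1)) / √(ξ (k + 1) ^ 2 + ξ (k + 2) ^ 2)

/-- `ζ_l^{(k)} = ξ / 2 ± √(κ_s² - |ξ|² / 4) α^{(k)}`, with `+` for `l = 0` and `-` for `l = 1`. -/
def zetaVec (θ : Fin 3 → ℝ) (κs : ℝ) (ξ : E3) (k : Fin 3) (l : Fin 2) : E3 :=
  (1 / 2 : ℝ) • ξ +
    ((if l = 0 then 1 else -1) * √(κs ^ 2 - ‖ξ‖ ^ 2 / 4)) • alphaVec θ ξ k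

/-- `η_l^{(k)}`, the unit vector orthogonal to `ζ_l^{(k)}` with the largest `k`-th component. -/
def etaVec (θ : Fin 3 → ℝ) (κs : ℝ) (ξ : E3) (k : Fin 3) (l : Fin 2) : E3 :=
  let z : E3 := κs⁻¹ • zetaVec θ κs ξ k l
  WithLp.toLp 2 fun m => (1 / √(1 - z k ^ 2)) * (if m = k then 1 - z k ^ 2 else -z k * z m)

/-- The complex exponential solution `U_l^{(k)} = η_l^{(k)} e^{i ζ_l^{(k)} · x}`. -/
def expSol (θ : Fin 3 → ℝ) (κs : ℝ) (ξ : E3) (k : Fin 3) (l : Fin 2) (x : E3) : C3 :=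
  WithLp.toLp 2 fun j => (etaVec θ κs ξ k l j : ℂ) *
    Complex.exp (Complex.I * ((inner ℝ (zetaVec θ κs ξ k l) x : ℝ) : ℂ))

/-- The coefficient matrix, `A_{kj} = η_{1j}^{(k)} η_{2j}^{(k)}`. -/
def coeffMatrix (θ : Fin 3 → ℝ) (κs : ℝ) (ξ : E3) : Matrix (Fin 3) (Fin 3) ℝ :=
  Matrix.of fun k j => etaVec θ κs ξ k 0 j * etaVec θ κs ξ k 1 j

/-- The spectral norm (induced 2-norm) of a matrix. -/
def specNorm (A : Matrix (Fin 3) (Fin 3) ℝ) : ℝ := ‖Matrix.toEuclideanCLM (𝕜 := ℝ) A‖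

/-- The condition number in the 2-norm (of an invertible matrix). -/
def condNumber (A : Matrix (Fin 3) (Fin 3) ℝ) : ℝ := specNorm A * specNorm A⁻¹

/-- All values of `cond(A) / ‖A‖₂`, where `A` is the coefficient matrix at a frequency `ξ` with
`0 < |ξ| ≤ β κ_s`, over all `κ_s > 0`. -/
def amplification (β : ℝ) : Set ℝ :=
  {q | ∃ (κs : ℝ) (θ : Fin 3 → ℝ) (ξ : E3), 0 < κs ∧ ξ ≠ 0 ∧ ‖ξ‖ ≤ β * κs ∧
    q = condNumber (coeffMatrix θ κs ξ) / specNorm (coeffMatrix θ κs ξ)}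

/-- The boundary integral `∫_{∂B_R} (t · U_l - DU_l · v) ds` of one sample, where `v` and `t` are the
measured values of the field and of its boundary operator. -/
def boundaryFunctional (lam mu κ R : ℝ) (θ : Fin 3 → ℝ) (ξ : E3) (k : Fin 3) (l : Fin 2)
    (v t : E3 → C3) : ℂ :=
  ∫ x, ((∑ j, t x j * expSol θ (kappaS mu κ) ξ k l x j) -
      ∑ j, boundaryOp lam mu (expSol θ (kappaS mu κ) ξ k l) x j * v x j) ∂(surfaceMeasure R)

/-- The Monte Carlo approximation of the correlation data from `N` samples. -/
def correlationData (lam mu κ R : ℝ) (θ : Fin 3 → ℝ) {N : ℕ} (v t : Fin N → E3 → C3) (ξ : E3)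
    (k : Fin 3) : ℂ :=
  (1 / (N : ℂ)) * ∑ n, boundaryFunctional lam mu κ R θ ξ k 0 (v n) (t n) *
    boundaryFunctional lam mu κ R θ ξ k 1 (v n) (t n)

/-- The reconstructed Fourier transform of the variance: its value at `-ξ` is the solution of the
linear system with the coefficient matrix and the correlation data at `ξ`. -/
def fourierRec (lam mu κ R : ℝ) (θ : Fin 3 → ℝ) {N : ℕ} (v t : Fin N → E3 → C3) (ξ : E3) :
    Fin 3 → ℂ :=
  ((coeffMatrix θ (kappaS mu κ) (-ξ)).map (fun a : ℝ => (a : ℂ)))⁻¹ *ᵥ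
    correlationData lam mu κ R θ v t (-ξ)

/-- The reconstructed variance `σ_r²`: inverse Fourier transform, truncated to `|ξ| ≤ ρ`, for the
convention `v̂(ξ) = ∫ v(x) e^{-i x · ξ} dx`. -/
def varianceRec (lam mu κ R : ℝ) (θ : Fin 3 → ℝ) (ρ : ℝ) {N : ℕ} (v t : Fin N → E3 → C3)
    (x : E3) : C3 :=
  WithLp.toLp 2 fun j => (1 / (2 * (Real.pi : ℂ)) ^ 3) *
    ∫ ξ in Metric.closedBall (0 : E3) ρ, fourierRec lam mu κ R θ v t ξ j *
      Complex.exp (Complex.I * ((inner ℝ x ξ : ℝ) : ℂ))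

/-- The variance `σ² = (σ_1², σ_2², σ_3²)`, with values in `ℂ³`. -/
def varianceVec (σ : Fin 3 → E3 → ℝ) (x : E3) : C3 :=
  WithLp.toLp 2 fun j => ((σ j x ^ 2 : ℝ) : ℂ)

/-- The error `‖σ_r² - σ²‖_{L²(D)}` of the reconstruction with cutoff frequency `ρ`. -/
def recError (lam mu κ R : ℝ) (D : Set E3) (σ : Fin 3 → E3 → ℝ) (θ : Fin 3 → ℝ) (ρ : ℝ) {N : ℕ}
    (v t : Fin N → E3 → C3) : ENNReal :=
  eLpNorm (fun x => varianceRec lam mu κ R θ ρ v t x - varianceVec σ x) 2 (volume.restrict D)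

end RandomSource

end

/-!
# Error estimate for the reconstruction of the variance of a random elastic source

The constant `C₁` is the supremum of the spectral norms of the inverse coefficient matrices. The entries
of `coeffMatrix` are rational in the numbers `(ξ_k / 2κ_s)²`, and its determinant, cleared of
denominators, is a polynomial with nonnegative coefficients (`det_polynomial_lower_bound`); this gives
`det A(ξ) ≥ (1 - |ξ|² / 4κ_s²)⁶` and a bound of the inverses that depends on `β` only
(`scaledGap_pow_le_det`, `isLUB_amplification`).

The probabilistic part rests on one identity: the boundary functional of the exact field is the Wiener
integral `∑_m ∫_D U_m σ_m dW_m` of the exponential solution `U`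
(`IsMildSolution.isSrcIntegral_boundaryFunctional`). Its deterministic half is Green's representation of
the divergence-free plane wave `U` by the Green tensor, `green_navier`. No divergence theorem is needed:
rotation invariance of the surface measure gives `∫ x_i ∂_j v ds = ∫ x_j ∂_i v ds`
(`integral_coord_mul_pd_comm`), so that fluxes of curls vanish and the flux of a divergence-free field
does not change when its singularity moves. This reduces the tensor representation to the scalar one,
and the scalar one to a singularity at the centre, where it is a Wronskian of two radial solutions of
the Helmholtz equation (`wronskian_eq_one`). The stochastic half exchanges the Wiener integral with
derivatives and with the surface integral. Both are pointwise limits of finite sums (difference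
quotients, quadrature rules), and almost sure limits of Wiener integrals with dominated kernels are
Wiener integrals (`IsSrcIntegral.pd`, `IsSrcIntegral.surface_integral`).

Since `ζ_1 + ζ_2 = ξ`, the Itô isometry shows that the expectation of `I_1 I_2` is the corresponding
row of `A(ξ)` applied to the Fourier transform of `σ²` at `-ξ` (`IsSample.integral_exactProduct`). The
average over the samples deviates from it by `O(N^{-1/2})` in mean square, because the fourth moment of
a Wiener integral is bounded by the square of its variance (`IsWhiteNoise.integral_norm_pow_four_le`),
and noisy data add a term of order `ε` (`lintegral_correlationData_sub_le`).

Finally, Plancherel's theorem bounds the error in `L²(D)` by the error of the Fourier transform in the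
ball `|ξ| ≤ |ξ|_max`, whose volume gives the factor `|ξ|_max^{3/2}`, and by the tail of the transform of
`σ²` (`eLpNorm_truncated_inverse_sub_le`). As the support of `σ` is a compact subset of `D`, the function
`σ_j²` extended by zero lies in `H¹(ℝ³)`, and its `H¹` norm controls the tail
(`lintegral_fourier_tail_le`).
-/

noncomputable section

namespace RandomSource

/-! ### The coefficient matrix -/

/-- The determinant of the coefficient matrix, cleared of denominators and homogenized by
`d = 1 - (a + b + c)`, is a polynomial with nonnegative coefficients that contains
`d ^ 6 (b + c) (c + a) (a + b)`. -/
lemma det_polynomial_lower_bound (a b c d : ℝ) (ha : 0 ≤ a) (hb : 0 ≤ b) (hc : 0 ≤ c)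
    (hd : 0 ≤ d) :
    d ^ 6 * ((b + c) * (c + a) * (a + b)) ≤
      ((b+c+d)^2*(b+c)) * ((c+a+d)^2*(c+a)) * ((a+b+d)^2*(a+b))
      - ((b+c+d)^2*(b+c)) * (b*(c*(c+a)-d*a)) * (c*(b*(a+b)-d*a))
      - (a*(b*(b+c)-d*c)) * (b*(a*(c+a)-d*c)) * ((a+b+d)^2*(a+b))
      + (a*(b*(b+c)-d*c)) * (b*(c*(c+a)-d*a)) * (c*(a*(a+b)-d*b))
      + (a*(c*(b+c)-d*b)) * (b*(a*(c+a)-d*c)) * (c*(b*(a+b)-d*a))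
      - (a*(c*(b+c)-d*b)) * ((c+a+d)^2*(c+a)) * (c*(a*(a+b)-d*b)) := by
  rw [← sub_nonneg]
  ring_nf
  positivity

lemma fin3_cases_ne (k : Fin 3) : k + 1 ≠ k ∧ k + 2 ≠ k ∧ k + 2 ≠ k + 1 := by
  fin_cases k <;> decide

lemma sum_fin3_cyclic {M : Type*} [AddCommMonoid M] (f : Fin 3 → M) (k : Fin 3) :
    ∑ i, f i = f k + f (k + 1) + f (k + 2) := by
  rw [Fin.sum_univ_three]
  fin_cases k
  · simp
  · simp only [Fin.mk_one, Fin.isValue, Fin.reduceAdd]; abel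
  · simp only [Fin.reduceFinMk, Fin.isValue, Fin.reduceAdd]; abel

lemma norm_sq_cyclic (x : E3) (k : Fin 3) :
    ‖x‖ ^ 2 = x k ^ 2 + x (k + 1) ^ 2 + x (k + 2) ^ 2 := by
  rw [EuclideanSpace.norm_sq_eq, sum_fin3_cyclic _ k]; simp

lemma inner_cyclic (x y : E3) (k : Fin 3) :
    inner ℝ x y = x k * y k + x (k + 1) * y (k + 1) + x (k + 2) * y (k + 2) := by
  rw [PiLp.inner_apply, sum_fin3_cyclic _ k]; simp [mul_comm]

section Alpha

variable (θ : Fin 3 → ℝ) (ξ : E3) (k : Fin 3)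

@[simp] lemma alphaVec_self : alphaVec θ ξ k k = 0 := by simp [alphaVec]

lemma alphaVec_add_one : alphaVec θ ξ k (k + 1) =
    if ξ (k + 1) = 0 ∧ ξ (k + 2) = 0 then Real.sin (θ k)
    else -ξ (k + 2) / √(ξ (k + 1) ^ 2 + ξ (k + 2) ^ 2) := by
  simp [alphaVec, (fin3_cases_ne k).1]

lemma alphaVec_add_two : alphaVec θ ξ k (k + 2) =
    if ξ (k + 1) = 0 ∧ ξ (k + 2) = 0 then Real.cos (θ k)
    else ξ (k + 1) / √(ξ (k + 1) ^ 2 + ξ (k + 2) ^ 2) := by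
  simp [alphaVec, (fin3_cases_ne k).2.1, (fin3_cases_ne k).2.2]

lemma pair_sq_pos (h : ¬(ξ (k + 1) = 0 ∧ ξ (k + 2) = 0)) :
    0 < ξ (k + 1) ^ 2 + ξ (k + 2) ^ 2 := by
  by_contra hc
  apply h
  have h1 := sq_nonneg (ξ (k + 1))
  have h2 := sq_nonneg (ξ (k + 2))
  constructor <;> nlinarith

lemma alphaVec_sq_mul (h : ¬(ξ (k + 1) = 0 ∧ ξ (k + 2) = 0)) :
    alphaVec θ ξ k (k + 1) ^ 2 * (ξ (k + 1) ^ 2 + ξ (k + 2) ^ 2) = ξ (k + 2) ^ 2 ∧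
    alphaVec θ ξ k (k + 2) ^ 2 * (ξ (k + 1) ^ 2 + ξ (k + 2) ^ 2) = ξ (k + 1) ^ 2 := by
  have hp := pair_sq_pos ξ k h
  rw [alphaVec_add_one, alphaVec_add_two, if_neg h, if_neg h, div_pow, div_pow,
    Real.sq_sqrt hp.le]
  constructor <;> field_simp

lemma alphaVec_sq_sum : alphaVec θ ξ k (k + 1) ^ 2 + alphaVec θ ξ k (k + 2) ^ 2 = 1 := by
  by_cases h : ξ (k + 1) = 0 ∧ ξ (k + 2) = 0
  · rw [alphaVec_add_one, alphaVec_add_two, if_pos h, if_pos h, Real.sin_sq_add_cos_sq]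
  · have hp := pair_sq_pos ξ k h
    obtain ⟨h1, h2⟩ := alphaVec_sq_mul θ ξ k h
    have : (alphaVec θ ξ k (k + 1) ^ 2 + alphaVec θ ξ k (k + 2) ^ 2 - 1) *
      (ξ (k + 1) ^ 2 + ξ (k + 2) ^ 2) = 0 := by linear_combination h1 + h2
    rcases mul_eq_zero.1 this with h | h
    · linarith
    · exact absurd h hp.ne'

lemma inner_alphaVec : inner ℝ ξ (alphaVec θ ξ k) = 0 := by
  rw [inner_cyclic _ _ k, alphaVec_add_one, alphaVec_add_two, alphaVec_self]
  by_cases h : ξ (k + 1) = 0 ∧ ξ (k + 2) = 0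
  · simp [h.1, h.2]
  · rw [if_neg h, if_neg h]; ring

lemma norm_alphaVec : ‖alphaVec θ ξ k‖ = 1 := by
  have : ‖alphaVec θ ξ k‖ ^ 2 = 1 := by
    rw [norm_sq_cyclic _ k, alphaVec_self, ← alphaVec_sq_sum θ ξ k]; ring
  exact (pow_left_inj₀ (norm_nonneg _) zero_le_one two_ne_zero).1 (by rw [this, one_pow])

end Alpha

section Zeta

variable (θ : Fin 3 → ℝ) (κs : ℝ) (ξ : E3) (k : Fin 3) (l : Fin 2)

lemma zetaVec_apply (m : Fin 3) : zetaVec θ κs ξ k l m = 1 / 2 * ξ m +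
    (if l = 0 then 1 else -1) * √(κs ^ 2 - ‖ξ‖ ^ 2 / 4) * alphaVec θ ξ k m := by
  simp only [zetaVec, PiLp.add_apply, PiLp.smul_apply, smul_eq_mul]

lemma zetaVec_self : zetaVec θ κs ξ k l k = 1 / 2 * ξ k := by
  simp [zetaVec_apply]

lemma zetaVec_add : zetaVec θ κs ξ k 0 + zetaVec θ κs ξ k 1 = ξ := by
  ext m
  simp only [PiLp.add_apply, zetaVec_apply]
  norm_num
  ring

variable {κs ξ}

lemma norm_zetaVec (hκ : 0 < κs) (hξ : ‖ξ‖ < 2 * κs) : ‖zetaVec θ κs ξ k l‖ = κs := by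
  have h0 : 0 ≤ κs ^ 2 - ‖ξ‖ ^ 2 / 4 := by nlinarith [norm_nonneg ξ]
  have : ‖zetaVec θ κs ξ k l‖ ^ 2 = κs ^ 2 := by
    rw [zetaVec, norm_add_sq_real, inner_smul_left, inner_smul_right, inner_alphaVec,
      norm_smul, norm_smul, norm_alphaVec, mul_pow, Real.norm_eq_abs, Real.norm_eq_abs,
      sq_abs, mul_pow, sq_abs, mul_pow, Real.sq_sqrt h0]
    split_ifs <;> norm_num <;> ring
  exact (pow_left_inj₀ (norm_nonneg _) hκ.le two_ne_zero).1 this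

lemma one_sub_scaled_sq_pos (hκ : 0 < κs) (hξ : ‖ξ‖ < 2 * κs) : 0 < 1 - (κs⁻¹ * (1 / 2 * ξ k)) ^ 2 := by
  have h1 := norm_sq_cyclic ξ k
  have h2 : ξ k ^ 2 < (2 * κs) ^ 2 := by
    have : ‖ξ‖ ^ 2 < (2 * κs) ^ 2 := by
      apply pow_lt_pow_left₀ hξ (norm_nonneg _) two_ne_zero
    nlinarith [sq_nonneg (ξ (k + 1)), sq_nonneg (ξ (k + 2))]
  have h3 : (κs⁻¹ * (1 / 2 * ξ k)) ^ 2 = ξ k ^ 2 / (2 * κs) ^ 2 := by field_simp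
  rw [h3, sub_pos, div_lt_one (by positivity)]
  exact h2

lemma etaVec_apply (m : Fin 3) : etaVec θ κs ξ k l m =
    (1 / √(1 - (κs⁻¹ * (1 / 2 * ξ k)) ^ 2)) * (if m = k then 1 - (κs⁻¹ * (1 / 2 * ξ k)) ^ 2
      else -(κs⁻¹ * (1 / 2 * ξ k)) * (κs⁻¹ * zetaVec θ κs ξ k l m)) := by
  simp [etaVec, zetaVec_self]

/-- Transversality: the exponential solutions are divergence free. -/
lemma inner_eta_zeta (hκ : 0 < κs) (hξ : ‖ξ‖ < 2 * κs) :
    inner ℝ (etaVec θ κs ξ k l) (zetaVec θ κs ξ k l) = 0 := by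
  have h1 := norm_sq_cyclic (zetaVec θ κs ξ k l) k
  rw [norm_zetaVec θ k l hκ hξ, zetaVec_self] at h1
  rw [inner_cyclic _ _ k, etaVec_apply, etaVec_apply, etaVec_apply, if_pos rfl,
    if_neg (fin3_cases_ne k).1, if_neg (fin3_cases_ne k).2.1, zetaVec_self]
  have : κs⁻¹ ^ 2 * κs ^ 2 = 1 := by field_simp
  linear_combination (1 / √(1 - (κs⁻¹ * (1 / 2 * ξ k)) ^ 2)) * (1 / 2 * ξ k * κs⁻¹ ^ 2) * h1 -
    (1 / √(1 - (κs⁻¹ * (1 / 2 * ξ k)) ^ 2)) * (1 / 2 * ξ k) * this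

lemma norm_etaVec (hκ : 0 < κs) (hξ : ‖ξ‖ < 2 * κs) : ‖etaVec θ κs ξ k l‖ = 1 := by
  have h1 := norm_sq_cyclic (zetaVec θ κs ξ k l) k
  rw [norm_zetaVec θ k l hκ hξ, zetaVec_self] at h1
  have hp := one_sub_scaled_sq_pos k hκ hξ
  have : ‖etaVec θ κs ξ k l‖ ^ 2 = 1 := by
    rw [norm_sq_cyclic _ k, etaVec_apply, etaVec_apply, etaVec_apply, if_pos rfl,
      if_neg (fin3_cases_ne k).1, if_neg (fin3_cases_ne k).2.1]
    have hr : (1 / √(1 - (κs⁻¹ * (1 / 2 * ξ k)) ^ 2)) ^ 2 *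
        (1 - (κs⁻¹ * (1 / 2 * ξ k)) ^ 2) = 1 := by
      rw [div_pow, Real.sq_sqrt hp.le, one_pow, one_div_mul_cancel hp.ne']
    have hz : (κs⁻¹ * (1 / 2 * ξ k)) ^ 2 + (κs⁻¹ * zetaVec θ κs ξ k l (k + 1)) ^ 2 +
        (κs⁻¹ * zetaVec θ κs ξ k l (k + 2)) ^ 2 = 1 := by
      have : κs⁻¹ ^ 2 * κs ^ 2 = 1 := by field_simp
      linear_combination this - κs⁻¹ ^ 2 * h1
    generalize 1 / √(1 - (κs⁻¹ * (1 / 2 * ξ k)) ^ 2) = r at *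
    generalize κs⁻¹ * (1 / 2 * ξ k) = w at *
    linear_combination hr + r ^ 2 * w ^ 2 * hz
  exact (pow_left_inj₀ (norm_nonneg _) zero_le_one two_ne_zero).1 (by rw [this, one_pow])

end Zeta

section Matrix

variable (θ : Fin 3 → ℝ) {κs : ℝ} {ξ : E3} (k : Fin 3)

/-- The rescaled squared components `(ξ_k / 2κ_s)²`; this is also the square of the `k`-th component
of `ζ_l^{(k)} / κ_s`, for `l = 1` and `l = 2`. -/
def scaledSq (κs : ℝ) (ξ : E3) (k : Fin 3) : ℝ := (κs⁻¹ * (1 / 2 * ξ k)) ^ 2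

/-- The quantity `1 - |ξ|² / 4κ_s²`. It vanishes at `|ξ| = 2κ_s`, where the inverse coefficient matrices
are no longer uniformly bounded. -/
def scaledGap (κs : ℝ) (ξ : E3) : ℝ := 1 - (scaledSq κs ξ 0 + scaledSq κs ξ 1 + scaledSq κs ξ 2)

lemma scaledSq_nonneg (κs : ℝ) (ξ : E3) (k : Fin 3) : 0 ≤ scaledSq κs ξ k := sq_nonneg _

lemma scaledGap_cyclic : scaledGap κs ξ =
    1 - (scaledSq κs ξ k + scaledSq κs ξ (k + 1) + scaledSq κs ξ (k + 2)) := by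
  rw [scaledGap, ← sum_fin3_cyclic (scaledSq κs ξ) k, Fin.sum_univ_three]

lemma scaledGap_eq (hκ : 0 < κs) : scaledGap κs ξ = κs⁻¹ ^ 2 * (κs ^ 2 - ‖ξ‖ ^ 2 / 4) := by
  rw [norm_sq_cyclic ξ 0, scaledGap]
  simp only [scaledSq, zero_add]
  field_simp
  ring

lemma scaledGap_ge {β : ℝ} (hκ : 0 < κs) (hξ : ‖ξ‖ ≤ β * κs) :
    1 - β ^ 2 / 4 ≤ scaledGap κs ξ := by
  have : ‖ξ‖ ^ 2 ≤ (β * κs) ^ 2 := pow_le_pow_left₀ (norm_nonneg _) hξ 2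
  have h2 : κs⁻¹ ^ 2 * ‖ξ‖ ^ 2 ≤ κs⁻¹ ^ 2 * (β * κs) ^ 2 := by gcongr
  have h3 : κs⁻¹ ^ 2 * (β * κs) ^ 2 = β ^ 2 := by field_simp
  have h4 : κs⁻¹ ^ 2 * κs ^ 2 = 1 := by field_simp
  rw [scaledGap_eq hκ]
  nlinarith

lemma scaledGap_pos (hκ : 0 < κs) (hξ : ‖ξ‖ < 2 * κs) : 0 < scaledGap κs ξ := by
  rw [scaledGap_eq hκ]
  have := norm_nonneg ξ
  have : 0 < κs ^ 2 - ‖ξ‖ ^ 2 / 4 := by nlinarith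
  positivity

lemma coeffMatrix_self (hκ : 0 < κs) (hξ : ‖ξ‖ < 2 * κs) :
    coeffMatrix θ κs ξ k k = 1 - scaledSq κs ξ k := by
  have hp := one_sub_scaled_sq_pos k hκ hξ
  rw [coeffMatrix, Matrix.of_apply, etaVec_apply, etaVec_apply, if_pos rfl, if_pos rfl]
  have hr : (1 / √(1 - (κs⁻¹ * (1 / 2 * ξ k)) ^ 2)) ^ 2 *
      (1 - (κs⁻¹ * (1 / 2 * ξ k)) ^ 2) = 1 := by
    rw [div_pow, Real.sq_sqrt hp.le, one_pow, one_div_mul_cancel hp.ne']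
  rw [scaledSq]
  linear_combination (1 - (κs⁻¹ * (1 / 2 * ξ k)) ^ 2) * hr

/-- The square roots `±√(κ_s² - |ξ|²/4)` in `ζ_1` and `ζ_2` combine to a difference of squares, so that
the entries of the coefficient matrix are rational in the squares of the components. -/
lemma coeffMatrix_of_ne (hκ : 0 < κs) (hξ : ‖ξ‖ < 2 * κs) {m : Fin 3} (hm : m ≠ k) :
    coeffMatrix θ κs ξ k m * (1 - scaledSq κs ξ k) =
      scaledSq κs ξ k * (scaledSq κs ξ m - scaledGap κs ξ * alphaVec θ ξ k m ^ 2) := by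
  have hp := one_sub_scaled_sq_pos k hκ hξ
  have h0 : 0 ≤ κs ^ 2 - ‖ξ‖ ^ 2 / 4 := by nlinarith [norm_nonneg ξ]
  rw [coeffMatrix, Matrix.of_apply, etaVec_apply, etaVec_apply, if_neg hm, if_neg hm, zetaVec_apply,
    zetaVec_apply, if_pos rfl, if_neg one_ne_zero, scaledGap_eq hκ]
  have hr : (1 / √(1 - (κs⁻¹ * (1 / 2 * ξ k)) ^ 2)) ^ 2 *
      (1 - (κs⁻¹ * (1 / 2 * ξ k)) ^ 2) = 1 := by
    rw [div_pow, Real.sq_sqrt hp.le, one_pow, one_div_mul_cancel hp.ne']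
  have hs := Real.sq_sqrt h0
  simp only [scaledSq]
  generalize 1 / √(1 - (κs⁻¹ * (1 / 2 * ξ k)) ^ 2) = r at *
  generalize √(κs ^ 2 - ‖ξ‖ ^ 2 / 4) = s at *
  rw [← hs]
  linear_combination (κs⁻¹ * (1 / 2 * ξ k)) ^ 2 *
    ((κs⁻¹ * (1 / 2 * ξ m)) ^ 2 - κs⁻¹ ^ 2 * s ^ 2 * alphaVec θ ξ k m ^ 2) * hr

lemma abs_coeffMatrix_le_one (hκ : 0 < κs) (hξ : ‖ξ‖ < 2 * κs) (j : Fin 3) :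
    |coeffMatrix θ κs ξ k j| ≤ 1 := by
  rw [coeffMatrix, Matrix.of_apply, abs_mul]
  have h : ∀ l, |etaVec θ κs ξ k l j| ≤ 1 := fun l => by
    have := PiLp.norm_apply_le (etaVec θ κs ξ k l) j
    rwa [norm_etaVec θ k l hκ hξ, Real.norm_eq_abs] at this
  exact mul_le_one₀ (h 0) (abs_nonneg _) (h 1)

/-- The off-diagonal entries in terms of the rescaled squares alone. Off the `k`-th coordinate axis the
angle `θ_k` plays no role. -/
lemma coeffMatrix_mul_pair (hκ : 0 < κs) (hξ : ‖ξ‖ < 2 * κs)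
    (h : ¬(ξ (k + 1) = 0 ∧ ξ (k + 2) = 0)) :
    coeffMatrix θ κs ξ k (k + 1) *
        ((1 - scaledSq κs ξ k) * (scaledSq κs ξ (k + 1) + scaledSq κs ξ (k + 2))) =
      scaledSq κs ξ k * (scaledSq κs ξ (k + 1) * (scaledSq κs ξ (k + 1) + scaledSq κs ξ (k + 2))
        - scaledGap κs ξ * scaledSq κs ξ (k + 2)) ∧
    coeffMatrix θ κs ξ k (k + 2) *
        ((1 - scaledSq κs ξ k) * (scaledSq κs ξ (k + 1) + scaledSq κs ξ (k + 2))) =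
      scaledSq κs ξ k * (scaledSq κs ξ (k + 2) * (scaledSq κs ξ (k + 1) + scaledSq κs ξ (k + 2))
        - scaledGap κs ξ * scaledSq κs ξ (k + 1)) := by
  obtain ⟨h1, h2⟩ := alphaVec_sq_mul θ ξ k h
  have e1 := coeffMatrix_of_ne θ k hκ hξ (fin3_cases_ne k).1
  have e2 := coeffMatrix_of_ne θ k hκ hξ (fin3_cases_ne k).2.1
  have g1 : alphaVec θ ξ k (k + 1) ^ 2 * (scaledSq κs ξ (k + 1) + scaledSq κs ξ (k + 2)) =
      scaledSq κs ξ (k + 2) := by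
    simp only [scaledSq]; linear_combination κs⁻¹ ^ 2 / 4 * h1
  have g2 : alphaVec θ ξ k (k + 2) ^ 2 * (scaledSq κs ξ (k + 1) + scaledSq κs ξ (k + 2)) =
      scaledSq κs ξ (k + 1) := by
    simp only [scaledSq]; linear_combination κs⁻¹ ^ 2 / 4 * h2
  constructor
  · linear_combination (scaledSq κs ξ (k + 1) + scaledSq κs ξ (k + 2)) * e1 -
      scaledSq κs ξ k * scaledGap κs ξ * g1
  · linear_combination (scaledSq κs ξ (k + 1) + scaledSq κs ξ (k + 2)) * e2 -
      scaledSq κs ξ k * scaledGap κs ξ * g2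

/-- If `ξ_m = 0`, the `m`-th row is the `m`-th unit vector, whatever the angle. -/
lemma coeffMatrix_row_of_zero (hκ : 0 < κs) (hξ : ‖ξ‖ < 2 * κs) {m : Fin 3} (hm : ξ m = 0)
    (j : Fin 3) : coeffMatrix θ κs ξ m j = if j = m then 1 else 0 := by
  have h0 : scaledSq κs ξ m = 0 := by simp [scaledSq, hm]
  split_ifs with h
  · rw [h, coeffMatrix_self θ m hκ hξ, h0, sub_zero]
  · simpa [h0] using coeffMatrix_of_ne θ m hκ hξ h

lemma scaledGap_le_one_sub : scaledGap κs ξ ≤ 1 - scaledSq κs ξ k := by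
  rw [scaledGap_cyclic k]
  linarith [scaledSq_nonneg κs ξ (k + 1), scaledSq_nonneg κs ξ (k + 2)]

/-- Quantitative invertibility of the coefficient matrix: off the coordinate axes, clearing the positive
denominators turns the determinant into the polynomial of `det_polynomial_lower_bound`; on an axis two
rows are unit vectors. -/
lemma scaledGap_pow_le_det (hκ : 0 < κs) (hξ : ‖ξ‖ < 2 * κs) :
    scaledGap κs ξ ^ 6 ≤ (coeffMatrix θ κs ξ).det := by
  have hd := scaledGap_pos hκ hξ
  have ha := scaledSq_nonneg κs ξ
  have hle := fun k => scaledGap_le_one_sub (κs := κs) (ξ := ξ) k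
  by_cases hdeg : ∃ k : Fin 3, ξ (k + 1) = 0 ∧ ξ (k + 2) = 0
  · obtain ⟨k, hk1, hk2⟩ := hdeg
    have hdet : (coeffMatrix θ κs ξ).det = 1 - scaledSq κs ξ k := by
      have r1 := coeffMatrix_row_of_zero θ hκ hξ hk1
      have r2 := coeffMatrix_row_of_zero θ hκ hξ hk2
      have r0 := coeffMatrix_self θ k hκ hξ
      rw [Matrix.det_fin_three]
      fin_cases k <;> simp at r0 r1 r2 ⊢ <;> simp [r0, r1, r2]
    rw [hdet]
    have h1 : scaledGap κs ξ ≤ 1 := by linarith [hle k, ha k]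
    calc scaledGap κs ξ ^ 6 ≤ scaledGap κs ξ := pow_le_of_le_one hd.le h1 (by norm_num)
      _ ≤ _ := hle k
  · push Not at hdeg
    have hne : ∀ k : Fin 3, ¬(ξ (k + 1) = 0 ∧ ξ (k + 2) = 0) := fun k h => hdeg k h.1 h.2
    have p0 := coeffMatrix_mul_pair θ 0 hκ hξ (hne 0)
    have p1 := coeffMatrix_mul_pair θ 1 hκ hξ (hne 1)
    have p2 := coeffMatrix_mul_pair θ 2 hκ hξ (hne 2)
    have s0 := coeffMatrix_self θ 0 hκ hξ
    have s1 := coeffMatrix_self θ 1 hκ hξ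
    have s2 := coeffMatrix_self θ 2 hκ hξ
    -- the denominators of the off-diagonal entries are positive off the axes
    have pos : ∀ k : Fin 3, 0 < scaledSq κs ξ (k + 1) + scaledSq κs ξ (k + 2) := fun k => by
      have h1 : scaledSq κs ξ (k + 1) + scaledSq κs ξ (k + 2) =
        (κs⁻¹ / 2) ^ 2 * (ξ (k + 1) ^ 2 + ξ (k + 2) ^ 2) := by simp only [scaledSq]; ring
      rw [h1]; exact mul_pos (by positivity) (pair_sq_pos ξ k (hne k))
    have q0 := pos 0
    have q1 := pos 1
    have q2 := pos 2
    have key := det_polynomial_lower_bound _ _ _ _ (ha 0) (ha 1) (ha 2) hd.le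
    have t0 := hle 0
    have t1 := hle 1
    have t2 := hle 2
    have hS : scaledGap κs ξ = 1 - (scaledSq κs ξ 0 + scaledSq κs ξ 1 + scaledSq κs ξ 2) := rfl
    have u0 := ha 0
    have u1 := ha 1
    have u2 := ha 2
    simp only [Fin.isValue, zero_add, Fin.reduceAdd] at p0 p1 p2 q0 q1 q2
    rw [Matrix.det_fin_three]
    generalize scaledGap κs ξ = d at *
    generalize scaledSq κs ξ 0 = a at *
    generalize scaledSq κs ξ 1 = b at *
    generalize scaledSq κs ξ 2 = c at *
    rw [show b + c + d = 1 - a by linarith, show c + a + d = 1 - b by linarith,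
      show a + b + d = 1 - c by linarith] at key
    rw [← p0.1, ← p0.2, ← p1.1, ← p1.2, ← p2.1, ← p2.2] at key
    rw [s0, s1, s2]
    generalize coeffMatrix θ κs ξ 0 1 = A01 at *
    generalize coeffMatrix θ κs ξ 0 2 = A02 at *
    generalize coeffMatrix θ κs ξ 1 0 = A10 at *
    generalize coeffMatrix θ κs ξ 1 2 = A12 at *
    generalize coeffMatrix θ κs ξ 2 0 = A20 at *
    generalize coeffMatrix θ κs ξ 2 1 = A21 at *
    set δ := (1 - a) * (1 - b) * (1 - c) - (1 - a) * A12 * A21 - A01 * A10 * (1 - c) +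
      A01 * A12 * A20 + A02 * A10 * A21 - A02 * (1 - b) * A20 with hδ
    have h1 : d ^ 6 ≤ δ * ((1 - a) * (1 - b) * (1 - c)) := by
      refine le_of_mul_le_mul_right (key.trans (le_of_eq ?_)) (mul_pos (mul_pos q0 q1) q2)
      rw [hδ]; ring
    have hpos : 0 < (1 - a) * (1 - b) * (1 - c) :=
      mul_pos (mul_pos (by linarith) (by linarith)) (by linarith)
    have hone : (1 - a) * (1 - b) * (1 - c) ≤ 1 :=
      mul_le_one₀ (mul_le_one₀ (by linarith) (by linarith) (by linarith)) (by linarith)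
        (by linarith)
    have hδ0 : 0 < δ := by
      by_contra h
      have := mul_nonneg (neg_nonneg.2 (not_lt.1 h)) hpos.le
      have : 0 < d ^ 6 := by positivity
      linarith
    exact h1.trans (mul_le_of_le_one_right hδ0.le hone)

end Matrix

section Amplification

lemma isUnit_coeffMatrix (θ : Fin 3 → ℝ) {κs : ℝ} {ξ : E3} (hκ : 0 < κs) (hξ : ‖ξ‖ < 2 * κs) :
    IsUnit (coeffMatrix θ κs ξ) := by
  rw [Matrix.isUnit_iff_isUnit_det, isUnit_iff_ne_zero]
  have := scaledGap_pow_le_det θ hκ hξ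
  have := pow_pos (scaledGap_pos hκ hξ) 6
  linarith

lemma specNorm_le_of_entries (B : Matrix (Fin 3) (Fin 3) ℝ) (K : ℝ) (hB : ∀ i j, |B i j| ≤ K) :
    specNorm B ≤ 9 * K := by
  have hK : 0 ≤ K := (abs_nonneg _).trans (hB 0 0)
  refine ContinuousLinearMap.opNorm_le_bound _ (by positivity) fun v => ?_
  have h1 : ∀ i, ‖Matrix.toEuclideanCLM (𝕜 := ℝ) B v i‖ ≤ 3 * K * ‖v‖ := fun i => by
    rw [Matrix.ofLp_toEuclideanCLM, Matrix.mulVec, dotProduct]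
    refine (norm_sum_le _ _).trans ?_
    refine (Finset.sum_le_card_nsmul _ _ (K * ‖v‖) fun j _ => ?_).trans (le_of_eq ?_)
    · rw [norm_mul]
      exact mul_le_mul (hB i j) (PiLp.norm_apply_le v j) (norm_nonneg _) hK
    · simp; ring
  have h2 : ‖Matrix.toEuclideanCLM (𝕜 := ℝ) B v‖ ≤
      ∑ i, ‖Matrix.toEuclideanCLM (𝕜 := ℝ) B v i‖ := by
    refine abs_le_of_sq_le_sq' ?_ (by positivity) |>.2
    rw [EuclideanSpace.norm_sq_eq, Fin.sum_univ_three, Fin.sum_univ_three]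
    have := norm_nonneg (Matrix.toEuclideanCLM (𝕜 := ℝ) B v 0)
    have := norm_nonneg (Matrix.toEuclideanCLM (𝕜 := ℝ) B v 1)
    have := norm_nonneg (Matrix.toEuclideanCLM (𝕜 := ℝ) B v 2)
    nlinarith [mul_nonneg ‹0 ≤ ‖Matrix.toEuclideanCLM (𝕜 := ℝ) B v 0‖› ‹0 ≤ ‖Matrix.toEuclideanCLM (𝕜 := ℝ) B v 1‖›,
      mul_nonneg ‹0 ≤ ‖Matrix.toEuclideanCLM (𝕜 := ℝ) B v 0‖› ‹0 ≤ ‖Matrix.toEuclideanCLM (𝕜 := ℝ) B v 2‖›,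
      mul_nonneg ‹0 ≤ ‖Matrix.toEuclideanCLM (𝕜 := ℝ) B v 1‖› ‹0 ≤ ‖Matrix.toEuclideanCLM (𝕜 := ℝ) B v 2‖›]
  refine h2.trans ((Finset.sum_le_card_nsmul _ _ _ fun i _ => h1 i).trans (le_of_eq ?_))
  simp; ring

lemma condNumber_div_specNorm {B : Matrix (Fin 3) (Fin 3) ℝ} (hB : IsUnit B) :
    condNumber B / specNorm B = specNorm B⁻¹ := by
  have : specNorm B ≠ 0 := by
    rw [specNorm, norm_ne_zero_iff]
    intro h
    have : B = 0 := EmbeddingLike.map_eq_zero_iff.1 h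
    rw [this] at hB
    exact not_isUnit_zero hB
  rw [condNumber, mul_div_cancel_left₀ _ this]

/-- By Cramer's rule, with minors bounded by `2`. The bound depends on `β` only. -/
lemma specNorm_inv_le (θ : Fin 3 → ℝ) {κs β : ℝ} {ξ : E3} (hκ : 0 < κs) (hβ : β ∈ Set.Ioo (0 : ℝ) 2)
    (hξ : ‖ξ‖ ≤ β * κs) : specNorm (coeffMatrix θ κs ξ)⁻¹ ≤ 9 * (((1 - β ^ 2 / 4) ^ 6)⁻¹ * 2) := by
  have hξ2 : ‖ξ‖ < 2 * κs := hξ.trans_lt (by gcongr; exact hβ.2)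
  have hg : 0 < 1 - β ^ 2 / 4 := by nlinarith [hβ.1, hβ.2]
  have hdet : (1 - β ^ 2 / 4) ^ 6 ≤ (coeffMatrix θ κs ξ).det :=
    (pow_le_pow_left₀ hg.le (scaledGap_ge hκ hξ) 6).trans (scaledGap_pow_le_det θ hκ hξ2)
  have hd0 : 0 < (coeffMatrix θ κs ξ).det := (by positivity : (0 : ℝ) < _).trans_le hdet
  apply specNorm_le_of_entries
  intro i j
  have hadj : |(coeffMatrix θ κs ξ).adjugate i j| ≤ 2 := by
    have hb := fun i j => abs_coeffMatrix_le_one θ i hκ hξ2 j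
    have h2 : ∀ i j k l m n p q, |coeffMatrix θ κs ξ i j * coeffMatrix θ κs ξ k l -
        coeffMatrix θ κs ξ m n * coeffMatrix θ κs ξ p q| ≤ 2 := fun i j k l m n p q => by
      refine (abs_sub _ _).trans ?_
      rw [abs_mul, abs_mul]
      have := mul_le_one₀ (hb i j) (abs_nonneg _) (hb k l)
      have := mul_le_one₀ (hb m n) (abs_nonneg _) (hb p q)
      linarith
    rw [Matrix.adjugate_fin_three]
    fin_cases i <;> fin_cases j <;> simp <;>
      first | exact h2 _ _ _ _ _ _ _ _ | (rw [neg_add_eq_sub]; exact h2 _ _ _ _ _ _ _ _)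
  rw [Matrix.inv_def, Matrix.smul_apply, smul_eq_mul, abs_mul, Ring.inverse_eq_inv', abs_inv,
    abs_of_pos hd0]
  gcongr

/-- The set of amplification factors has a supremum, which bounds the spectral norms of the inverse
coefficient matrices. -/
lemma isLUB_amplification {β : ℝ} (hβ : β ∈ Set.Ioo (0 : ℝ) 2) :
    IsLUB (amplification β) (sSup (amplification β)) := by
  apply isLUB_csSup
  · refine ⟨_, 1, 0, EuclideanSpace.single 0 β, one_pos, ?_, ?_, rfl⟩
    · intro h
      have := congrArg (fun v : E3 => v 0) h
      simp at this
      exact hβ.1.ne' this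
    · simp [abs_of_pos hβ.1]
  · refine ⟨9 * (((1 - β ^ 2 / 4) ^ 6)⁻¹ * 2), ?_⟩
    rintro q ⟨κs, θ, ξ, hκ, -, hξ, rfl⟩
    rw [condNumber_div_specNorm (isUnit_coeffMatrix θ hκ (hξ.trans_lt (by gcongr; exact hβ.2)))]
    exact specNorm_inv_le θ hκ hβ hξ

lemma specNorm_inv_le_sSup (θ : Fin 3 → ℝ) {κs β : ℝ} {ξ : E3} (hκ : 0 < κs)
    (hβ : β ∈ Set.Ioo (0 : ℝ) 2) (hξ0 : ξ ≠ 0) (hξ : ‖ξ‖ ≤ β * κs) :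
    specNorm (coeffMatrix θ κs ξ)⁻¹ ≤ sSup (amplification β) := by
  rw [← condNumber_div_specNorm (isUnit_coeffMatrix θ hκ (hξ.trans_lt (by gcongr; exact hβ.2)))]
  exact (isLUB_amplification hβ).1 ⟨κs, θ, ξ, hκ, hξ0, hξ, rfl⟩

/-- A real matrix acts on `ℂ³` with its real spectral norm. -/
lemma norm_map_mulVec_le (B : Matrix (Fin 3) (Fin 3) ℝ) (w : Fin 3 → ℂ) :
    ‖(WithLp.toLp 2 (B.map (fun a : ℝ => (a : ℂ)) *ᵥ w) : C3)‖ ≤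
      specNorm B * ‖(WithLp.toLp 2 w : C3)‖ := by
  have hre : ∀ v : E3, ∑ i, (B *ᵥ v) i ^ 2 ≤ specNorm B ^ 2 * ∑ i, v i ^ 2 := fun v => by
    have h := (Matrix.toEuclideanCLM (𝕜 := ℝ) B).le_opNorm v
    have h2 := pow_le_pow_left₀ (norm_nonneg _) h 2
    rw [mul_pow, EuclideanSpace.norm_sq_eq, EuclideanSpace.norm_sq_eq] at h2
    simpa [Matrix.ofLp_toEuclideanCLM, specNorm] using h2
  have h1 := hre (WithLp.toLp 2 fun i => (w i).re)
  have h2 := hre (WithLp.toLp 2 fun i => (w i).im)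
  refine abs_le_of_sq_le_sq' ?_ (mul_nonneg (norm_nonneg _) (norm_nonneg _)) |>.2
  rw [mul_pow, EuclideanSpace.norm_sq_eq, EuclideanSpace.norm_sq_eq]
  have e1 : ∀ z : ℂ, ‖z‖ ^ 2 = z.re ^ 2 + z.im ^ 2 := fun z => by
    rw [Complex.sq_norm, Complex.normSq_apply]; ring
  simp only [e1, Finset.sum_add_distrib, mul_add]
  have e2 : ∀ i, ((B.map (fun a : ℝ => (a : ℂ)) *ᵥ w) i).re = (B *ᵥ fun i => (w i).re) i := by
    intro i; simp [Matrix.mulVec, dotProduct]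
  have e3 : ∀ i, ((B.map (fun a : ℝ => (a : ℂ)) *ᵥ w) i).im = (B *ᵥ fun i => (w i).im) i := by
    intro i; simp [Matrix.mulVec, dotProduct]
  simp only [e2, e3]
  exact add_le_add h1 h2

lemma map_inv_coeffMatrix {B : Matrix (Fin 3) (Fin 3) ℝ} (hB : IsUnit B) :
    (B.map (fun a : ℝ => (a : ℂ)))⁻¹ = B⁻¹.map (fun a : ℝ => (a : ℂ)) := by
  apply Matrix.inv_eq_left_inv
  have : (B⁻¹.map (Complex.ofRealHom)) * (B.map Complex.ofRealHom) = 1 := by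
    rw [← Matrix.map_mul, Matrix.nonsing_inv_mul _ ((Matrix.isUnit_iff_isUnit_det _).1 hB),
      Matrix.map_one _ (map_zero _) (map_one _)]
  exact this

end Amplification

/-! ### The surface measure of a sphere -/

section Surface
open Set Metric
open scoped Pointwise ENNReal

instance isFiniteMeasure_surfaceMeasure (R : ℝ) : IsFiniteMeasure (surfaceMeasure R) := by
  constructor
  have := measure_lt_top (((volume : Measure E3).toSphere).map
    (fun w : Metric.sphere (0 : E3) 1 => R • (w : E3))) univ
  rw [surfaceMeasure, Measure.smul_apply, smul_eq_mul]
  exact ENNReal.mul_lt_top ENNReal.ofReal_lt_top this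

lemma measurable_smul_sphere (R : ℝ) :
    Measurable (fun w : Metric.sphere (0 : E3) 1 => R • (w : E3)) :=
  (measurable_subtype_coe).const_smul R

lemma ae_mem_sphere {R : ℝ} (hR : 0 < R) : ∀ᵐ x ∂(surfaceMeasure R), x ∈ sphere (0 : E3) R := by
  refine Measure.ae_smul_measure ?_ _
  refine (ae_map_iff (p := fun x => x ∈ sphere (0 : E3) R)
    (measurable_smul_sphere R).aemeasurable isClosed_sphere.measurableSet).2 ?_
  refine Filter.Eventually.of_forall fun w => ?_
  simp [norm_smul, abs_of_pos hR]

lemma surfaceMeasure_restrict {R : ℝ} (hR : 0 < R) :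
    (surfaceMeasure R).restrict (sphere (0 : E3) R) = surfaceMeasure R :=
  Measure.restrict_eq_self_of_ae_mem (ae_mem_sphere hR)

lemma integral_surfaceMeasure {F : Type*} [NormedAddCommGroup F] [NormedSpace ℝ F] {R : ℝ}
    (hR : 0 < R) (f : E3 → F) :
    ∫ x, f x ∂(surfaceMeasure R) = R ^ 2 • ∫ x, f (R • x) ∂(surfaceMeasure 1) := by
  have h1 : MeasurableEmbedding (fun w : Metric.sphere (0 : E3) 1 => R • (w : E3)) :=
    (MeasurableEquiv.smul₀ R hR.ne').measurableEmbedding.comp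
      (MeasurableEmbedding.subtype_coe isClosed_sphere.measurableSet)
  have h2 : MeasurableEmbedding (fun w : Metric.sphere (0 : E3) 1 => (1 : ℝ) • (w : E3)) :=
    (MeasurableEquiv.smul₀ (1 : ℝ) one_ne_zero).measurableEmbedding.comp
      (MeasurableEmbedding.subtype_coe isClosed_sphere.measurableSet)
  rw [surfaceMeasure, surfaceMeasure, integral_smul_measure, integral_smul_measure,
    h1.integral_map, h2.integral_map, ENNReal.toReal_ofReal (by positivity)]
  simp

lemma surfaceMeasure_one_univ : (surfaceMeasure 1).real univ = 4 * Real.pi := by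
  rw [surfaceMeasure, measureReal_def, Measure.smul_apply,
    Measure.map_apply (measurable_smul_sphere 1) .univ]
  simp only [one_pow, ENNReal.ofReal_one, one_smul, smul_eq_mul, one_mul, preimage_univ,
    Measure.toSphere_apply_univ, finrank_euclideanSpace, Fintype.card_fin,
    EuclideanSpace.volume_ball_fin_three]
  rw [ENNReal.toReal_mul, ENNReal.toReal_ofReal (by positivity)]
  norm_num
  ring

/-- Rotation invariance of the surface measure. -/
lemma measurePreserving_surfaceMeasure (T : E3 ≃ₗᵢ[ℝ] E3) (R : ℝ) :
    MeasurePreserving T (surfaceMeasure R) (surfaceMeasure R) := by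
  refine ⟨T.continuous.measurable, ?_⟩
  rw [surfaceMeasure, Measure.map_smul, Measure.map_map T.continuous.measurable
    (measurable_smul_sphere R)]
  congr 1
  ext A hA
  rw [Measure.map_apply (T.continuous.measurable.comp (measurable_smul_sphere R)) hA,
    Measure.map_apply (measurable_smul_sphere R) hA,
    Measure.toSphere_apply' _ ((T.continuous.measurable.comp (measurable_smul_sphere R)) hA),
    Measure.toSphere_apply' _ (measurable_smul_sphere R hA)]
  congr 1
  rw [← T.measurePreserving.measure_preimage_emb T.toHomeomorph.measurableEmbedding
    (Ioo (0 : ℝ) 1 • (Subtype.val '' ((fun w : sphere (0 : E3) 1 => R • (w : E3)) ⁻¹' A)))]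
  congr 1
  ext x
  simp only [mem_smul, mem_image, mem_preimage]
  constructor
  · rintro ⟨r, hr, _, ⟨w, hw, rfl⟩, rfl⟩
    refine ⟨r, hr, T w, ⟨⟨T w, by simp⟩, ?_, rfl⟩, ?_⟩
    · simpa using hw
    · simp
  · rintro ⟨r, hr, _, ⟨w, hw, rfl⟩, h⟩
    refine ⟨r, hr, T.symm w, ⟨⟨T.symm w, by simp⟩, ?_, rfl⟩, ?_⟩
    · simpa using hw
    · apply T.injective
      simpa using h

lemma ContinuousOn.integrable_surface {F : Type*} [NormedAddCommGroup F] {R : ℝ} (hR : 0 < R)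
    {f : E3 → F} (hf : ContinuousOn f (sphere 0 R)) : Integrable f (surfaceMeasure R) := by
  rw [← surfaceMeasure_restrict hR]
  exact hf.integrableOn_compact (isCompact_sphere 0 R)

/-- Differentiation of a surface integral with respect to a parameter. -/
lemma hasDerivAt_surface_integral {R : ℝ} (hR : 0 < R) {a b t₀ : ℝ} (ht₀ : t₀ ∈ Ioo a b)
    {G G' : ℝ → E3 → ℂ} (hG : ∀ t ∈ Ioo a b, ContinuousOn (G t) (sphere 0 R))
    (hd : ∀ t ∈ Ioo a b, ∀ x ∈ sphere (0 : E3) R, HasDerivAt (fun t => G t x) (G' t x) t)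
    (hG' : ContinuousOn (fun p : ℝ × E3 => G' p.1 p.2) (Ioo a b ×ˢ sphere 0 R)) :
    HasDerivAt (fun t => ∫ x, G t x ∂(surfaceMeasure R)) (∫ x, G' t₀ x ∂(surfaceMeasure R)) t₀ := by
  obtain ⟨a', ha, hat⟩ := exists_between ht₀.1
  obtain ⟨b', hbt, hb⟩ := exists_between ht₀.2
  have hsub : Icc a' b' ⊆ Ioo a b := fun t ht => ⟨ha.trans_le ht.1, ht.2.trans_lt hb⟩
  obtain ⟨C, hC⟩ := (isCompact_Icc.prod (isCompact_sphere (0 : E3) R)).exists_bound_of_continuousOn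
    (hG'.mono (prod_mono hsub subset_rfl))
  have hnhds : Icc a' b' ∈ nhds t₀ := Icc_mem_nhds hat hbt
  refine (hasDerivAt_integral_of_dominated_loc_of_deriv_le (bound := fun _ => C) (F' := G')
    (s := Ioo a' b') (Ioo_mem_nhds hat hbt) ?_ (ContinuousOn.integrable_surface hR (hG t₀ ht₀)) ?_ ?_
    (integrable_const C) ?_).2
  · filter_upwards [hnhds] with t ht
    exact (ContinuousOn.integrable_surface hR (hG t (hsub ht))).1
  · refine (ContinuousOn.integrable_surface hR ?_).1
    exact hG'.comp (f := fun x : E3 => (t₀, x)) (by fun_prop) (fun x hx => ⟨ht₀, hx⟩)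
  · filter_upwards [ae_mem_sphere hR] with x hx t ht
    exact hC (t, x) ⟨Ioo_subset_Icc_self ht, hx⟩
  · filter_upwards [ae_mem_sphere hR] with x hx t ht
    exact hd t (hsub (Ioo_subset_Icc_self ht)) x hx

end Surface

section Partial
open Set Metric
open scoped ContDiff

/-! ### Partial derivatives -/

/-- The partial derivative in the direction of the `j`-th coordinate axis. -/
def pd (j : Fin 3) (f : E3 → ℂ) (x : E3) : ℂ := fderiv ℝ f x (unitVec j)

lemma pd_congr {f g : E3 → ℂ} {x : E3} (h : f =ᶠ[nhds x] g) (j : Fin 3) : pd j f x = pd j g x := by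
  rw [pd, h.fderiv_eq, pd]

lemma contDiffAt_pd {f : E3 → ℂ} {x : E3} (hf : ContDiffAt ℝ ∞ f x) (j : Fin 3) :
    ContDiffAt ℝ ∞ (pd j f) x :=
  (hf.fderiv_right (m := ∞) (by simp)).clm_apply contDiffAt_const

lemma differentiableAt_of_smooth {f : E3 → ℂ} {x : E3} (hf : ContDiffAt ℝ ∞ f x) :
    DifferentiableAt ℝ f x := hf.differentiableAt (by simp)

lemma fderiv_apply_eq_sum_pd (f : E3 → ℂ) (x v : E3) :
    fderiv ℝ f x v = ∑ j, (v j : ℂ) * pd j f x := by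
  have hv : v = ∑ j, v j • unitVec j := by
    ext i
    simp [unitVec, Finset.sum_apply, Pi.single_apply]
  conv_lhs => rw [hv]
  simp [map_sum, pd]

lemma pd_add {f g : E3 → ℂ} {x : E3} (hf : DifferentiableAt ℝ f x) (hg : DifferentiableAt ℝ g x)
    (j : Fin 3) : pd j (fun x => f x + g x) x = pd j f x + pd j g x := by
  simp only [pd]; rw [fderiv_fun_add hf hg]; simp

lemma pd_sub {f g : E3 → ℂ} {x : E3} (hf : DifferentiableAt ℝ f x) (hg : DifferentiableAt ℝ g x)
    (j : Fin 3) : pd j (fun x => f x - g x) x = pd j f x - pd j g x := by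
  simp only [pd]; rw [fderiv_fun_sub hf hg]; simp

lemma pd_mul {f g : E3 → ℂ} {x : E3} (hf : DifferentiableAt ℝ f x) (hg : DifferentiableAt ℝ g x)
    (j : Fin 3) : pd j (fun x => f x * g x) x = pd j f x * g x + f x * pd j g x := by
  simp only [pd]; rw [fderiv_fun_mul hf hg]; simp; ring

lemma pd_const_mul {f : E3 → ℂ} {x : E3} (hf : DifferentiableAt ℝ f x) (c : ℂ)
    (j : Fin 3) : pd j (fun x => c * f x) x = c * pd j f x := by
  simp only [pd]; rw [fderiv_const_mul hf]; simp

lemma pd_mul_const {f : E3 → ℂ} {x : E3} (hf : DifferentiableAt ℝ f x) (c : ℂ)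
    (j : Fin 3) : pd j (fun x => f x * c) x = pd j f x * c := by
  simp only [pd]; rw [fderiv_mul_const hf]; simp [mul_comm]

lemma pd_comm {f : E3 → ℂ} {x : E3} (hf : ContDiffAt ℝ ∞ f x) (i j : Fin 3) :
    pd i (pd j f) x = pd j (pd i f) x := by
  have h1 : DifferentiableAt ℝ (fderiv ℝ f) x :=
    (hf.fderiv_right (m := ∞) (by simp)).differentiableAt (by simp)
  have h : ∀ i j, pd i (pd j f) x = fderiv ℝ (fderiv ℝ f) x (unitVec i) (unitVec j) := by
    intro i j
    have : pd j f = fun x => fderiv ℝ f x (unitVec j) := rfl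
    rw [pd, this, fderiv_clm_apply h1 (differentiableAt_const _)]
    simp
  rw [h, h]
  exact (hf.isSymmSndFDerivAt (by
    simpa using WithTop.coe_le_coe.2 (le_top : (2 : ℕ∞) ≤ ⊤))).eq _ _

lemma pd_comp_sub (f : E3 → ℂ) (y : E3) (j : Fin 3) :
    pd j (fun x => f (x - y)) = fun x => pd j f (x - y) := by
  funext x
  simp only [pd]
  rw [fderiv_comp_sub]

lemma pd_coord (i j : Fin 3) (x : E3) : pd j (fun x : E3 => (x i : ℂ)) x = if i = j then 1 else 0 := by
  have h : HasFDerivAt (fun x : E3 => (x i : ℂ))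
      (Complex.ofRealCLM.comp (EuclideanSpace.proj (𝕜 := ℝ) i)) x :=
    (Complex.ofRealCLM.comp (EuclideanSpace.proj (𝕜 := ℝ) i)).hasFDerivAt
  rw [pd, h.fderiv]
  simp only [unitVec, ContinuousLinearMap.comp_apply, PiLp.proj_apply, PiLp.single_apply,
    Complex.ofRealCLM_apply]
  split_ifs <;> simp

lemma contDiff_coord (i : Fin 3) : ContDiff ℝ ∞ (fun x : E3 => (x i : ℂ)) :=
  (Complex.ofRealCLM.comp (EuclideanSpace.proj (𝕜 := ℝ) i)).contDiff

/-! ### Rotations -/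

/-- The rotation by the angle `t` in the plane of the coordinates `i ≠ j`. -/
def planeRotation (i j : Fin 3) (hij : i ≠ j) (t : ℝ) : E3 ≃ₗᵢ[ℝ] E3 :=
  LinearIsometry.toLinearIsometryEquiv
    { toFun := fun x => x + (Real.cos t - 1) • (x i • unitVec i + x j • unitVec j) +
        Real.sin t • (x i • unitVec j - x j • unitVec i)
      map_add' := fun x y => by
        ext m; simp; ring
      map_smul' := fun c x => by
        ext m; simp; ring
      norm_map' := fun x => by
        have h := Real.sin_sq_add_cos_sq t
        rw [← sq_eq_sq₀ (norm_nonneg _) (norm_nonneg _), EuclideanSpace.norm_sq_eq,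
          EuclideanSpace.norm_sq_eq, Fin.sum_univ_three, Fin.sum_univ_three]
        fin_cases i <;> fin_cases j <;> simp at hij <;> simp [unitVec] <;>
          first
          | linear_combination (x 0 ^ 2 + x 1 ^ 2) * h
          | linear_combination (x 0 ^ 2 + x 2 ^ 2) * h
          | linear_combination (x 1 ^ 2 + x 2 ^ 2) * h } rfl

lemma planeRotation_apply (i j : Fin 3) (hij : i ≠ j) (t : ℝ) (x : E3) :
    planeRotation i j hij t x = x + (Real.cos t - 1) • (x i • unitVec i + x j • unitVec j) +
        Real.sin t • (x i • unitVec j - x j • unitVec i) := rfl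

/-- The generators of rotations annihilate the surface integral over a centred sphere, because the
surface measure is rotation invariant. -/
lemma integral_rotation_generator {R : ℝ} (hR : 0 < R) {v : E3 → ℂ}
    (hv : ∀ x ∈ sphere (0 : E3) R, ContDiffAt ℝ ∞ v x) (i j : Fin 3) :
    ∫ x, ((x i : ℂ) * pd j v x - (x j : ℂ) * pd i v x) ∂(surfaceMeasure R) = 0 := by
  by_cases hij : i = j
  · simp [hij]
  set T := planeRotation i j hij with hT
  set T' : ℝ → E3 → E3 := fun t x => -Real.sin t • (x i • unitVec i + x j • unitVec j) +
    Real.cos t • (x i • unitVec j - x j • unitVec i) with hT'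
  have hTS : ∀ t, ∀ x ∈ sphere (0 : E3) R, T t x ∈ sphere (0 : E3) R := by
    intro t x hx; simpa using hx
  have hTd : ∀ t x, HasDerivAt (fun t => T t x) (T' t x) t := by
    intro t x
    simp only [hT, planeRotation_apply]
    have h1 := ((Real.hasDerivAt_cos t).sub_const 1).smul_const
      (x i • (unitVec i : E3) + x j • unitVec j)
    have h2 := (Real.hasDerivAt_sin t).smul_const (x i • (unitVec j : E3) - x j • unitVec i)
    exact (h1.const_add x).add h2
  have hTc : Continuous (fun p : ℝ × E3 => T p.1 p.2) := by
    simp only [hT, planeRotation_apply]; fun_prop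
  have hTc' : Continuous (fun p : ℝ × E3 => T' p.1 p.2) := by
    simp only [hT']; fun_prop
  have key := hasDerivAt_surface_integral hR (a := -1) (b := 1) (t₀ := 0) (by norm_num)
    (G := fun t x => v (T t x)) (G' := fun t x => fderiv ℝ v (T t x) (T' t x)) ?_ ?_ ?_
  · have hconst : ∀ t, ∫ x, v (T t x) ∂(surfaceMeasure R) = ∫ x, v x ∂(surfaceMeasure R) :=
      fun t => (measurePreserving_surfaceMeasure (T t) R).integral_comp
        (T t).toHomeomorph.measurableEmbedding v
    simp only [hconst] at key
    have h0 := key.unique (hasDerivAt_const (0 : ℝ) _)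
    rw [← h0]
    congr 1
    funext x
    have e1 : T 0 x = x := by simp [hT, planeRotation_apply]
    have e2 : T' 0 x = x i • unitVec j - x j • unitVec i := by simp [hT']
    rw [e1, e2, map_sub, map_smul, map_smul]
    simp [pd]
  · intro t _
    exact fun x hx => ((hv _ (hTS t x hx)).continuousAt.comp (f := fun x => T t x)
      (T t).continuous.continuousAt).continuousWithinAt
  · intro t _ x hx
    exact ((hv _ (hTS t x hx)).differentiableAt (by simp)).hasFDerivAt.comp_hasDerivAt t (hTd t x)
  · rintro ⟨t, x⟩ ⟨-, hx⟩
    have hc : ContinuousAt (fderiv ℝ v) (T t x) :=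
      ((hv _ (hTS t x hx)).fderiv_right (m := ∞) (by simp)).continuousAt
    have hc2 : ContinuousAt (fun p : ℝ × E3 => fderiv ℝ v (T p.1 p.2)) (t, x) :=
      ContinuousAt.comp (f := fun p : ℝ × E3 => T p.1 p.2) hc hTc.continuousAt
    exact (hc2.clm_apply hTc'.continuousAt).continuousWithinAt

/-- The exchange rule `∫ x_i ∂_j v ds = ∫ x_j ∂_i v ds` on a sphere. It takes the place of the divergence
theorem in all integrations by parts below. -/
lemma integral_coord_mul_pd_comm {R : ℝ} (hR : 0 < R) {v : E3 → ℂ}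
    (hv : ∀ x ∈ sphere (0 : E3) R, ContDiffAt ℝ ∞ v x) (i j : Fin 3) :
    ∫ x, (x i : ℂ) * pd j v x ∂(surfaceMeasure R) =
      ∫ x, (x j : ℂ) * pd i v x ∂(surfaceMeasure R) := by
  have hc : ∀ i j : Fin 3, Integrable (fun x : E3 => (x i : ℂ) * pd j v x) (surfaceMeasure R) :=
    fun i j => ContinuousOn.integrable_surface hR fun x hx =>
      ((contDiff_coord i).continuous.continuousAt.mul
        (contDiffAt_pd (hv x hx) j).continuousAt).continuousWithinAt
  rw [← sub_eq_zero, ← integral_sub (hc i j) (hc j i)]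
  exact integral_rotation_generator hR hv i j

end Partial

/-! ### Plane waves and the Helmholtz kernel -/

section Waves
open Set Metric Complex
open scoped ContDiff

/-- The scalar plane wave `e^{i ζ · x}`. -/
def planeWave (ζ x : E3) : ℂ := Complex.exp (Complex.I * ((inner ℝ ζ x : ℝ) : ℂ))

lemma contDiff_planeWave (ζ : E3) : ContDiff ℝ ∞ (planeWave ζ) := by
  have h : ContDiff ℝ ∞ (fun x : E3 => ((inner ℝ ζ x : ℝ) : ℂ)) :=
    (Complex.ofRealCLM.comp (innerSL ℝ ζ)).contDiff
  exact (contDiff_const.mul h).cexp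

lemma hasFDerivAt_planeWave (ζ x : E3) : HasFDerivAt (planeWave ζ)
    ((Complex.I * planeWave ζ x) • (Complex.ofRealCLM.comp (innerSL ℝ ζ))) x := by
  have h : HasFDerivAt (fun x : E3 => ((inner ℝ ζ x : ℝ) : ℂ))
      (Complex.ofRealCLM.comp (innerSL ℝ ζ)) x :=
    (Complex.ofRealCLM.comp (innerSL ℝ ζ)).hasFDerivAt
  have h2 : HasFDerivAt (planeWave ζ) _ x := (h.const_mul Complex.I).cexp
  rw [smul_smul, mul_comm] at h2
  exact h2

lemma pd_planeWave (ζ : E3) (j : Fin 3) :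
    pd j (planeWave ζ) = fun x => Complex.I * ζ j * planeWave ζ x := by
  funext x
  rw [pd, (hasFDerivAt_planeWave ζ x).fderiv]
  simp [unitVec, EuclideanSpace.inner_single_right]
  ring

lemma norm_planeWave (ζ x : E3) : ‖planeWave ζ x‖ = 1 := by
  rw [planeWave, mul_comm, Complex.norm_exp_ofReal_mul_I]

lemma planeWave_sub (ζ x y : E3) : planeWave ζ (x - y) = planeWave ζ x * planeWave ζ (-y) := by
  simp only [planeWave]
  rw [← Complex.exp_add, sub_eq_add_neg, inner_add_right]
  push_cast; ring_nf

lemma planeWave_mul_neg (ζ y : E3) : planeWave ζ y * planeWave ζ (-y) = 1 := by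
  rw [← planeWave_sub, sub_self]; simp [planeWave]

/-- The Helmholtz kernel centred at the origin. -/
def kernelH (k : ℝ) (z : E3) : ℂ := helmholtz k z 0

lemma helmholtz_eq_kernelH (k : ℝ) (x y : E3) : helmholtz k x y = kernelH k (x - y) := by
  simp [kernelH, helmholtz]

/-- The radial profile of the Helmholtz kernel: `g(z) = profileH |z|`. -/
def profileH (k r : ℝ) : ℂ :=
  -(1 / (4 * (Real.pi : ℂ))) * (Complex.exp (Complex.I * ((k * r : ℝ) : ℂ)) / (r : ℂ))

/-- The profile of the gradient of the Helmholtz kernel: `∇g(z) = profileG |z| z`. -/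
def profileG (k r : ℝ) : ℂ :=
  -(1 / (4 * (Real.pi : ℂ))) * (Complex.exp (Complex.I * ((k * r : ℝ) : ℂ)) *
    (Complex.I * k / (r : ℂ) ^ 2 - 1 / (r : ℂ) ^ 3))

lemma kernelH_eq (k : ℝ) (z : E3) : kernelH k z = profileH k ‖z‖ := by
  simp [kernelH, helmholtz, profileH]

lemma hasDerivAt_exp_profile (k r : ℝ) :
    HasDerivAt (fun r : ℝ => Complex.exp (Complex.I * ((k * r : ℝ) : ℂ)))
      (Complex.exp (Complex.I * ((k * r : ℝ) : ℂ)) * (Complex.I * k)) r := by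
  have h1 : HasDerivAt (fun r : ℝ => ((k * r : ℝ) : ℂ)) (k : ℂ) r := by
    simpa using ((hasDerivAt_id r).const_mul k).ofReal_comp
  exact (h1.const_mul Complex.I).cexp

lemma hasDerivAt_profileH (k : ℝ) {r : ℝ} (hr : r ≠ 0) :
    HasDerivAt (profileH k) (profileG k r * r) r := by
  have hr' : (r : ℂ) ≠ 0 := by exact_mod_cast hr
  have h2 : HasDerivAt (fun r : ℝ => (r : ℂ)) 1 r := (hasDerivAt_id r).ofReal_comp
  have h : HasDerivAt (profileH k) _ r := ((hasDerivAt_exp_profile k r).div h2 hr').const_mul (-(1 / (4 * (Real.pi : ℂ))))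
  convert h using 1
  rw [profileG]
  field_simp

lemma hasDerivAt_profileG (k : ℝ) {r : ℝ} (hr : r ≠ 0) :
    HasDerivAt (profileG k) ((-(k : ℂ) ^ 2 * profileH k r - 3 * profileG k r) / r) r := by
  have hr' : (r : ℂ) ≠ 0 := by exact_mod_cast hr
  have h2 : HasDerivAt (fun r : ℝ => (r : ℂ)) 1 r := (hasDerivAt_id r).ofReal_comp
  have h3 := ((hasDerivAt_const r (Complex.I * (k : ℂ))).div (h2.pow 2) (pow_ne_zero 2 hr')).sub
    ((hasDerivAt_const r (1 : ℂ)).div (h2.pow 3) (pow_ne_zero 3 hr'))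
  have h : HasDerivAt (profileG k) _ r := ((hasDerivAt_exp_profile k r).mul h3).const_mul (-(1 / (4 * (Real.pi : ℂ))))
  simp only [Pi.pow_apply, Pi.sub_apply, Pi.div_apply, Nat.cast_ofNat] at h
  convert h using 1
  rw [profileG, profileH]
  field_simp
  ring_nf
  simp only [Complex.I_sq]
  ring

lemma pd_radial {F : ℝ → ℂ} {F' : ℂ} {z : E3} (hz : z ≠ 0) (hF : HasDerivAt F (F' * ‖z‖) ‖z‖)
    (j : Fin 3) : pd j (fun z => F ‖z‖) z = F' * z j := by
  have hz' : ‖z‖ ≠ 0 := norm_ne_zero_iff.2 hz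
  have hn := ((hasStrictFDerivAt_norm_sq z).hasFDerivAt).sqrt (by positivity)
  simp only [Real.sqrt_sq (norm_nonneg _)] at hn
  have h : HasFDerivAt (fun z : E3 => F ‖z‖) _ z := hF.hasFDerivAt.comp z hn
  have hz'' : (‖z‖ : ℂ) ≠ 0 := by simpa using hz
  rw [pd, h.fderiv]
  simp [unitVec, EuclideanSpace.inner_single_right]
  field_simp

lemma contDiffAt_kernelH (k : ℝ) {z : E3} (hz : z ≠ 0) : ContDiffAt ℝ ∞ (kernelH k) z := by
  have hn : ContDiffAt ℝ ∞ (fun z : E3 => ‖z‖) z := contDiffAt_norm ℝ hz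
  have e : kernelH k = fun z => profileH k ‖z‖ := funext (kernelH_eq k)
  have h1 : ContDiffAt ℝ ∞ (fun z : E3 => ((‖z‖ : ℝ) : ℂ)) z :=
    Complex.ofRealCLM.contDiff.contDiffAt.comp z hn
  have h2 : ContDiffAt ℝ ∞ (fun z : E3 => ((k * ‖z‖ : ℝ) : ℂ)) z :=
    Complex.ofRealCLM.contDiff.contDiffAt.comp z (contDiffAt_const.mul hn)
  have h3 : ((‖z‖ : ℝ) : ℂ) ≠ 0 := by simpa using hz
  rw [e]
  have h4 : ContDiffAt ℝ ∞ (fun z : E3 => ((‖z‖ : ℝ) : ℂ)⁻¹) z := h1.inv h3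
  exact contDiffAt_const.mul ((contDiffAt_const.mul h2).cexp.mul h4)

lemma pd_kernelH (k : ℝ) {z : E3} (hz : z ≠ 0) (j : Fin 3) :
    pd j (kernelH k) z = profileG k ‖z‖ * z j := by
  rw [show kernelH k = fun z => profileH k ‖z‖ from funext (kernelH_eq k)]
  exact pd_radial hz (hasDerivAt_profileH k (norm_ne_zero_iff.2 hz)) j

/-- The Helmholtz equation `Δg + k² g = 0` off the origin. -/
lemma laplacian_kernelH (k : ℝ) {z : E3} (hz : z ≠ 0) :
    ∑ j, pd j (pd j (kernelH k)) z = -(k : ℂ) ^ 2 * kernelH k z := by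
  have hz' : (‖z‖ : ℂ) ≠ 0 := by simpa using hz
  have hn : ∀ᶠ w in nhds z, w ≠ 0 := isOpen_ne.mem_nhds hz
  have hG := hasDerivAt_profileG k (norm_ne_zero_iff.2 hz)
  have hdG : DifferentiableAt ℝ (fun z : E3 => profileG k ‖z‖) z :=
    hG.differentiableAt.comp z
      ((contDiffAt_norm ℝ hz (n := 1)).differentiableAt (by simp))
  have h1 : ∀ j, pd j (pd j (kernelH k)) z =
      (-(k : ℂ) ^ 2 * profileH k ‖z‖ - 3 * profileG k ‖z‖) / (‖z‖ : ℂ) ^ 2 * z j * z j +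
        profileG k ‖z‖ := fun j => by
    rw [pd_congr (g := fun z => profileG k ‖z‖ * z j) (hn.mono fun w hw => pd_kernelH k hw j),
      pd_mul hdG (differentiableAt_of_smooth (contDiff_coord j).contDiffAt), pd_coord, if_pos rfl,
      pd_radial hz (F' := (-(k : ℂ) ^ 2 * profileH k ‖z‖ - 3 * profileG k ‖z‖) / (‖z‖ : ℂ) ^ 2)]
    · ring
    · convert hG using 1; field_simp
  have h2 : (z 0 : ℂ) * z 0 + z 1 * z 1 + z 2 * z 2 = (‖z‖ : ℂ) ^ 2 := by
    have := norm_sq_cyclic z 0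
    rw [← Complex.ofReal_pow, this]; push_cast; ring_nf
  rw [Fin.sum_univ_three, h1, h1, h1, kernelH_eq]
  field_simp
  linear_combination (-(k : ℂ) ^ 2 * profileH k ‖z‖ - 3 * profileG k ‖z‖) * h2

end Waves

/-! ### The scalar Green representation -/

section ScalarGreen
open Set Metric Complex
open scoped ContDiff

lemma ne_of_mem_sphere_of_norm_lt {R : ℝ} {x y : E3} (hx : x ∈ sphere (0 : E3) R) (hy : ‖y‖ < R) :
    x - y ≠ 0 := by
  intro h
  rw [sub_eq_zero] at h
  rw [mem_sphere_zero_iff_norm, h] at hx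
  linarith

/-- Spherical means of a plane wave with weights `(i ζ · ω)^n`. -/
def waveMoment (ζ : E3) (n : ℕ) (r : ℝ) : ℂ :=
  ∫ w, (Complex.I * ((inner ℝ ζ w : ℝ) : ℂ)) ^ n * planeWave (r • ζ) w ∂(surfaceMeasure 1)

lemma hasDerivAt_waveMoment (ζ : E3) (n : ℕ) (r : ℝ) :
    HasDerivAt (waveMoment ζ n) (waveMoment ζ (n + 1) r) r := by
  refine hasDerivAt_surface_integral one_pos (a := r - 1) (b := r + 1) (t₀ := r) (by simp)
    (G := fun r w => (Complex.I * ((inner ℝ ζ w : ℝ) : ℂ)) ^ n * planeWave (r • ζ) w)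
    (G' := fun r w => (Complex.I * ((inner ℝ ζ w : ℝ) : ℂ)) ^ (n + 1) * planeWave (r • ζ) w) ?_ ?_ ?_
  · intro t _
    simp only [planeWave]
    fun_prop
  · intro t _ x _
    have h1 : HasDerivAt (fun t : ℝ => planeWave (t • ζ) x)
        (planeWave (t • ζ) x * (Complex.I * ((inner ℝ ζ x : ℝ) : ℂ))) t := by
      have h0 : HasDerivAt (fun t : ℝ => ((inner ℝ (t • ζ) x : ℝ) : ℂ))
          ((inner ℝ ζ x : ℝ) : ℂ) t := by
        simp only [inner_smul_left]
        simpa using ((hasDerivAt_id t).mul_const (inner ℝ ζ x)).ofReal_comp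
      exact (h0.const_mul Complex.I).cexp
    exact (h1.const_mul ((Complex.I * ((inner ℝ ζ x : ℝ) : ℂ)) ^ n)).congr_deriv (by ring)
  · simp only [planeWave]
    fun_prop

/-- The ordinary differential equation of the spherical mean of a plane wave; it expresses the
Helmholtz equation through rotation generators. -/
lemma waveMoment_ode (ζ : E3) (r : ℝ) :
    r * waveMoment ζ 2 r + 2 * waveMoment ζ 1 r = -(r * (‖ζ‖ : ℂ) ^ 2) * waveMoment ζ 0 r := by
  have hv : ∀ j, ∀ x ∈ sphere (0 : E3) 1,
      ContDiffAt ℝ ∞ (fun w : E3 => (w j : ℂ) * planeWave (r • ζ) w) x := fun j x _ =>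
    (contDiff_coord j).contDiffAt.mul (contDiff_planeWave _).contDiffAt
  have hpd : ∀ i j x, pd i (fun w : E3 => (w j : ℂ) * planeWave (r • ζ) w) x =
      (if j = i then 1 else 0) * planeWave (r • ζ) x + x j * (Complex.I * (r * ζ i) * planeWave (r • ζ) x) := by
    intro i j x
    rw [pd_mul (differentiableAt_of_smooth (contDiff_coord j).contDiffAt)
      (differentiableAt_of_smooth (contDiff_planeWave _).contDiffAt), pd_coord, pd_planeWave]
    simp
  have hint : ∀ n, Integrable (fun w => (Complex.I * ((inner ℝ ζ w : ℝ) : ℂ)) ^ n *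
      planeWave (r • ζ) w) (surfaceMeasure 1) := fun n => by
    apply ContinuousOn.integrable_surface one_pos
    simp only [planeWave]
    fun_prop
  -- the rotation generators applied to the field `w ↦ w_j e^{i r ζ · w}` and contracted with `ζ`
  have hsum : ∑ i, ∑ j, ζ i * ∫ x, ((x i : ℂ) * pd j (fun w : E3 => (w j : ℂ) * planeWave (r • ζ) w) x -
      (x j : ℂ) * pd i (fun w : E3 => (w j : ℂ) * planeWave (r • ζ) w) x) ∂(surfaceMeasure 1) = 0 := by
    refine Finset.sum_eq_zero fun i _ => Finset.sum_eq_zero fun j _ => ?_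
    rw [integral_rotation_generator one_pos (hv j), mul_zero]
  have hI : ∀ i j, Integrable (fun x : E3 => ((x i : ℂ) * pd j (fun w : E3 => (w j : ℂ) * planeWave (r • ζ) w) x -
      (x j : ℂ) * pd i (fun w : E3 => (w j : ℂ) * planeWave (r • ζ) w) x)) (surfaceMeasure 1) := by
    intro i j
    apply ContinuousOn.integrable_surface one_pos
    simp only [hpd]
    simp only [planeWave]
    fun_prop
  simp only [← integral_const_mul] at hsum
  simp only [← integral_finsetSum _ fun j _ => (hI _ j).const_mul _] at hsum
  rw [← integral_finsetSum _ fun i _ => integrable_finsetSum _ fun j _ => (hI i j).const_mul _] at hsum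
  rw [← sub_eq_zero]
  have e : ∀ n : ℕ, ∀ c : ℂ, c * waveMoment ζ n r = ∫ w, c * ((Complex.I * ((inner ℝ ζ w : ℝ) : ℂ)) ^ n *
      planeWave (r • ζ) w) ∂(surfaceMeasure 1) := fun n c => by rw [integral_const_mul, waveMoment]
  have hadd : Integrable (fun w => (r : ℂ) * ((Complex.I * ((inner ℝ ζ w : ℝ) : ℂ)) ^ 2 *
      planeWave (r • ζ) w) + 2 * ((Complex.I * ((inner ℝ ζ w : ℝ) : ℂ)) ^ 1 *
      planeWave (r • ζ) w)) (surfaceMeasure 1) := ((hint 2).const_mul _).add ((hint 1).const_mul _)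
  rw [e, e, e, ← integral_add ((hint 2).const_mul _) ((hint 1).const_mul _),
    ← integral_sub hadd ((hint 0).const_mul _)]
  rw [← mul_zero Complex.I, ← hsum, ← integral_const_mul]
  refine integral_congr_ae ?_
  filter_upwards [ae_mem_sphere one_pos] with x hx
  have hx1 : (x 0 : ℂ) ^ 2 + (x 1 : ℂ) ^ 2 + (x 2 : ℂ) ^ 2 = 1 := by
    have := norm_sq_cyclic x 0
    rw [mem_sphere_zero_iff_norm.1 hx] at this
    exact_mod_cast this.symm.trans (one_pow 2)
  have hz : (‖ζ‖ : ℂ) ^ 2 = (ζ 0 : ℂ) ^ 2 + (ζ 1 : ℂ) ^ 2 + (ζ 2 : ℂ) ^ 2 := by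
    have := norm_sq_cyclic ζ 0
    exact_mod_cast this
  have hin : ((inner ℝ ζ x : ℝ) : ℂ) = ζ 0 * x 0 + ζ 1 * x 1 + ζ 2 * x 2 := by
    have := inner_cyclic ζ x 0
    exact_mod_cast this
  simp only [hpd, Fin.sum_univ_three, hin, hz]
  simp only [if_neg (by decide : ¬(2 : Fin 3) = 0), if_neg (by decide : ¬(0 : Fin 3) = 2),
    if_neg (by decide : ¬(2 : Fin 3) = 1), if_neg (by decide : ¬(1 : Fin 3) = 2),
    if_neg (by decide : ¬(0 : Fin 3) = 1), if_neg (by decide : ¬(1 : Fin 3) = 0), if_true]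
  have hI2 := Complex.I_sq
  generalize planeWave (r • ζ) x = e
  linear_combination (-(r * ((ζ 0 : ℂ) ^ 2 + (ζ 1 : ℂ) ^ 2 + (ζ 2 : ℂ) ^ 2) * e)) * hx1 +
    (r * ((ζ 0 : ℂ) ^ 2 + (ζ 1 : ℂ) ^ 2 + (ζ 2 : ℂ) ^ 2) * e *
      ((x 0 : ℂ) ^ 2 + (x 1 : ℂ) ^ 2 + (x 2 : ℂ) ^ 2)) * hI2

lemma waveMoment_zero (ζ : E3) : waveMoment ζ 0 0 = 4 * Real.pi := by
  have : waveMoment ζ 0 0 = ((surfaceMeasure 1).real univ : ℂ) := by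
    simp [waveMoment, planeWave]
  rw [this, surfaceMeasure_one_univ]
  push_cast; rfl

/-- The Wronskian of the radial Helmholtz kernel and the spherical mean of a plane wave with the same
wave number: it is constant, since both solve the same radial equation, and its value is found at the
centre. -/
lemma wronskian_eq_one {k : ℝ} {ζ : E3} (hζ : ‖ζ‖ = k) {r : ℝ} (hr : r ≠ 0) :
    (r : ℂ) ^ 2 * (profileG k r * r * waveMoment ζ 0 r - profileH k r * waveMoment ζ 1 r) = 1 := by
  -- with `p = r g` and `q = r M` the Wronskian `p' q - p q'` is smooth up to `r = 0`
  set p : ℝ → ℂ := fun r => -(1 / (4 * (Real.pi : ℂ))) * Complex.exp (Complex.I * ((k * r : ℝ) : ℂ))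
    with hp
  have dp : ∀ r, HasDerivAt p (Complex.I * k * p r) r := fun r => by
    exact ((hasDerivAt_exp_profile k r).const_mul (-(1 / (4 * (Real.pi : ℂ))))).congr_deriv
      (by simp only [hp]; ring)
  set V : ℝ → ℂ := fun r => Complex.I * k * p r * (r * waveMoment ζ 0 r) -
    p r * (waveMoment ζ 0 r + r * waveMoment ζ 1 r) with hV
  have dV : ∀ r, HasDerivAt V 0 r := fun r => by
    have hr : HasDerivAt (fun r : ℝ => (r : ℂ)) 1 r := (hasDerivAt_id r).ofReal_comp
    have h0 := hasDerivAt_waveMoment ζ 0 r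
    have h1 := hasDerivAt_waveMoment ζ 1 r
    have h := (((dp r).const_mul (Complex.I * k)).mul (hr.mul h0)).sub
      ((dp r).mul (h0.add (hr.mul h1)))
    refine h.congr_deriv ?_
    have ode := waveMoment_ode ζ r
    rw [hζ] at ode
    have hI2 := Complex.I_sq
    simp only [Pi.mul_apply, Pi.add_apply]
    linear_combination (-p r) * ode + (k ^ 2 * p r * (r * waveMoment ζ 0 r)) * hI2
  have hVr : V r = V 0 := is_const_of_deriv_eq_zero (fun r => (dV r).differentiableAt)
    (fun r => (dV r).deriv) r 0
  have hV0 : V 0 = 1 := by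
    have : (Real.pi : ℂ) ≠ 0 := by exact_mod_cast Real.pi_ne_zero
    simp only [hV, hp, waveMoment_zero]
    simp
    field_simp
  rw [← hV0, ← hVr]
  have hr' : (r : ℂ) ≠ 0 := by exact_mod_cast hr
  simp only [hV, hp, profileG, profileH]
  field_simp
  ring

/-- The field `∇g E - g ∇E`, where `g` is the Helmholtz kernel and `E` a plane wave. -/
def greenField (k : ℝ) (ζ : E3) (i : Fin 3) (z : E3) : ℂ :=
  pd i (kernelH k) z * planeWave ζ z - kernelH k z * (Complex.I * ζ i * planeWave ζ z)

lemma contDiffAt_greenField (k : ℝ) (ζ : E3) (i : Fin 3) {z : E3} (hz : z ≠ 0) :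
    ContDiffAt ℝ ∞ (greenField k ζ i) z :=
  ((contDiffAt_pd (contDiffAt_kernelH k hz) i).mul (contDiff_planeWave ζ).contDiffAt).sub
    ((contDiffAt_kernelH k hz).mul (contDiffAt_const.mul (contDiff_planeWave ζ).contDiffAt))

lemma div_greenField {k : ℝ} {ζ : E3} (hζ : ‖ζ‖ = k) {z : E3} (hz : z ≠ 0) :
    ∑ i, pd i (greenField k ζ i) z = 0 := by
  have hk := contDiffAt_kernelH k hz
  have hE : ContDiffAt ℝ ∞ (planeWave ζ) z := (contDiff_planeWave ζ).contDiffAt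
  have h : ∀ i, pd i (greenField k ζ i) z = pd i (pd i (kernelH k)) z * planeWave ζ z +
      kernelH k z * (ζ i : ℂ) ^ 2 * planeWave ζ z := fun i => by
    have h1 := differentiableAt_of_smooth ((contDiffAt_pd hk i).mul hE)
    have h2 := differentiableAt_of_smooth (hk.mul (contDiffAt_const.mul hE) :
      ContDiffAt ℝ ∞ (fun z => kernelH k z * (Complex.I * ζ i * planeWave ζ z)) z)
    have hE' := differentiableAt_of_smooth hE
    unfold greenField
    rw [pd_sub h1 h2, pd_mul (differentiableAt_of_smooth (contDiffAt_pd hk i)) hE',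
      pd_mul (differentiableAt_of_smooth hk) (hE'.const_mul _), pd_const_mul hE', pd_planeWave]
    linear_combination (-(kernelH k z * (ζ i : ℂ) ^ 2 * planeWave ζ z)) * Complex.I_sq
  have hz2 : (k : ℂ) ^ 2 = (ζ 0 : ℂ) ^ 2 + (ζ 1 : ℂ) ^ 2 + (ζ 2 : ℂ) ^ 2 := by
    have := norm_sq_cyclic ζ 0
    rw [hζ] at this
    exact_mod_cast this
  have hl := laplacian_kernelH k hz
  simp only [h, Fin.sum_univ_three] at hl ⊢
  linear_combination planeWave ζ z * hl + kernelH k z * planeWave ζ z * (-hz2)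

/-- The flux of the divergence-free field `greenField (· - t y)` does not change while its
singularity `t y` moves inside the ball. -/
lemma flux_greenField {k R : ℝ} (hR : 0 < R) {ζ : E3} (hζ : ‖ζ‖ = k) {y : E3} (hy : ‖y‖ < R) :
    ∫ x, ∑ i, (x i : ℂ) * greenField k ζ i (x - y) ∂(surfaceMeasure R) =
      ∫ x, ∑ i, (x i : ℂ) * greenField k ζ i x ∂(surfaceMeasure R) := by
  -- a parameter interval around `[0, 1]` on which `t y` stays inside the ball
  set b : ℝ := 2 * R / (R + ‖y‖) with hb
  have hRy : 0 < R + ‖y‖ := by positivity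
  have hb1 : 1 < b := by rw [hb, one_lt_div hRy]; linarith
  have hby : b * ‖y‖ < R := by
    rw [hb, div_mul_eq_mul_div, div_lt_iff₀ hRy]; nlinarith [norm_nonneg y]
  have hty : ∀ t ∈ Ioo (-b) b, ‖t • y‖ < R := fun t ht => by
    rw [norm_smul, Real.norm_eq_abs]
    exact (mul_le_mul_of_nonneg_right (abs_le.2 ⟨ht.1.le, ht.2.le⟩) (norm_nonneg y)).trans_lt hby
  have hne : ∀ t ∈ Ioo (-b) b, ∀ x ∈ sphere (0 : E3) R, x - t • y ≠ 0 := fun t ht x hx =>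
    ne_of_mem_sphere_of_norm_lt hx (hty t ht)
  have hsm : ∀ t ∈ Ioo (-b) b, ∀ x ∈ sphere (0 : E3) R, ∀ i,
      ContDiffAt ℝ ∞ (fun x => greenField k ζ i (x - t • y)) x := fun t ht x hx i =>
    (contDiffAt_greenField k ζ i (hne t ht x hx)).comp (f := fun x => x - t • y) x
      (contDiffAt_id.sub contDiffAt_const)
  have key : ∀ t ∈ Ioo (-b) b, HasDerivAt
      (fun t => ∫ x, ∑ i, (x i : ℂ) * greenField k ζ i (x - t • y) ∂(surfaceMeasure R)) 0 t := by
    intro t ht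
    have h := hasDerivAt_surface_integral hR (a := -b) (b := b) ht
      (G := fun t x => ∑ i, (x i : ℂ) * greenField k ζ i (x - t • y))
      (G' := fun t x => ∑ i, (x i : ℂ) * -(∑ j, (y j : ℂ) * pd j (greenField k ζ i) (x - t • y)))
      ?_ ?_ ?_
    · convert h using 1
      have hint : ∀ i j, Integrable (fun x : E3 => (x i : ℂ) * pd j (greenField k ζ i) (x - t • y))
          (surfaceMeasure R) := fun i j => ContinuousOn.integrable_surface hR fun x hx => by
        have := contDiffAt_pd (hsm t ht x hx i) j
        rw [pd_comp_sub] at this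
        exact ((contDiff_coord i).continuous.continuousAt.mul this.continuousAt).continuousWithinAt
      have hint' : ∀ i j, Integrable (fun x : E3 => (x j : ℂ) * pd i (greenField k ζ i) (x - t • y))
          (surfaceMeasure R) := fun i j => ContinuousOn.integrable_surface hR fun x hx => by
        have := contDiffAt_pd (hsm t ht x hx i) i
        rw [pd_comp_sub] at this
        exact ((contDiff_coord j).continuous.continuousAt.mul this.continuousAt).continuousWithinAt
      have e1 : ∀ x : E3, ∑ i, (x i : ℂ) * -(∑ j, (y j : ℂ) * pd j (greenField k ζ i) (x - t • y)) =
          ∑ i, ∑ j, -(y j : ℂ) * ((x i : ℂ) * pd j (greenField k ζ i) (x - t • y)) := fun x => by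
        simp only [Fin.sum_univ_three]; ring
      simp only [e1]
      rw [integral_finsetSum _ fun i _ => integrable_finsetSum _ fun j _ => (hint i j).const_mul _]
      -- exchanging `x_i ∂_j` for `x_j ∂_i` produces the divergence of the field
      have e2 : ∀ i, ∫ x, ∑ j, -(y j : ℂ) * ((x i : ℂ) * pd j (greenField k ζ i) (x - t • y))
          ∂(surfaceMeasure R) =
          ∫ x, ∑ j, -(y j : ℂ) * ((x j : ℂ) * pd i (greenField k ζ i) (x - t • y))
          ∂(surfaceMeasure R) := fun i => by
        rw [integral_finsetSum _ fun j _ => (hint i j).const_mul _,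
          integral_finsetSum _ fun j _ => (hint' i j).const_mul _]
        refine Finset.sum_congr rfl fun j _ => ?_
        rw [integral_const_mul, integral_const_mul]
        have := integral_coord_mul_pd_comm hR (fun x hx => hsm t ht x hx i) i j
        simp only [pd_comp_sub] at this
        rw [this]
      simp only [e2]
      rw [← integral_finsetSum _ fun i _ => integrable_finsetSum _ fun j _ =>
        (hint' i j).const_mul _]
      refine (integral_eq_zero_of_ae ?_).symm
      filter_upwards [ae_mem_sphere hR] with x hx
      have hd := div_greenField hζ (hne t ht x hx)
      simp only [Fin.sum_univ_three, Pi.zero_apply] at hd ⊢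
      linear_combination (-(y 0 : ℂ) * x 0 - y 1 * x 1 - y 2 * x 2) * hd
    · intro t ht x hx
      refine ContinuousAt.continuousWithinAt ?_
      exact tendsto_finsetSum _ fun i _ =>
        (contDiff_coord i).continuous.continuousAt.mul (hsm t ht x hx i).continuousAt
    · intro t ht x hx
      refine HasDerivAt.fun_sum fun i _ => HasDerivAt.const_mul _ ?_
      have h1 := (differentiableAt_of_smooth
        (contDiffAt_greenField k ζ i (hne t ht x hx))).hasFDerivAt
      have h2 : HasDerivAt (fun t : ℝ => x - t • y) (-y) t := by
        simpa using ((hasDerivAt_id t).smul_const y).const_sub x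
      have h3 := h1.comp_hasDerivAt t h2
      rw [map_neg, fderiv_apply_eq_sum_pd] at h3
      exact h3
    · rintro ⟨t, x⟩ ⟨ht, hx⟩
      refine ContinuousAt.continuousWithinAt ?_
      refine tendsto_finsetSum _ fun i _ => Filter.Tendsto.mul ?_ (Filter.Tendsto.neg ?_)
      · exact ((contDiff_coord i).continuous.comp continuous_snd).continuousAt
      · refine tendsto_finsetSum _ fun j _ => Filter.Tendsto.mul tendsto_const_nhds ?_
        have h1 := (contDiffAt_pd (contDiffAt_greenField k ζ i (hne t ht x hx)) j).continuousAt
        exact ContinuousAt.comp (f := fun p : ℝ × E3 => p.2 - p.1 • y) (x := (t, x)) h1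
          (by fun_prop)
  have hc := isOpen_Ioo.is_const_of_deriv_eq_zero isPreconnected_Ioo
    (fun t ht => (key t ht).differentiableAt.differentiableWithinAt) (fun t ht => (key t ht).deriv)
    (show (1 : ℝ) ∈ Ioo (-b) b from ⟨by linarith, hb1⟩)
    (show (0 : ℝ) ∈ Ioo (-b) b from ⟨by linarith, by linarith⟩)
  simpa using hc

/-- Green's representation of a plane wave inside a ball: the singularity is moved to the centre, where
the flux is the Wronskian of `wronskian_eq_one`. -/
lemma green_planeWave {k R : ℝ} (hR : 0 < R) {ζ : E3} (hζ : ‖ζ‖ = k) {y : E3} (hy : ‖y‖ < R) :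
    ∫ x, ∑ i, ((R⁻¹ * x i : ℝ) : ℂ) * (pd i (kernelH k) (x - y) * planeWave ζ x -
      kernelH k (x - y) * (Complex.I * ζ i * planeWave ζ x)) ∂(surfaceMeasure R) =
      planeWave ζ y := by
  have e1 : ∀ x : E3, ∑ i, ((R⁻¹ * x i : ℝ) : ℂ) * (pd i (kernelH k) (x - y) * planeWave ζ x -
      kernelH k (x - y) * (Complex.I * ζ i * planeWave ζ x)) =
      (R : ℂ)⁻¹ * planeWave ζ y * ∑ i, (x i : ℂ) * greenField k ζ i (x - y) := fun x => by
    simp only [greenField, planeWave_sub]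
    have := planeWave_mul_neg ζ y
    simp only [Fin.sum_univ_three, Complex.ofReal_mul, Complex.ofReal_inv]
    generalize planeWave ζ (-y) = a at *
    generalize planeWave ζ y = b at *
    linear_combination (-(R : ℂ)⁻¹ * planeWave ζ x * (∑ i, (x i : ℂ) * (pd i (kernelH k) (x - y) -
      kernelH k (x - y) * (Complex.I * ζ i)))) * this + (R : ℂ)⁻¹ * planeWave ζ x * a * b *
      (Fin.sum_univ_three (fun i => (x i : ℂ) * (pd i (kernelH k) (x - y) -
      kernelH k (x - y) * (Complex.I * ζ i)))) -
      (R : ℂ)⁻¹ * planeWave ζ x * (Fin.sum_univ_three (fun i => (x i : ℂ) * (pd i (kernelH k) (x - y) -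
      kernelH k (x - y) * (Complex.I * ζ i))))
  simp only [e1]
  rw [integral_const_mul, flux_greenField hR hζ hy, integral_surfaceMeasure hR]
  have hR' : (R : ℂ) ≠ 0 := by exact_mod_cast hR.ne'
  have e2 : ∫ x, ∑ i, ((R • x) i : ℂ) * greenField k ζ i (R • x) ∂(surfaceMeasure 1) =
      R * (profileG k R * R * waveMoment ζ 0 R - profileH k R * waveMoment ζ 1 R) := by
    have hint : ∀ n, Integrable (fun w => (Complex.I * ((inner ℝ ζ w : ℝ) : ℂ)) ^ n *
        planeWave (R • ζ) w) (surfaceMeasure 1) := fun n => by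
      apply ContinuousOn.integrable_surface one_pos
      simp only [planeWave]
      fun_prop
    rw [waveMoment, waveMoment, ← integral_const_mul, ← integral_const_mul,
      ← integral_sub ((hint 0).const_mul _) ((hint 1).const_mul _), ← integral_const_mul]
    refine integral_congr_ae ?_
    filter_upwards [ae_mem_sphere one_pos] with x hx
    have hx1 : (x 0 : ℂ) ^ 2 + (x 1 : ℂ) ^ 2 + (x 2 : ℂ) ^ 2 = 1 := by
      have := norm_sq_cyclic x 0
      rw [mem_sphere_zero_iff_norm.1 hx] at this
      exact_mod_cast this.symm.trans (one_pow 2)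
    have hin : ((inner ℝ ζ x : ℝ) : ℂ) = ζ 0 * x 0 + ζ 1 * x 1 + ζ 2 * x 2 := by
      have := inner_cyclic ζ x 0
      exact_mod_cast this
    have hn : ‖R • x‖ = R := by
      rw [norm_smul, mem_sphere_zero_iff_norm.1 hx, mul_one, Real.norm_eq_abs, abs_of_pos hR]
    have hRx : R • x ≠ 0 := by rw [← norm_ne_zero_iff, hn]; exact hR.ne'
    have hpw : planeWave ζ (R • x) = planeWave (R • ζ) x := by
      simp [planeWave, inner_smul_left, inner_smul_right]
    simp only [greenField, pd_kernelH k hRx, kernelH_eq, hn, hpw, Fin.sum_univ_three,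
      PiLp.smul_apply, smul_eq_mul, Complex.ofReal_mul, hin]
    linear_combination (R * profileG k R * R * planeWave (R • ζ) x) * hx1
  rw [e2]
  have hW := wronskian_eq_one hζ hR.ne'
  rw [Complex.real_smul]
  push_cast
  field_simp
  linear_combination planeWave ζ y * hW

end ScalarGreen

/-! ### The Green representation for the Navier equation -/

section VectorGreen
open Set Metric Complex
open scoped ContDiff

/-- The Green tensor as a function of the difference variable. -/
def greenKernel (lam mu κ : ℝ) (i m : Fin 3) (z : E3) : ℂ :=
  (1 / (mu : ℂ)) * (if i = m then kernelH (kappaS mu κ) z else 0) +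
    (1 / (κ : ℂ) ^ 2) *
      pd i (pd m (fun z => kernelH (kappaS mu κ) z - kernelH (kappaP lam mu κ) z)) z

lemma greenTensor_eq (lam mu κ : ℝ) (x y : E3) (i m : Fin 3) :
    greenTensor lam mu κ x y i m = greenKernel lam mu κ i m (x - y) := by
  have h1 : (fun z' : E3 => helmholtz (kappaS mu κ) z' y - helmholtz (kappaP lam mu κ) z' y) =
      fun z' => (fun z => kernelH (kappaS mu κ) z - kernelH (kappaP lam mu κ) z) (z' - y) := by
    funext z'; simp only [helmholtz_eq_kernelH]
  have h2 : ∀ f : E3 → ℂ, fderiv ℝ (fun z : E3 => fderiv ℝ f z (unitVec m)) x (unitVec i) =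
      pd i (pd m f) x := fun f => rfl
  rw [greenTensor, h2, h1, pd_comp_sub (fun z => kernelH (kappaS mu κ) z -
    kernelH (kappaP lam mu κ) z) y m, pd_comp_sub, greenKernel, helmholtz_eq_kernelH]

lemma contDiffAt_kernel_sub (k l : ℝ) {z : E3} (hz : z ≠ 0) :
    ContDiffAt ℝ ∞ (fun z => kernelH k z - kernelH l z) z :=
  (contDiffAt_kernelH k hz).sub (contDiffAt_kernelH l hz)

lemma contDiffAt_greenKernel (lam mu κ : ℝ) (i m : Fin 3) {z : E3} (hz : z ≠ 0) :
    ContDiffAt ℝ ∞ (greenKernel lam mu κ i m) z := by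
  have h1 : ContDiffAt ℝ ∞ (fun z => if i = m then kernelH (kappaS mu κ) z else 0) z := by
    by_cases h : i = m
    · simpa [h] using contDiffAt_kernelH (kappaS mu κ) hz
    · simpa [h] using contDiffAt_const
  exact (contDiffAt_const.mul h1).add (contDiffAt_const.mul
    (contDiffAt_pd (contDiffAt_pd (contDiffAt_kernel_sub _ _ hz) m) i))

lemma pd_greenKernel (lam mu κ : ℝ) (l i m : Fin 3) {z : E3} (hz : z ≠ 0) :
    pd l (greenKernel lam mu κ i m) z =
      (1 / (mu : ℂ)) * (if i = m then pd l (kernelH (kappaS mu κ)) z else 0) +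
      (1 / (κ : ℂ) ^ 2) *
        pd l (pd i (pd m (fun z => kernelH (kappaS mu κ) z - kernelH (kappaP lam mu κ) z))) z := by
  have hk := differentiableAt_of_smooth (contDiffAt_kernelH (kappaS mu κ) hz)
  have hφ := differentiableAt_of_smooth (contDiffAt_pd (contDiffAt_pd
    (contDiffAt_kernel_sub (kappaS mu κ) (kappaP lam mu κ) hz) m) i)
  by_cases h : i = m
  · subst h
    unfold greenKernel
    simp only [if_true]
    rw [pd_add, pd_const_mul hk, pd_const_mul hφ]
    exacts [hk.const_mul _, hφ.const_mul _]
  · unfold greenKernel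
    simp only [h, if_false, mul_zero, zero_add]
    rw [pd_const_mul hφ]

/-- The boundary operator on the components of a field. -/
def traction (lam mu : ℝ) (V : Fin 3 → E3 → ℂ) (x : E3) (j : Fin 3) : ℂ :=
  mu * ∑ i, ((‖x‖⁻¹ * x i : ℝ) : ℂ) * pd i (V j) x +
    ((lam + mu : ℝ) : ℂ) * (∑ l, pd l (V l) x) * ((‖x‖⁻¹ * x j : ℝ) : ℂ)

lemma fderiv_component {v : E3 → C3} {x : E3} (hv : DifferentiableAt ℝ v x) (w : E3) (j : Fin 3) :
    fderiv ℝ v x w j = fderiv ℝ (fun x => v x j) x w := by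
  have h := (((EuclideanSpace.proj j : C3 →L[ℂ] ℂ)).restrictScalars ℝ).hasFDerivAt.comp
    x hv.hasFDerivAt
  have h2 : HasFDerivAt (fun x => v x j) _ x := h
  rw [h2.fderiv]
  rfl

lemma boundaryOp_eq_traction (lam mu : ℝ) {v : E3 → C3} {x : E3} (hv : DifferentiableAt ℝ v x)
    (j : Fin 3) : boundaryOp lam mu v x j = traction lam mu (fun j x => v x j) x j := by
  simp only [boundaryOp, traction, PiLp.add_apply, PiLp.smul_apply, smul_eq_mul,
    fderiv_component hv]
  congr 2
  rw [fderiv_apply_eq_sum_pd]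
  simp

lemma expSol_apply (θ : Fin 3 → ℝ) (κs : ℝ) (ξ : E3) (k : Fin 3) (l : Fin 2) (x : E3) (j : Fin 3) :
    expSol θ κs ξ k l x j = (etaVec θ κs ξ k l j : ℂ) * planeWave (zetaVec θ κs ξ k l) x := rfl

lemma differentiableAt_expSol (θ : Fin 3 → ℝ) (κs : ℝ) (ξ : E3) (k : Fin 3) (l : Fin 2) (x : E3) :
    DifferentiableAt ℝ (expSol θ κs ξ k l) x := by
  rw [differentiableAt_piLp 2]
  intro j
  exact (differentiableAt_of_smooth (contDiff_planeWave _).contDiffAt).const_mul _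

lemma traction_planeWave (lam mu : ℝ) (η ζ x : E3) (j : Fin 3) :
    traction lam mu (fun j x => (η j : ℂ) * planeWave ζ x) x j =
      mu * (∑ i, ((‖x‖⁻¹ * x i : ℝ) : ℂ) * (Complex.I * ζ i)) * (η j * planeWave ζ x) +
      ((lam + mu : ℝ) : ℂ) * (Complex.I * ((inner ℝ η ζ : ℝ) : ℂ) * planeWave ζ x) *
        ((‖x‖⁻¹ * x j : ℝ) : ℂ) := by
  have hin : ((inner ℝ η ζ : ℝ) : ℂ) = η 0 * ζ 0 + η 1 * ζ 1 + η 2 * ζ 2 := by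
    have := inner_cyclic η ζ 0
    exact_mod_cast this
  have h : ∀ i j, pd i (fun x => (η j : ℂ) * planeWave ζ x) x =
      η j * (Complex.I * ζ i * planeWave ζ x) := fun i j => by
    rw [pd_const_mul (differentiableAt_of_smooth (contDiff_planeWave ζ).contDiffAt), pd_planeWave]
  simp only [traction, h, Fin.sum_univ_three, hin]
  ring

/-- The flux through a sphere of the divergence of an antisymmetric tensor (that is, of a curl)
vanishes. -/
lemma integral_antisymmetric_flux {R : ℝ} (hR : 0 < R) {w : Fin 3 → Fin 3 → E3 → ℂ}
    (hw : ∀ i j, ∀ x ∈ sphere (0 : E3) R, ContDiffAt ℝ ∞ (w i j) x)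
    (ha : ∀ i j x, w i j x = -w j i x) :
    ∫ x, ∑ i, ∑ j, (x i : ℂ) * pd j (w i j) x ∂(surfaceMeasure R) = 0 := by
  have hc : ∀ i j a b : Fin 3, Integrable (fun x : E3 => (x a : ℂ) * pd b (w i j) x)
      (surfaceMeasure R) := fun i j a b => ContinuousOn.integrable_surface hR fun x hx =>
      ((contDiff_coord a).continuous.continuousAt.mul
        (contDiffAt_pd (hw i j x hx) b).continuousAt).continuousWithinAt
  have h0 : ∀ i j, ∫ x, (x i : ℂ) * pd j (w i j) x ∂(surfaceMeasure R) =
      -∫ x, (x j : ℂ) * pd i (w j i) x ∂(surfaceMeasure R) := fun i j => by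
    rw [integral_coord_mul_pd_comm hR (hw i j) i j, ← integral_neg]
    congr 1; funext x
    have : w i j = fun x => (-1) * w j i x := by funext x; rw [ha]; ring
    by_cases hd : DifferentiableAt ℝ (w j i) x
    · rw [this, pd_const_mul hd]; ring
    · have hd' : ¬DifferentiableAt ℝ (w i j) x := fun h => hd (by
        have e : w j i = fun x => -w i j x := by funext x; rw [ha]
        rw [e]; exact h.neg)
      simp [pd, fderiv_zero_of_not_differentiableAt hd, fderiv_zero_of_not_differentiableAt hd']
  rw [integral_finsetSum _ fun i _ => integrable_finsetSum _ fun j _ => hc i j i j]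
  simp only [integral_finsetSum _ fun j _ => hc _ j _ j]
  have e00 := h0 0 0
  have e11 := h0 1 1
  have e22 := h0 2 2
  have e01 := h0 0 1
  have e02 := h0 0 2
  have e12 := h0 1 2
  simp only [Fin.sum_univ_three]
  linear_combination e00 / 2 + e11 / 2 + e22 / 2 + e01 + e02 + e12

lemma pd_eventuallyEq {f g : E3 → ℂ} {x : E3} (h : f =ᶠ[nhds x] g) (j : Fin 3) :
    pd j f =ᶠ[nhds x] pd j g := h.eventuallyEq_nhds.mono fun _ h => pd_congr h j

lemma laplacian_pd_kernelH (k : ℝ) (m : Fin 3) {z : E3} (hz : z ≠ 0) :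
    ∑ j, pd j (pd j (pd m (kernelH k))) z = -(k : ℂ) ^ 2 * pd m (kernelH k) z := by
  have hn : ∀ᶠ w in nhds z, w ≠ 0 := isOpen_ne.mem_nhds hz
  have hs : ContDiffAt ℝ ∞ (kernelH k) z := contDiffAt_kernelH k hz
  have h1 : ∀ j, pd j (pd j (pd m (kernelH k))) z = pd m (pd j (pd j (kernelH k))) z := fun j => by
    rw [pd_congr (hn.mono fun w hw => pd_comm (contDiffAt_kernelH k hw) j m) j,
      pd_comm (contDiffAt_pd hs j)]
  have h2 : (fun w => pd 0 (pd 0 (kernelH k)) w + pd 1 (pd 1 (kernelH k)) w +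
      pd 2 (pd 2 (kernelH k)) w) =ᶠ[nhds z] fun w => -(k : ℂ) ^ 2 * kernelH k w :=
    hn.mono fun w hw => by
      have := laplacian_kernelH k hw
      rwa [Fin.sum_univ_three] at this
  have hd : ∀ j, DifferentiableAt ℝ (pd j (pd j (kernelH k))) z := fun j =>
    differentiableAt_of_smooth (contDiffAt_pd (contDiffAt_pd hs j) j)
  have h3 := pd_congr h2 m
  rw [pd_const_mul (differentiableAt_of_smooth hs), pd_add ((hd 0).fun_add (hd 1)) (hd 2),
    pd_add (hd 0) (hd 1)] at h3
  rw [Fin.sum_univ_three, h1, h1, h1, h3]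

lemma laplacian_pd_kernel_sub (k l : ℝ) (m : Fin 3) {z : E3} (hz : z ≠ 0) :
    ∑ j, pd j (pd j (pd m (fun z => kernelH k z - kernelH l z))) z =
      -(k : ℂ) ^ 2 * pd m (kernelH k) z + (l : ℂ) ^ 2 * pd m (kernelH l) z := by
  have hn : ∀ᶠ w in nhds z, w ≠ 0 := isOpen_ne.mem_nhds hz
  have e1 : pd m (fun z => kernelH k z - kernelH l z) =ᶠ[nhds z]
      fun z => pd m (kernelH k) z - pd m (kernelH l) z := hn.mono fun w hw =>
    pd_sub (differentiableAt_of_smooth (contDiffAt_kernelH _ hw))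
      (differentiableAt_of_smooth (contDiffAt_kernelH _ hw)) m
  have e2 : ∀ j, pd j (pd m (fun z => kernelH k z - kernelH l z)) =ᶠ[nhds z]
      fun z => pd j (pd m (kernelH k)) z - pd j (pd m (kernelH l)) z := fun j =>
    (pd_eventuallyEq e1 j).trans (hn.mono fun w hw =>
      pd_sub (differentiableAt_of_smooth (contDiffAt_pd (contDiffAt_kernelH _ hw) m))
        (differentiableAt_of_smooth (contDiffAt_pd (contDiffAt_kernelH _ hw) m)) j)
  have e3 : ∀ j, pd j (pd j (pd m (fun z => kernelH k z - kernelH l z))) z =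
      pd j (pd j (pd m (kernelH k))) z - pd j (pd j (pd m (kernelH l))) z := fun j => by
    rw [pd_congr (e2 j) j]
    exact pd_sub
      (differentiableAt_of_smooth (contDiffAt_pd (contDiffAt_pd (contDiffAt_kernelH _ hz) m) j))
      (differentiableAt_of_smooth (contDiffAt_pd (contDiffAt_pd (contDiffAt_kernelH _ hz) m) j)) j
  simp only [e3, Finset.sum_sub_distrib, laplacian_pd_kernelH _ m hz]
  ring

/-- Green's representation of a transversal plane wave by the Green tensor of the Navier equation:
up to the scalar representation, the boundary integrand is the flux of a curl. -/
lemma green_navier {lam mu κ R : ℝ} (hmu : 0 < mu) (hlam : 0 < lam + 2 * mu) (hκ : 0 < κ)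
    (hR : 0 < R) {η ζ : E3} (hζ : ‖ζ‖ = kappaS mu κ) (hηζ : inner ℝ η ζ = 0) {y : E3}
    (hy : ‖y‖ < R) (m : Fin 3) :
    ∫ x, (∑ j, traction lam mu (fun j x => greenKernel lam mu κ j m (x - y)) x j *
        (η j * planeWave ζ x) -
      ∑ j, traction lam mu (fun j x => (η j : ℂ) * planeWave ζ x) x j *
        greenKernel lam mu κ j m (x - y)) ∂(surfaceMeasure R) = η m * planeWave ζ y := by
  have hE : ∀ x, ContDiffAt ℝ ∞ (planeWave ζ) x := fun x => (contDiff_planeWave ζ).contDiffAt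
  have hne : ∀ x ∈ sphere (0 : E3) R, x - y ≠ 0 := fun x hx => ne_of_mem_sphere_of_norm_lt hx hy
  set φ : E3 → ℂ := pd m (fun z => kernelH (kappaS mu κ) z - kernelH (kappaP lam mu κ) z) with hφ
  have hφs : ∀ z, z ≠ 0 → ContDiffAt ℝ ∞ φ z := fun z hz =>
    contDiffAt_pd (contDiffAt_kernel_sub _ _ hz) m
  have hsub : ∀ f : E3 → ℂ, ∀ x, ContDiffAt ℝ ∞ f (x - y) → ContDiffAt ℝ ∞ (fun x => f (x - y)) x :=
    fun f x hf => hf.comp (f := fun x => x - y) x (contDiffAt_id.sub contDiffAt_const)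
  -- the antisymmetric potential: `∇φ × U - φ curl U` in components
  set w : Fin 3 → Fin 3 → E3 → ℂ := fun i j x =>
    (pd i φ (x - y) * η j - pd j φ (x - y) * η i) * planeWave ζ x -
      φ (x - y) * (Complex.I * (ζ i * η j - ζ j * η i) * planeWave ζ x) with hw
  have hws : ∀ i j, ∀ x ∈ sphere (0 : E3) R, ContDiffAt ℝ ∞ (w i j) x := fun i j x hx =>
    ((((hsub _ x (contDiffAt_pd (hφs _ (hne x hx)) i)).mul contDiffAt_const).sub
      ((hsub _ x (contDiffAt_pd (hφs _ (hne x hx)) j)).mul contDiffAt_const)).mul (hE x)).sub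
      ((hsub _ x (hφs _ (hne x hx))).mul (contDiffAt_const.mul (hE x)))
  have hpdw : ∀ l i j, ∀ x ∈ sphere (0 : E3) R, pd l (w i j) x =
      (pd l (pd i φ) (x - y) * η j - pd l (pd j φ) (x - y) * η i) * planeWave ζ x +
      (pd i φ (x - y) * η j - pd j φ (x - y) * η i) * (Complex.I * ζ l * planeWave ζ x) -
      (pd l φ (x - y) * (Complex.I * (ζ i * η j - ζ j * η i) * planeWave ζ x) +
        φ (x - y) * (Complex.I * (ζ i * η j - ζ j * η i) * (Complex.I * ζ l * planeWave ζ x))) := by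
    intro l i j x hx
    have d1 := differentiableAt_of_smooth (hsub _ x (contDiffAt_pd (hφs _ (hne x hx)) i))
    have d2 := differentiableAt_of_smooth (hsub _ x (contDiffAt_pd (hφs _ (hne x hx)) j))
    have d3 := differentiableAt_of_smooth (hsub _ x (hφs _ (hne x hx)))
    have d4 := differentiableAt_of_smooth (hE x)
    simp only [hw]
    rw [pd_sub, pd_mul (g := planeWave ζ), pd_sub, pd_mul_const d1, pd_mul_const d2,
      pd_mul (f := fun x => φ (x - y)), pd_const_mul d4, pd_planeWave,
      pd_comp_sub, pd_comp_sub, pd_comp_sub]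
    all_goals first | exact d3 | exact d3.mul (d4.const_mul _) | fun_prop
  have hflux := integral_antisymmetric_flux hR hws fun i j x => by simp only [hw]; ring
  have hscalar := green_planeWave hR hζ hy
  have hI1 : Integrable (fun x : E3 => ∑ i, ((R⁻¹ * x i : ℝ) : ℂ) *
      (pd i (kernelH (kappaS mu κ)) (x - y) * planeWave ζ x -
      kernelH (kappaS mu κ) (x - y) * (Complex.I * ζ i * planeWave ζ x))) (surfaceMeasure R) := by
    refine ContinuousOn.integrable_surface hR fun x hx => ContinuousAt.continuousWithinAt ?_
    have c1 := (hsub _ x (contDiffAt_kernelH (kappaS mu κ) (hne x hx))).continuousAt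
    refine tendsto_finsetSum _ fun i _ => Filter.Tendsto.mul ?_ (Filter.Tendsto.sub
      (Filter.Tendsto.mul ?_ ?_) (Filter.Tendsto.mul c1 (Filter.Tendsto.mul tendsto_const_nhds ?_)))
    · have : Continuous fun x : E3 => ((R⁻¹ * x i : ℝ) : ℂ) := by fun_prop
      exact this.continuousAt
    · exact (hsub _ x (contDiffAt_pd (contDiffAt_kernelH (kappaS mu κ) (hne x hx)) i)).continuousAt
    · exact (hE x).continuousAt
    · exact (hE x).continuousAt
  have hI2 : Integrable (fun x : E3 => ∑ i, ∑ j, (x i : ℂ) * pd j (w i j) x) (surfaceMeasure R) := by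
    refine ContinuousOn.integrable_surface hR fun x hx => ContinuousAt.continuousWithinAt ?_
    exact tendsto_finsetSum _ fun i _ => tendsto_finsetSum _ fun j _ =>
      (contDiff_coord i).continuous.continuousAt.mul (contDiffAt_pd (hws i j x hx) j).continuousAt
  -- the integrand is `η_m` times the scalar Green integrand plus the flux of the curl
  have hmain : ∀ x ∈ sphere (0 : E3) R,
      (∑ j, traction lam mu (fun j x => greenKernel lam mu κ j m (x - y)) x j *
        (η j * planeWave ζ x) -
      ∑ j, traction lam mu (fun j x => (η j : ℂ) * planeWave ζ x) x j *
        greenKernel lam mu κ j m (x - y)) =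
      η m * (∑ i, ((R⁻¹ * x i : ℝ) : ℂ) * (pd i (kernelH (kappaS mu κ)) (x - y) * planeWave ζ x -
        kernelH (kappaS mu κ) (x - y) * (Complex.I * ζ i * planeWave ζ x))) +
      (mu / κ ^ 2 * (R : ℂ)⁻¹) * ∑ i, ∑ j, (x i : ℂ) * pd j (w i j) x := by
    intro x hx
    have hz := hne x hx
    have hnx : ‖x‖ = R := mem_sphere_zero_iff_norm.1 hx
    have hmu' : (mu : ℂ) ≠ 0 := by exact_mod_cast hmu.ne'
    have hκ' : (κ : ℂ) ≠ 0 := by exact_mod_cast hκ.ne'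
    have hks : (kappaS mu κ : ℂ) ^ 2 * mu = κ ^ 2 := by
      have : kappaS mu κ ^ 2 * mu = κ ^ 2 := by
        rw [kappaS, div_pow, Real.sq_sqrt hmu.le, div_mul_cancel₀ _ hmu.ne']
      exact_mod_cast this
    have hkp : (kappaP lam mu κ : ℂ) ^ 2 * (lam + 2 * mu) = κ ^ 2 := by
      have : kappaP lam mu κ ^ 2 * (lam + 2 * mu) = κ ^ 2 := by
        rw [kappaP, div_pow, Real.sq_sqrt hlam.le, div_mul_cancel₀ _ hlam.ne']
      exact_mod_cast this
    have hz2 : (kappaS mu κ : ℂ) ^ 2 = (ζ 0 : ℂ) ^ 2 + (ζ 1 : ℂ) ^ 2 + (ζ 2 : ℂ) ^ 2 := by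
      have := norm_sq_cyclic ζ 0
      rw [hζ] at this
      exact_mod_cast this
    have hin : (η 0 * ζ 0 + η 1 * ζ 1 + η 2 * ζ 2 : ℂ) = 0 := by
      have := inner_cyclic η ζ 0
      rw [hηζ] at this
      exact_mod_cast this.symm
    have hφz : φ (x - y) = pd m (kernelH (kappaS mu κ)) (x - y) -
        pd m (kernelH (kappaP lam mu κ)) (x - y) :=
      pd_sub (differentiableAt_of_smooth (contDiffAt_kernelH _ hz))
        (differentiableAt_of_smooth (contDiffAt_kernelH _ hz)) m
    -- the Laplacian of `φ`
    have hlap : ∑ j, pd j (pd j φ) (x - y) =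
        -(kappaS mu κ : ℂ) ^ 2 * pd m (kernelH (kappaS mu κ)) (x - y) +
        (kappaP lam mu κ : ℂ) ^ 2 * pd m (kernelH (kappaP lam mu κ)) (x - y) :=
      laplacian_pd_kernel_sub _ _ m hz
    have hsym : ∀ i j, pd i (pd j φ) (x - y) = pd j (pd i φ) (x - y) := pd_comm (hφs _ hz)
    -- the terms along the normal cancel, because `κ_s² μ = κ_p² (λ + 2μ) = κ²`
    have key : ((lam : ℂ) + mu) * ((1 / (mu : ℂ)) * pd m (kernelH (kappaS mu κ)) (x - y) +
        (1 / (κ : ℂ) ^ 2) * ∑ j, pd j (pd j φ) (x - y)) +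
        mu / κ ^ 2 * ∑ j, pd j (pd j φ) (x - y) + φ (x - y) = 0 := by
      rw [hlap, hφz]
      generalize pd m (kernelH (kappaS mu κ)) (x - y) = a
      generalize pd m (kernelH (kappaP lam mu κ)) (x - y) = b
      field_simp
      linear_combination (-(lam + 2 * mu) * a) * hks + (mu * b) * hkp
    have htr : ∀ j, traction lam mu (fun j x => greenKernel lam mu κ j m (x - y)) x j =
        mu * ∑ i, ((R⁻¹ * x i : ℝ) : ℂ) * ((1 / (mu : ℂ)) *
          (if j = m then pd i (kernelH (kappaS mu κ)) (x - y) else 0) +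
          (1 / (κ : ℂ) ^ 2) * pd i (pd j φ) (x - y)) +
        ((lam + mu : ℝ) : ℂ) * ((1 / (mu : ℂ)) * pd m (kernelH (kappaS mu κ)) (x - y) +
          (1 / (κ : ℂ) ^ 2) * ∑ l, pd l (pd l φ) (x - y)) * ((R⁻¹ * x j : ℝ) : ℂ) := fun j => by
      simp only [traction, pd_comp_sub, pd_greenKernel lam mu κ _ _ _ hz, hnx, ← hφ]
      rw [Finset.sum_add_distrib, ← Finset.mul_sum, ← Finset.mul_sum]
      simp
    simp only [htr, traction_planeWave, hηζ, hpdw _ _ _ x hx, hnx]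
    simp only [greenKernel, ← hφ]
    set δ : Fin 3 → ℂ := fun j => if j = m then 1 else 0 with hδ
    have hite : ∀ (j : Fin 3) (a : ℂ), (if j = m then a else 0) = δ j * a := fun j a => by
      simp [hδ]
    have hηm : (η m : ℂ) = δ 0 * η 0 + δ 1 * η 1 + δ 2 * η 2 := by
      have : (η m : ℂ) = ∑ j, δ j * η j := by simp [hδ]
      rw [this, Fin.sum_univ_three]
    have hma : (mu : ℂ) * (1 / mu) = 1 := by field_simp
    have hc : (mu : ℂ) * (1 / (κ : ℂ) ^ 2) * ((ζ 0 : ℂ) ^ 2 + (ζ 1 : ℂ) ^ 2 + (ζ 2 : ℂ) ^ 2) = 1 := by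
      rw [← hz2]; field_simp; linear_combination hks
    have hI2 := Complex.I_sq
    rw [div_eq_mul_one_div (mu : ℂ)] at key ⊢
    simp only [hite, hηm]
    generalize 1 / (mu : ℂ) = a at *
    generalize 1 / (κ : ℂ) ^ 2 = b at *
    simp only [Fin.sum_univ_three] at key ⊢
    rw [hsym 1 0, hsym 2 0, hsym 2 1]
    simp only [Complex.ofReal_mul, Complex.ofReal_inv, Complex.ofReal_add, Complex.ofReal_zero]
    generalize planeWave ζ x = e
    generalize kernelH (kappaS mu κ) (x - y) = g
    generalize pd m (kernelH (kappaS mu κ)) (x - y) = gm at *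
    generalize pd 0 (kernelH (kappaS mu κ)) (x - y) = g0
    generalize pd 1 (kernelH (kappaS mu κ)) (x - y) = g1
    generalize pd 2 (kernelH (kappaS mu κ)) (x - y) = g2
    generalize φ (x - y) = f at *
    linear_combination (e * ((R : ℂ)⁻¹ * (x 0 * η 0 + x 1 * η 1 + x 2 * η 2))) * key +
      ((δ 0 * η 0 + δ 1 * η 1 + δ 2 * η 2) * ((R : ℂ)⁻¹ * (x 0 * (g0 - g * (Complex.I * ζ 0)) +
        x 1 * (g1 - g * (Complex.I * ζ 1)) + x 2 * (g2 - g * (Complex.I * ζ 2)))) * e) * hma +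
      (-(mu * b * e * Complex.I * ((R : ℂ)⁻¹ * (x 0 * pd 0 φ (x - y) + x 1 * pd 1 φ (x - y) +
        x 2 * pd 2 φ (x - y)))) + mu * b * f * e * Complex.I ^ 2 *
        ((R : ℂ)⁻¹ * (x 0 * ζ 0 + x 1 * ζ 1 + x 2 * ζ 2))) * hin +
      (f * e * ((R : ℂ)⁻¹ * (x 0 * η 0 + x 1 * η 1 + x 2 * η 2))) * hc -
      (mu * b * f * e * ((ζ 0 : ℂ) ^ 2 + (ζ 1 : ℂ) ^ 2 + (ζ 2 : ℂ) ^ 2) * ((R : ℂ)⁻¹ * (x 0 * η 0 + x 1 * η 1 + x 2 * η 2))) * hI2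
  rw [integral_congr_ae ((ae_mem_sphere hR).mono fun x hx => hmain x hx),
    integral_add (hI1.const_mul _) (hI2.const_mul _), integral_const_mul, integral_const_mul, hflux,
    hscalar, mul_zero, add_zero]

end VectorGreen

/-! ### The Wiener integral -/

section Wiener

variable {Ω : Type*} [MeasurableSpace Ω] {P : Measure Ω}
  {W : Fin 3 → Lp ℝ 2 (volume : Measure E3) → Ω → ℝ}

lemma IsWhiteNoise.memLp (hW : IsWhiteNoise W P) (j : Fin 3) (h : Lp ℝ 2 (volume : Measure E3)) :
    MemLp (W j h) 2 P := (hW.gaussian.hasGaussianLaw_eval (j, h)).memLp_two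

lemma IsWhiteNoise.integrable_mul (hW : IsWhiteNoise W P) (i j : Fin 3)
    (h k : Lp ℝ 2 (volume : Measure E3)) : Integrable (fun ω => W i h ω * W j k ω) P :=
  (hW.memLp i h).integrable_mul (hW.memLp j k)

/-- By the Itô isometry, the Wiener integral is linear almost surely. -/
lemma IsWhiteNoise.ae_linear (hW : IsWhiteNoise W P) (j : Fin 3) (a b : ℝ)
    (f g : Lp ℝ 2 (volume : Measure E3)) :
    W j (a • f + b • g) =ᵐ[P] fun ω => a * W j f ω + b * W j g ω := by
  set Φ : Lp ℝ 2 (volume : Measure E3) → Lp ℝ 2 P := fun h => (hW.memLp j h).toLp with hΦ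
  have hin : ∀ u v, inner ℝ (Φ u) (Φ v) = inner ℝ u v := by
    intro u v
    rw [L2.inner_def]
    have : inner ℝ u v = ∫ ω, W j u ω * W j v ω ∂P := by rw [hW.isometry, if_pos rfl]
    rw [this]
    refine integral_congr_ae ?_
    filter_upwards [(hW.memLp j u).coeFn_toLp, (hW.memLp j v).coeFn_toLp] with ω h1 h2
    simp only [hΦ, h1, h2]
    simp [mul_comm]
  have h0 : ∀ h : Lp ℝ 2 (volume : Measure E3), h = a • f + b • g →
      inner ℝ (Φ h - (a • Φ f + b • Φ g)) (Φ h - (a • Φ f + b • Φ g)) = 0 := by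
    intro h hh
    have : inner ℝ (h - (a • f + b • g)) (h - (a • f + b • g)) = 0 := by
      rw [hh, sub_self, inner_zero_left]
    rw [← this]
    simp only [inner_sub_left, inner_sub_right, inner_add_left, inner_add_right,
      real_inner_smul_left, real_inner_smul_right, hin]
  have h1 := sub_eq_zero.1 (inner_self_eq_zero.1 (h0 _ rfl))
  have h2 : Φ (a • f + b • g) =ᵐ[P] (a • Φ f + b • Φ g : Lp ℝ 2 P) := by rw [h1]
  filter_upwards [h2, (hW.memLp j (a • f + b • g)).coeFn_toLp, (hW.memLp j f).coeFn_toLp,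
    (hW.memLp j g).coeFn_toLp, Lp.coeFn_add (a • Φ f) (b • Φ g), Lp.coeFn_smul a (Φ f),
    Lp.coeFn_smul b (Φ g)] with ω e1 e2 e3 e4 e5 e6 e7
  rw [← e2, e1, e5, Pi.add_apply, e6, e7, Pi.smul_apply, Pi.smul_apply, e3, e4]
  rfl

/-- The real part of a square integrable function, as an element of `L²`. -/
def reLp {h : E3 → ℂ} (hh : MemLp h 2 (volume : Measure E3)) : Lp ℝ 2 (volume : Measure E3) :=
  hh.re.toLp

/-- The imaginary part of a square integrable function, as an element of `L²`. -/
def imLp {h : E3 → ℂ} (hh : MemLp h 2 (volume : Measure E3)) : Lp ℝ 2 (volume : Measure E3) :=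
  hh.im.toLp

lemma coeFn_reLp {h : E3 → ℂ} (hh : MemLp h 2 (volume : Measure E3)) :
    reLp hh =ᵐ[volume] fun y => (h y).re := hh.re.coeFn_toLp

lemma coeFn_imLp {h : E3 → ℂ} (hh : MemLp h 2 (volume : Measure E3)) :
    imLp hh =ᵐ[volume] fun y => (h y).im := hh.im.coeFn_toLp

lemma wienerIntegral_of_memLp (w : Lp ℝ 2 (volume : Measure E3) → Ω → ℝ) {h : E3 → ℂ}
    (hh : MemLp h 2 (volume : Measure E3)) (ω : Ω) :
    wienerIntegral w h ω = (w (reLp hh) ω : ℂ) + (w (imLp hh) ω : ℂ) * Complex.I := by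
  rw [wienerIntegral, dif_pos hh]; rfl

lemma IsWhiteNoise.wienerIntegral_add (hW : IsWhiteNoise W P) (j : Fin 3) {f g : E3 → ℂ}
    (hf : MemLp f 2 (volume : Measure E3)) (hg : MemLp g 2 (volume : Measure E3)) :
    wienerIntegral (W j) (fun y => f y + g y) =ᵐ[P]
      fun ω => wienerIntegral (W j) f ω + wienerIntegral (W j) g ω := by
  have hfg : MemLp (fun y => f y + g y) 2 (volume : Measure E3) := hf.add hg
  have e1 : reLp hfg = (1 : ℝ) • reLp hf + (1 : ℝ) • reLp hg := by
    rw [one_smul, one_smul]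
    apply Lp.ext
    filter_upwards [coeFn_reLp hf, coeFn_reLp hg, coeFn_reLp hfg, Lp.coeFn_add (reLp hf) (reLp hg)]
      with y h1 h2 h3 h4
    rw [h4, Pi.add_apply, h1, h2, h3, Complex.add_re]
  have e2 : imLp hfg = (1 : ℝ) • imLp hf + (1 : ℝ) • imLp hg := by
    rw [one_smul, one_smul]
    apply Lp.ext
    filter_upwards [coeFn_imLp hf, coeFn_imLp hg, coeFn_imLp hfg, Lp.coeFn_add (imLp hf) (imLp hg)]
      with y h1 h2 h3 h4
    rw [h4, Pi.add_apply, h1, h2, h3, Complex.add_im]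
  filter_upwards [hW.ae_linear j 1 1 (reLp hf) (reLp hg), hW.ae_linear j 1 1 (imLp hf) (imLp hg)]
    with ω h1 h2
  rw [wienerIntegral_of_memLp _ hfg, wienerIntegral_of_memLp _ hf, wienerIntegral_of_memLp _ hg,
    e1, e2, h1, h2]
  push_cast; ring

lemma IsWhiteNoise.wienerIntegral_const_mul (hW : IsWhiteNoise W P) (j : Fin 3) {f : E3 → ℂ}
    (hf : MemLp f 2 (volume : Measure E3)) (c : ℂ) :
    wienerIntegral (W j) (fun y => c * f y) =ᵐ[P] fun ω => c * wienerIntegral (W j) f ω := by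
  have hcf : MemLp (fun y => c * f y) 2 (volume : Measure E3) := hf.const_mul c
  have e1 : reLp hcf = c.re • reLp hf + (-c.im) • imLp hf := by
    apply Lp.ext
    filter_upwards [coeFn_reLp hf, coeFn_imLp hf, coeFn_reLp hcf,
      Lp.coeFn_add (c.re • reLp hf) ((-c.im) • imLp hf), Lp.coeFn_smul c.re (reLp hf),
      Lp.coeFn_smul (-c.im) (imLp hf)] with y h1 h2 h3 h4 h5 h6
    rw [h4, Pi.add_apply, h5, h6, Pi.smul_apply, Pi.smul_apply, h1, h2, h3, Complex.mul_re]
    simp [sub_eq_add_neg]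
  have e2 : imLp hcf = c.re • imLp hf + c.im • reLp hf := by
    apply Lp.ext
    filter_upwards [coeFn_reLp hf, coeFn_imLp hf, coeFn_imLp hcf,
      Lp.coeFn_add (c.re • imLp hf) (c.im • reLp hf), Lp.coeFn_smul c.re (imLp hf),
      Lp.coeFn_smul c.im (reLp hf)] with y h1 h2 h3 h4 h5 h6
    rw [h4, Pi.add_apply, h5, h6, Pi.smul_apply, Pi.smul_apply, h1, h2, h3, Complex.mul_im]
    simp
  filter_upwards [hW.ae_linear j c.re (-c.im) (reLp hf) (imLp hf),
    hW.ae_linear j c.re c.im (imLp hf) (reLp hf)] with ω h1 h2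
  rw [wienerIntegral_of_memLp _ hcf, wienerIntegral_of_memLp _ hf, e1, e2, h1, h2]
  apply Complex.ext <;> simp <;> ring

/-- The Wiener integral `∑_j ∫ k_j dW_j` of a vector field. -/
def wienerSum (W : Fin 3 → Lp ℝ 2 (volume : Measure E3) → Ω → ℝ) (k : Fin 3 → E3 → ℂ) (ω : Ω) : ℂ :=
  ∑ j, wienerIntegral (W j) (k j) ω

/-- Square integrability of all components. -/
abbrev SqInt (k : Fin 3 → E3 → ℂ) : Prop := ∀ j, MemLp (k j) 2 (volume : Measure E3)

/-- The squared norm in `L²(ℝ³; ℂ³)`. -/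
def energy (k : Fin 3 → E3 → ℂ) : ℝ := ∑ j, ∫ y, ‖k j y‖ ^ 2

lemma energy_nonneg (k : Fin 3 → E3 → ℂ) : 0 ≤ energy k :=
  Finset.sum_nonneg fun j _ => integral_nonneg fun y => by positivity

lemma IsWhiteNoise.wienerSum_add (hW : IsWhiteNoise W P) {k l : Fin 3 → E3 → ℂ} (hk : SqInt k)
    (hl : SqInt l) : wienerSum W (fun j y => k j y + l j y) =ᵐ[P]
      fun ω => wienerSum W k ω + wienerSum W l ω := by
  have h := ae_all_iff.2 fun j => hW.wienerIntegral_add j (hk j) (hl j)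
  filter_upwards [h] with ω hω
  simp only [wienerSum, hω, Finset.sum_add_distrib]

lemma IsWhiteNoise.wienerSum_const_mul (hW : IsWhiteNoise W P) {k : Fin 3 → E3 → ℂ} (hk : SqInt k)
    (c : ℂ) : wienerSum W (fun j y => c * k j y) =ᵐ[P] fun ω => c * wienerSum W k ω := by
  have h := ae_all_iff.2 fun j => hW.wienerIntegral_const_mul j (hk j) c
  filter_upwards [h] with ω hω
  simp only [wienerSum, hω, Finset.mul_sum]

lemma SqInt.const_mul {k : Fin 3 → E3 → ℂ} (hk : SqInt k) (c : ℂ) :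
    SqInt (fun j y => c * k j y) := fun j => (hk j).const_mul c

lemma SqInt.sub {k l : Fin 3 → E3 → ℂ} (hk : SqInt k) (hl : SqInt l) :
    SqInt (fun j y => k j y - l j y) := fun j => (hk j).sub (hl j)

lemma IsWhiteNoise.wienerSum_sub (hW : IsWhiteNoise W P) {k l : Fin 3 → E3 → ℂ} (hk : SqInt k)
    (hl : SqInt l) : wienerSum W (fun j y => k j y - l j y) =ᵐ[P]
      fun ω => wienerSum W k ω - wienerSum W l ω := by
  have e : (fun (j : Fin 3) y => k j y - l j y) = fun j y => k j y + (-1) * l j y := by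
    funext j y; ring
  rw [e]
  filter_upwards [hW.wienerSum_add hk (hl.const_mul (-1)), hW.wienerSum_const_mul hl (-1)]
    with ω h1 h2
  rw [h1, h2]; ring

lemma IsWhiteNoise.wienerSum_zero (hW : IsWhiteNoise W P) :
    wienerSum W (fun _ _ => (0 : ℂ)) =ᵐ[P] fun _ => 0 := by
  have h0 : SqInt (fun _ _ => (0 : ℂ)) := fun j => MemLp.zero'
  have h := hW.wienerSum_const_mul h0 0
  simpa using h

/-- `Integrable.sub` with the difference written pointwise, the form in which `integral_sub` needs it. -/
lemma integrable_fun_sub {α : Type*} [MeasurableSpace α] {μ : Measure α} {f g : α → ℂ}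
    (hf : Integrable f μ) (hg : Integrable g μ) : Integrable (fun a => f a - g a) μ := hf.sub hg

/-- `Integrable.add` with the sum written pointwise, the form in which `integral_add` needs it. -/
lemma integrable_fun_add {α : Type*} [MeasurableSpace α] {μ : Measure α} {f g : α → ℂ}
    (hf : Integrable f μ) (hg : Integrable g μ) : Integrable (fun a => f a + g a) μ := hf.add hg

lemma inner_Lp_eq (f g : Lp ℝ 2 (volume : Measure E3)) : inner ℝ f g = ∫ y, f y * g y := by
  rw [L2.inner_def]
  congr 1; funext y; simp [mul_comm]

/-- The bilinear Itô isometry. -/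
lemma IsWhiteNoise.integral_wienerSum_mul (hW : IsWhiteNoise W P) {k l : Fin 3 → E3 → ℂ}
    (hk : SqInt k) (hl : SqInt l) :
    ∫ ω, wienerSum W k ω * wienerSum W l ω ∂P = ∑ j, ∫ y, k j y * l j y := by
  have hI : ∀ i j u v, Integrable (fun ω => (W i u ω : ℂ) * (W j v ω : ℂ)) P := fun i j u v => by
    simpa using (hW.integrable_mul i j u v).ofReal (𝕜 := ℂ)
  have hE : ∀ i j u v, ∫ ω, (W i u ω : ℂ) * (W j v ω : ℂ) ∂P =
      ((if i = j then inner ℝ u v else 0 : ℝ) : ℂ) := fun i j u v => by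
    rw [← hW.isometry i j u v, ← integral_complex_ofReal]; simp
  have e : ∀ i j ω, wienerIntegral (W i) (k i) ω * wienerIntegral (W j) (l j) ω =
      ((W i (reLp (hk i)) ω : ℂ) * W j (reLp (hl j)) ω -
        (W i (imLp (hk i)) ω : ℂ) * W j (imLp (hl j)) ω) +
      ((W i (reLp (hk i)) ω : ℂ) * W j (imLp (hl j)) ω +
        (W i (imLp (hk i)) ω : ℂ) * W j (reLp (hl j)) ω) * Complex.I := fun i j ω => by
    rw [wienerIntegral_of_memLp _ (hk i), wienerIntegral_of_memLp _ (hl j)]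
    linear_combination ((W i (imLp (hk i)) ω : ℂ) * W j (imLp (hl j)) ω) * Complex.I_sq
  have hterm : ∀ i j, ∫ ω, wienerIntegral (W i) (k i) ω * wienerIntegral (W j) (l j) ω ∂P =
      if i = j then ∫ y, k i y * l j y else 0 := by
    intro i j
    simp only [e i j]
    rw [integral_add (integrable_fun_sub (hI i j (reLp (hk i)) (reLp (hl j)))
        (hI i j (imLp (hk i)) (imLp (hl j))))
        ((integrable_fun_add (hI i j (reLp (hk i)) (imLp (hl j)))
          (hI i j (imLp (hk i)) (reLp (hl j)))).mul_const _),
      integral_sub (hI _ _ _ _) (hI _ _ _ _), integral_mul_const,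
      integral_add (hI _ _ _ _) (hI _ _ _ _), hE, hE, hE, hE]
    by_cases hij : i = j
    · subst hij
      simp only [if_true, inner_Lp_eq]
      have hi2 : ∀ u v : Lp ℝ 2 (volume : Measure E3),
          Integrable (fun y => ((u y * v y : ℝ) : ℂ)) :=
        fun u v => ((Lp.memLp u).integrable_mul (Lp.memLp v)).ofReal
      rw [← integral_complex_ofReal, ← integral_complex_ofReal, ← integral_complex_ofReal,
        ← integral_complex_ofReal, ← integral_sub (hi2 _ _) (hi2 _ _),
        ← integral_add (hi2 _ _) (hi2 _ _), ← integral_mul_const,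
        ← integral_add (integrable_fun_sub (hi2 _ _) (hi2 _ _))
          ((integrable_fun_add (hi2 _ _) (hi2 _ _)).mul_const _)]
      refine integral_congr_ae ?_
      filter_upwards [coeFn_reLp (hk i), coeFn_imLp (hk i), coeFn_reLp (hl i), coeFn_imLp (hl i)]
        with y h1 h2 h3 h4
      rw [h1, h2, h3, h4]
      apply Complex.ext <;> simp
    · simp [hij]
  have hint : ∀ i j, Integrable (fun ω => wienerIntegral (W i) (k i) ω *
      wienerIntegral (W j) (l j) ω) P := fun i j => by
    simp only [e i j]
    exact integrable_fun_add (integrable_fun_sub (hI i j (reLp (hk i)) (reLp (hl j)))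
        (hI i j (imLp (hk i)) (imLp (hl j))))
        ((integrable_fun_add (hI i j (reLp (hk i)) (imLp (hl j)))
          (hI i j (imLp (hk i)) (reLp (hl j)))).mul_const _)
  simp only [wienerSum, Finset.sum_mul_sum]
  rw [integral_finsetSum _ fun i _ => integrable_finsetSum _ fun j _ => hint i j]
  refine Finset.sum_congr rfl fun i _ => ?_
  rw [integral_finsetSum _ fun j _ => hint i j]
  simp [hterm]

lemma SqInt.conj {k : Fin 3 → E3 → ℂ} (hk : SqInt k) :
    SqInt (fun j y => (starRingEnd ℂ) (k j y)) := fun j => (hk j).star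

lemma IsWhiteNoise.wienerSum_conj (hW : IsWhiteNoise W P) {k : Fin 3 → E3 → ℂ} (hk : SqInt k) :
    wienerSum W (fun j y => (starRingEnd ℂ) (k j y)) =ᵐ[P]
      fun ω => (starRingEnd ℂ) (wienerSum W k ω) := by
  have h : ∀ j, wienerIntegral (W j) (fun y => (starRingEnd ℂ) (k j y)) =ᵐ[P]
      fun ω => (starRingEnd ℂ) (wienerIntegral (W j) (k j) ω) := fun j => by
    have e1 : reLp (hk.conj j) = reLp (hk j) := by
      apply Lp.ext
      filter_upwards [coeFn_reLp (hk j), coeFn_reLp (hk.conj j)] with y h1 h2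
      rw [h1, h2]; simp
    have e2 : imLp (hk.conj j) = (-1 : ℝ) • imLp (hk j) + (0 : ℝ) • imLp (hk j) := by
      rw [zero_smul, add_zero]
      apply Lp.ext
      filter_upwards [coeFn_imLp (hk j), coeFn_imLp (hk.conj j),
        Lp.coeFn_smul (-1 : ℝ) (imLp (hk j))] with y h1 h2 h3
      rw [h3, Pi.smul_apply, h1, h2]; simp
    filter_upwards [hW.ae_linear j (-1) 0 (imLp (hk j)) (imLp (hk j))] with ω h1
    rw [wienerIntegral_of_memLp _ (hk.conj j), wienerIntegral_of_memLp _ (hk j), e1, e2, h1]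
    apply Complex.ext <;> simp
  filter_upwards [ae_all_iff.2 h] with ω hω
  simp only [wienerSum, hω, map_sum]

lemma IsWhiteNoise.memLp_wienerSum (hW : IsWhiteNoise W P) {k : Fin 3 → E3 → ℂ} (hk : SqInt k) :
    MemLp (wienerSum W k) 2 P := by
  have h : ∀ j ∈ Finset.univ, MemLp (wienerIntegral (W j) (k j)) 2 P := fun j _ => by
    have e : wienerIntegral (W j) (k j) = fun ω => (W j (reLp (hk j)) ω : ℂ) +
        (W j (imLp (hk j)) ω : ℂ) * Complex.I := funext fun ω => wienerIntegral_of_memLp _ (hk j) ω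
    have h1 : MemLp (fun ω => (W j (reLp (hk j)) ω : ℂ)) 2 P := (hW.memLp j _).ofReal
    have h2 : MemLp (fun ω => (W j (imLp (hk j)) ω : ℂ)) 2 P := (hW.memLp j _).ofReal
    rw [e]
    exact h1.add (h2.mul_const _)
  exact memLp_finsetSum Finset.univ h

/-- The Itô isometry. -/
lemma IsWhiteNoise.integral_norm_sq_wienerSum (hW : IsWhiteNoise W P) {k : Fin 3 → E3 → ℂ}
    (hk : SqInt k) : ∫ ω, ‖wienerSum W k ω‖ ^ 2 ∂P = energy k := by
  have h := hW.integral_wienerSum_mul hk hk.conj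
  have e1 : ∫ ω, wienerSum W k ω * wienerSum W (fun j y => (starRingEnd ℂ) (k j y)) ω ∂P =
      ((∫ ω, ‖wienerSum W k ω‖ ^ 2 ∂P : ℝ) : ℂ) := by
    rw [← integral_complex_ofReal]
    refine integral_congr_ae ?_
    filter_upwards [hW.wienerSum_conj hk] with ω hω
    rw [hω, Complex.mul_conj, Complex.normSq_eq_norm_sq]
  have e2 : ∑ j, ∫ y, k j y * (starRingEnd ℂ) (k j y) = ((energy k : ℝ) : ℂ) := by
    rw [energy, Complex.ofReal_sum]
    refine Finset.sum_congr rfl fun j _ => ?_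
    rw [← integral_complex_ofReal]
    congr 1; funext y
    rw [Complex.mul_conj, Complex.normSq_eq_norm_sq]
  rw [e1, e2] at h
  exact_mod_cast h

end Wiener

/-! ### Limits and fourth moments of Wiener integrals -/

section WienerLimits

open Filter Topology

variable {Ω : Type*} [MeasurableSpace Ω] {P : Measure Ω}
  {W : Fin 3 → Lp ℝ 2 (volume : Measure E3) → Ω → ℝ}

lemma IsWhiteNoise.eLpNorm_wienerSum (hW : IsWhiteNoise W P) {k : Fin 3 → E3 → ℂ} (hk : SqInt k) :
    eLpNorm (wienerSum W k) 2 P = ENNReal.ofReal (energy k ^ (2⁻¹ : ℝ)) := by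
  rw [(hW.memLp_wienerSum hk).eLpNorm_eq_integral_rpow_norm two_ne_zero ENNReal.ofNat_ne_top,
    ← hW.integral_norm_sq_wienerSum hk]
  simp

/-- Almost sure limits of Wiener integrals are Wiener integrals if the kernels converge in `L²`. -/
lemma IsWhiteNoise.ae_eq_wienerSum_of_tendsto (hW : IsWhiteNoise W P) {X : Ω → ℂ}
    {Xn : ℕ → Ω → ℂ} {k : Fin 3 → E3 → ℂ} {kn : ℕ → Fin 3 → E3 → ℂ} (hk : SqInt k)
    (hkn : ∀ n, SqInt (kn n)) (hX : ∀ n, Xn n =ᵐ[P] wienerSum W (kn n))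
    (hlim : ∀ᵐ ω ∂P, Tendsto (fun n => Xn n ω) atTop (𝓝 (X ω)))
    (hen : Tendsto (fun n => energy (fun j y => kn n j y - k j y)) atTop (𝓝 0)) :
    X =ᵐ[P] wienerSum W k := by
  have h1 : Tendsto (fun n => eLpNorm (wienerSum W (kn n) - wienerSum W k) 2 P) atTop (𝓝 0) := by
    have e : ∀ n, eLpNorm (wienerSum W (kn n) - wienerSum W k) 2 P =
        ENNReal.ofReal (energy (fun j y => kn n j y - k j y) ^ (2⁻¹ : ℝ)) := fun n => by
      rw [← hW.eLpNorm_wienerSum ((hkn n).sub hk)]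
      exact eLpNorm_congr_ae (hW.wienerSum_sub (hkn n) hk).symm
    simp only [e]
    have h2 := (hen.rpow_const (p := (2⁻¹ : ℝ)) (Or.inr (by norm_num)))
    rw [Real.zero_rpow (by norm_num)] at h2
    simpa using ENNReal.tendsto_ofReal h2
  have h2 := tendstoInMeasure_of_tendsto_eLpNorm two_ne_zero
    (fun n => (hW.memLp_wienerSum (hkn n)).1) (hW.memLp_wienerSum hk).1 h1
  obtain ⟨ns, hns, hlim2⟩ := h2.exists_seq_tendsto_ae
  filter_upwards [hlim, hlim2, ae_all_iff.2 hX] with ω a b c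
  refine tendsto_nhds_unique (a.comp hns.tendsto_atTop) ?_
  simpa only [Function.comp_def, c] using b

/-- The same under pointwise domination of the kernels. -/
lemma IsWhiteNoise.ae_eq_wienerSum_of_dominated (hW : IsWhiteNoise W P) {X : Ω → ℂ}
    {Xn : ℕ → Ω → ℂ} {k : Fin 3 → E3 → ℂ} {kn : ℕ → Fin 3 → E3 → ℂ} {g : Fin 3 → E3 → ℝ}
    (hg : ∀ j, MemLp (g j) 2 (volume : Measure E3)) (hkn : ∀ n, SqInt (kn n))
    (hdom : ∀ n j y, ‖kn n j y‖ ≤ g j y)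
    (hconv : ∀ j y, Tendsto (fun n => kn n j y) atTop (𝓝 (k j y)))
    (hX : ∀ n, Xn n =ᵐ[P] wienerSum W (kn n))
    (hlim : ∀ᵐ ω ∂P, Tendsto (fun n => Xn n ω) atTop (𝓝 (X ω))) :
    SqInt k ∧ X =ᵐ[P] wienerSum W k := by
  have hkg : ∀ j y, ‖k j y‖ ≤ g j y := fun j y =>
    le_of_tendsto (hconv j y).norm (Eventually.of_forall fun n => hdom n j y)
  have hkm : ∀ j, AEStronglyMeasurable (k j) (volume : Measure E3) := fun j =>
    aestronglyMeasurable_of_tendsto_ae atTop (fun n => (hkn n j).1)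
      (Eventually.of_forall fun y => hconv j y)
  have hk : SqInt k := fun j => (hg j).mono' (hkm j) (Eventually.of_forall fun y => hkg j y)
  refine ⟨hk, hW.ae_eq_wienerSum_of_tendsto hk hkn hX hlim ?_⟩
  have h : ∀ j, Tendsto (fun n => ∫ y, ‖kn n j y - k j y‖ ^ 2) atTop (𝓝 0) := by
    intro j
    have h0 : ∫ y : E3, (0 : ℝ) = 0 := by simp
    rw [← h0]
    refine tendsto_integral_of_dominated_convergence (fun y => (2 * g j y) ^ 2)
      (fun n => ?_) ?_ (fun n => ?_) ?_
    · exact (((hkn n j).1.sub (hkm j)).norm.pow 2)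
    · exact ((hg j).const_mul 2).integrable_sq
    · refine Eventually.of_forall fun y => ?_
      rw [Real.norm_of_nonneg (by positivity)]
      have := (norm_sub_le (kn n j y) (k j y)).trans (add_le_add (hdom n j y) (hkg j y))
      have h3 := norm_nonneg (kn n j y - k j y)
      nlinarith
    · refine Eventually.of_forall fun y => ?_
      have := ((hconv j y).sub_const (k j y)).norm.pow 2
      simpa using this
  simpa [energy] using tendsto_finsetSum Finset.univ fun j _ => h j

/-- The fourth moment of the standard normal distribution. -/
def gaussFourth : ℝ := ∫ x, x ^ 4 ∂(gaussianReal 0 1)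

lemma gaussFourth_nonneg : 0 ≤ gaussFourth := integral_nonneg fun x => by positivity

lemma IsWhiteNoise.memLp_four (hW : IsWhiteNoise W P) (j : Fin 3)
    (h : Lp ℝ 2 (volume : Measure E3)) : MemLp (W j h) 4 P :=
  (hW.gaussian.hasGaussianLaw_eval (j, h)).memLp (by norm_num)

lemma memLp_four_integrable {X : Ω → ℝ} (hX : MemLp X 4 P) : Integrable (fun ω => X ω ^ 4) P := by
  have := hX.integrable_norm_pow (p := 4) (by norm_num)
  refine this.congr (Eventually.of_forall fun ω => ?_)
  simp only [Real.norm_eq_abs]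
  exact Even.pow_abs (by decide) _

lemma IsWhiteNoise.integral_pow_four (hW : IsWhiteNoise W P) (j : Fin 3)
    (h : Lp ℝ 2 (volume : Measure E3)) :
    ∫ ω, W j h ω ^ 4 ∂P = gaussFourth * (inner ℝ h h) ^ 2 := by
  have hg := hW.gaussian.hasGaussianLaw_eval (j, h)
  have hm := hg.aemeasurable
  have hlaw := hg.map_eq_gaussianReal
  have : IsProbabilityMeasure P := hg.isProbabilityMeasure
  have hvar : Var[fun ω => W j h ω; P] = inner ℝ h h := by
    rw [variance_of_integral_eq_zero hm (hW.mean_zero j h)]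
    have := hW.isometry j j h h
    rw [if_pos rfl] at this
    rw [← this]
    simp [pow_two]
  have h0 : (0 : ℝ) ≤ inner ℝ h h := real_inner_self_nonneg
  have e : P.map (fun ω => W j h ω) = (gaussianReal 0 1).map (fun x => √(inner ℝ h h) * x) := by
    rw [hlaw, gaussianReal_map_const_mul, hvar]
    congr 1
    · simpa using hW.mean_zero j h
    · ext; simp
  have e1 : ∫ ω, W j h ω ^ 4 ∂P = ∫ x, x ^ 4 ∂(P.map (fun ω => W j h ω)) :=
    (integral_map hm (f := fun x : ℝ => x ^ 4) (by fun_prop)).symm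
  rw [e1, e, integral_map (by fun_prop) (by fun_prop), gaussFourth, mul_comm, ← integral_const_mul]
  congr 1; funext x
  have : √(inner ℝ h h) ^ 4 = (inner ℝ h h) ^ 2 := by
    rw [show (4 : ℕ) = 2 * 2 by norm_num, pow_mul, Real.sq_sqrt h0]
  rw [mul_pow, this]

lemma energy_eq {k : Fin 3 → E3 → ℂ} (hk : SqInt k) :
    energy k = ∑ j, (inner ℝ (reLp (hk j)) (reLp (hk j)) + inner ℝ (imLp (hk j)) (imLp (hk j))) := by
  refine Finset.sum_congr rfl fun j _ => ?_
  rw [inner_Lp_eq, inner_Lp_eq, ← integral_add ((Lp.memLp _).integrable_mul (Lp.memLp _))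
    ((Lp.memLp _).integrable_mul (Lp.memLp _))]
  refine integral_congr_ae ?_
  filter_upwards [coeFn_reLp (hk j), coeFn_imLp (hk j)] with y h1 h2
  simp only [h1, h2]
  rw [← Complex.normSq_eq_norm_sq, Complex.normSq_apply]

lemma norm_wienerSum_pow_four_le {k : Fin 3 → E3 → ℂ} (hk : SqInt k) (ω : Ω) :
    ‖wienerSum W k ω‖ ^ 4 ≤
      216 * ∑ j, (W j (reLp (hk j)) ω ^ 4 + W j (imLp (hk j)) ω ^ 4) := by
  have h1 : ‖wienerSum W k ω‖ ^ 2 ≤ 6 * ∑ j, (W j (reLp (hk j)) ω ^ 2 + W j (imLp (hk j)) ω ^ 2) := by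
    rw [← Complex.normSq_eq_norm_sq, Complex.normSq_apply, wienerSum]
    simp only [wienerIntegral_of_memLp _ (hk _), Fin.sum_univ_three]
    simp
    nlinarith [sq_nonneg (W 0 (reLp (hk 0)) ω - W 1 (reLp (hk 1)) ω),
      sq_nonneg (W 0 (reLp (hk 0)) ω - W 2 (reLp (hk 2)) ω),
      sq_nonneg (W 1 (reLp (hk 1)) ω - W 2 (reLp (hk 2)) ω),
      sq_nonneg (W 0 (imLp (hk 0)) ω - W 1 (imLp (hk 1)) ω),
      sq_nonneg (W 0 (imLp (hk 0)) ω - W 2 (imLp (hk 2)) ω),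
      sq_nonneg (W 1 (imLp (hk 1)) ω - W 2 (imLp (hk 2)) ω),
      sq_nonneg (W 0 (reLp (hk 0)) ω), sq_nonneg (W 1 (reLp (hk 1)) ω),
      sq_nonneg (W 2 (reLp (hk 2)) ω), sq_nonneg (W 0 (imLp (hk 0)) ω),
      sq_nonneg (W 1 (imLp (hk 1)) ω), sq_nonneg (W 2 (imLp (hk 2)) ω)]
  have h2 : (∑ j, (W j (reLp (hk j)) ω ^ 2 + W j (imLp (hk j)) ω ^ 2)) ^ 2 ≤
      6 * ∑ j, (W j (reLp (hk j)) ω ^ 4 + W j (imLp (hk j)) ω ^ 4) := by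
    have h3 : (∑ j, (W j (reLp (hk j)) ω ^ 2 + W j (imLp (hk j)) ω ^ 2)) ^ 2 ≤
        3 * ∑ j, (W j (reLp (hk j)) ω ^ 2 + W j (imLp (hk j)) ω ^ 2) ^ 2 := by
      simpa using sq_sum_le_card_mul_sum_sq (s := (Finset.univ : Finset (Fin 3)))
        (f := fun j => W j (reLp (hk j)) ω ^ 2 + W j (imLp (hk j)) ω ^ 2)
    refine h3.trans ?_
    rw [show (6 : ℝ) = 3 * 2 by norm_num, mul_assoc, Finset.mul_sum (a := (2 : ℝ))]
    gcongr with j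
    nlinarith [sq_nonneg (W j (reLp (hk j)) ω ^ 2 - W j (imLp (hk j)) ω ^ 2)]
  have h4 : ‖wienerSum W k ω‖ ^ 4 = (‖wienerSum W k ω‖ ^ 2) ^ 2 := by ring
  rw [h4]
  calc (‖wienerSum W k ω‖ ^ 2) ^ 2
      ≤ (6 * ∑ j, (W j (reLp (hk j)) ω ^ 2 + W j (imLp (hk j)) ω ^ 2)) ^ 2 := by gcongr
    _ ≤ _ := by rw [mul_pow]; linarith

lemma IsWhiteNoise.integrable_norm_pow_four (hW : IsWhiteNoise W P) {k : Fin 3 → E3 → ℂ}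
    (hk : SqInt k) : Integrable (fun ω => ‖wienerSum W k ω‖ ^ 4) P := by
  refine Integrable.mono' (g := fun ω =>
    216 * ∑ j, (W j (reLp (hk j)) ω ^ 4 + W j (imLp (hk j)) ω ^ 4)) ?_
    ((hW.memLp_wienerSum hk).1.norm.pow 4) (Eventually.of_forall fun ω => ?_)
  · exact (integrable_finsetSum _ fun j _ => (memLp_four_integrable (hW.memLp_four _ _)).add
      (memLp_four_integrable (hW.memLp_four _ _))).const_mul _
  · rw [Real.norm_of_nonneg (by positivity)]
    exact norm_wienerSum_pow_four_le hk ω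

/-- Hypercontractivity in its simplest form: the fourth moment of a Wiener integral is bounded by
the square of its variance. -/
lemma IsWhiteNoise.integral_norm_pow_four_le (hW : IsWhiteNoise W P) {k : Fin 3 → E3 → ℂ}
    (hk : SqInt k) : ∫ ω, ‖wienerSum W k ω‖ ^ 4 ∂P ≤ 216 * gaussFourth * energy k ^ 2 := by
  have hi : ∀ j, Integrable (fun ω => W j (reLp (hk j)) ω ^ 4) P := fun j =>
    memLp_four_integrable (hW.memLp_four _ _)
  have hi' : ∀ j, Integrable (fun ω => W j (imLp (hk j)) ω ^ 4) P := fun j =>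
    memLp_four_integrable (hW.memLp_four _ _)
  have hii : ∀ j, Integrable (fun ω => W j (reLp (hk j)) ω ^ 4 + W j (imLp (hk j)) ω ^ 4) P :=
    fun j => (hi j).add (hi' j)
  calc ∫ ω, ‖wienerSum W k ω‖ ^ 4 ∂P
      ≤ ∫ ω, 216 * ∑ j, (W j (reLp (hk j)) ω ^ 4 + W j (imLp (hk j)) ω ^ 4) ∂P :=
        integral_mono (hW.integrable_norm_pow_four hk)
          ((integrable_finsetSum _ fun j _ => (hi j).add (hi' j)).const_mul _)
          (norm_wienerSum_pow_four_le hk)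
    _ = 216 * gaussFourth * ∑ j, ((inner ℝ (reLp (hk j)) (reLp (hk j))) ^ 2 +
          (inner ℝ (imLp (hk j)) (imLp (hk j))) ^ 2) := by
        rw [integral_const_mul, integral_finsetSum _ fun j _ => hii j, mul_assoc,
          Finset.mul_sum (a := gaussFourth)]
        congr 1
        refine Finset.sum_congr rfl fun j _ => ?_
        rw [integral_add (hi j) (hi' j), hW.integral_pow_four, hW.integral_pow_four, mul_add]
    _ ≤ 216 * gaussFourth * energy k ^ 2 := by
        have := gaussFourth_nonneg
        gcongr
        rw [energy_eq hk]
        have h1 : ∀ j, 0 ≤ inner ℝ (reLp (hk j)) (reLp (hk j)) := fun j => real_inner_self_nonneg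
        have h2 : ∀ j, 0 ≤ inner ℝ (imLp (hk j)) (imLp (hk j)) := fun j => real_inner_self_nonneg
        refine le_trans (Finset.sum_le_sum fun j _ => ?_)
          (Finset.sum_sq_le_sq_sum_of_nonneg fun j _ => add_nonneg (h1 j) (h2 j))
        nlinarith [mul_nonneg (h1 j) (h2 j)]

end WienerLimits

/-! ### Wiener integrals of kernels restricted to the source region -/

section SourceKernel

open Filter Topology Metric


variable {Ω : Type*} [MeasurableSpace Ω] {P : Measure Ω}
  {W : Fin 3 → Lp ℝ 2 (volume : Measure E3) → Ω → ℝ} {D : Set E3} {σ : Fin 3 → E3 → ℝ}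

/-- The kernel `1_D f_m σ_m`. -/
def srcKernel (D : Set E3) (σ : Fin 3 → E3 → ℝ) (f : Fin 3 → E3 → ℂ) : Fin 3 → E3 → ℂ :=
  fun m => D.indicator fun y => f m y * (σ m y : ℂ)

/-- Square integrability of the strength of the source in `D`. -/
abbrev SqIntOn (D : Set E3) (σ : Fin 3 → E3 → ℝ) : Prop :=
  SqInt fun m => D.indicator fun y => (σ m y : ℂ)

lemma srcKernel_eq (f : Fin 3 → E3 → ℂ) (m : Fin 3) (y : E3) :
    srcKernel D σ f m y = f m y * D.indicator (fun y => (σ m y : ℂ)) y := by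
  by_cases h : y ∈ D <;> simp [srcKernel, h]

lemma norm_srcKernel_le {f : Fin 3 → E3 → ℂ} {C : ℝ} (m : Fin 3) (hC : ∀ y ∈ D, ‖f m y‖ ≤ C)
    (y : E3) : ‖srcKernel D σ f m y‖ ≤ C * ‖D.indicator (fun y => (σ m y : ℂ)) y‖ := by
  rw [srcKernel_eq, norm_mul]
  by_cases hy : y ∈ D
  · gcongr; exact hC y hy
  · simp [hy]

lemma sqInt_srcKernel (hD : IsOpen D) (hDb : Bornology.IsBounded D) (hσ : SqIntOn D σ)
    {f : Fin 3 → E3 → ℂ} (hf : ∀ m, ContinuousOn (f m) (closure D)) : SqInt (srcKernel D σ f) := by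
  intro m
  obtain ⟨C, hC⟩ := hDb.isCompact_closure.exists_bound_of_continuousOn (hf m)
  refine ((hσ m).norm.const_mul C).mono' ?_ (Eventually.of_forall fun y =>
    norm_srcKernel_le m (fun y hy => hC y (subset_closure hy)) y)
  have h1 : AEStronglyMeasurable (D.indicator (f m)) (volume : Measure E3) :=
    (aestronglyMeasurable_indicator_iff hD.measurableSet).2
      (((hf m).mono subset_closure).aestronglyMeasurable hD.measurableSet)
  refine (h1.mul (hσ m).1).congr (Eventually.of_forall fun y => ?_)
  by_cases hy : y ∈ D <;> simp [srcKernel, hy]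

/-- `X` is almost surely the Wiener integral `∑_m ∫_D f_m σ_m dW_m` of a field `f` that is continuous
on the closure of `D`. -/
def IsSrcIntegral (P : Measure Ω) (W : Fin 3 → Lp ℝ 2 (volume : Measure E3) → Ω → ℝ) (D : Set E3)
    (σ : Fin 3 → E3 → ℝ) (X : Ω → ℂ) (f : Fin 3 → E3 → ℂ) : Prop :=
  (∀ m, ContinuousOn (f m) (closure D)) ∧ X =ᵐ[P] wienerSum W (srcKernel D σ f)

lemma IsSrcIntegral.congr_ae {X Y : Ω → ℂ} {f : Fin 3 → E3 → ℂ} (h : IsSrcIntegral P W D σ X f)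
    (hXY : X =ᵐ[P] Y) : IsSrcIntegral P W D σ Y f := ⟨h.1, hXY.symm.trans h.2⟩

lemma IsSrcIntegral.add (hW : IsWhiteNoise W P) (hD : IsOpen D) (hDb : Bornology.IsBounded D)
    (hσ : SqIntOn D σ) {X Y : Ω → ℂ} {f g : Fin 3 → E3 → ℂ} (hX : IsSrcIntegral P W D σ X f)
    (hY : IsSrcIntegral P W D σ Y g) :
    IsSrcIntegral P W D σ (fun ω => X ω + Y ω) (fun m y => f m y + g m y) := by
  refine ⟨fun m => (hX.1 m).add (hY.1 m), ?_⟩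
  have e : srcKernel D σ (fun m y => f m y + g m y) =
      fun m y => srcKernel D σ f m y + srcKernel D σ g m y := by
    funext m y; simp only [srcKernel_eq]; ring
  rw [e]
  filter_upwards [hX.2, hY.2, hW.wienerSum_add (sqInt_srcKernel hD hDb hσ hX.1)
    (sqInt_srcKernel hD hDb hσ hY.1)] with ω h1 h2 h3
  rw [h1, h2, h3]

lemma IsSrcIntegral.const_mul (hW : IsWhiteNoise W P) (hD : IsOpen D) (hDb : Bornology.IsBounded D)
    (hσ : SqIntOn D σ) {X : Ω → ℂ} {f : Fin 3 → E3 → ℂ} (hX : IsSrcIntegral P W D σ X f) (c : ℂ) :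
    IsSrcIntegral P W D σ (fun ω => c * X ω) (fun m y => c * f m y) := by
  refine ⟨fun m => continuousOn_const.mul (hX.1 m), ?_⟩
  have e : srcKernel D σ (fun m y => c * f m y) = fun m y => c * srcKernel D σ f m y := by
    funext m y; simp only [srcKernel_eq]; ring
  rw [e]
  filter_upwards [hX.2, hW.wienerSum_const_mul (sqInt_srcKernel hD hDb hσ hX.1) c] with ω h1 h2
  rw [h1, h2]

lemma IsSrcIntegral.sub (hW : IsWhiteNoise W P) (hD : IsOpen D) (hDb : Bornology.IsBounded D)
    (hσ : SqIntOn D σ) {X Y : Ω → ℂ} {f g : Fin 3 → E3 → ℂ} (hX : IsSrcIntegral P W D σ X f)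
    (hY : IsSrcIntegral P W D σ Y g) :
    IsSrcIntegral P W D σ (fun ω => X ω - Y ω) (fun m y => f m y - g m y) := by
  have h := hX.add hW hD hDb hσ (hY.const_mul hW hD hDb hσ (-1))
  simpa [sub_eq_add_neg] using h

lemma IsSrcIntegral.sum (hW : IsWhiteNoise W P) (hD : IsOpen D) (hDb : Bornology.IsBounded D)
    (hσ : SqIntOn D σ) {ι : Type*} (s : Finset ι) {X : ι → Ω → ℂ} {f : ι → Fin 3 → E3 → ℂ}
    (hX : ∀ i ∈ s, IsSrcIntegral P W D σ (X i) (f i)) :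
    IsSrcIntegral P W D σ (fun ω => ∑ i ∈ s, X i ω) (fun m y => ∑ i ∈ s, f i m y) := by
  classical
  induction s using Finset.induction_on with
  | empty =>
    refine ⟨fun m => by simpa using continuousOn_const, ?_⟩
    have e : srcKernel D σ (fun m y => ∑ i ∈ (∅ : Finset ι), f i m y) = fun _ _ => 0 := by
      funext m y; simp [srcKernel_eq]
    rw [e]
    simpa using hW.wienerSum_zero.symm
  | insert a s ha ih =>
    simp only [Finset.sum_insert ha]
    exact (hX a (Finset.mem_insert_self a s)).add hW hD hDb hσ
      (ih fun i hi => hX i (Finset.mem_insert_of_mem hi))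

/-- Passage to the limit for uniformly bounded kernels. -/
lemma IsSrcIntegral.of_tendsto (hW : IsWhiteNoise W P) (hD : IsOpen D)
    (hDb : Bornology.IsBounded D) (hσ : SqIntOn D σ) {X : Ω → ℂ} {Xn : ℕ → Ω → ℂ}
    {f : Fin 3 → E3 → ℂ} {fn : ℕ → Fin 3 → E3 → ℂ} (C : ℝ)
    (hXn : ∀ n, IsSrcIntegral P W D σ (Xn n) (fn n))
    (hf : ∀ m, ContinuousOn (f m) (closure D))
    (hdom : ∀ n m, ∀ y ∈ D, ‖fn n m y‖ ≤ C)
    (hconv : ∀ m, ∀ y ∈ D, Tendsto (fun n => fn n m y) atTop (𝓝 (f m y)))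
    (hlim : ∀ᵐ ω ∂P, Tendsto (fun n => Xn n ω) atTop (𝓝 (X ω))) : IsSrcIntegral P W D σ X f := by
  refine ⟨hf, (hW.ae_eq_wienerSum_of_dominated (g := fun m y =>
    C * ‖D.indicator (fun y => (σ m y : ℂ)) y‖) (fun m => (hσ m).norm.const_mul C)
    (fun n => sqInt_srcKernel hD hDb hσ (hXn n).1)
    (fun n m y => norm_srcKernel_le m (hdom n m) y) (fun m y => ?_) (fun n => (hXn n).2) hlim).2⟩
  simp only [srcKernel_eq]
  by_cases hy : y ∈ D
  · exact (hconv m y hy).mul_const _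
  · simp [hy]

/-- Differentiation of a random field with a convolution kernel outside of the source region: the
difference quotients of the kernels are bounded by the mean value inequality, and those of the field
converge along almost every path. -/
lemma IsSrcIntegral.pd (hW : IsWhiteNoise W P) (hD : IsOpen D) (hDb : Bornology.IsBounded D)
    (hσ : SqIntOn D σ) {v : E3 → Ω → ℂ} {H : Fin 3 → E3 → ℂ}
    (hH : ∀ m z, z ≠ 0 → ContDiffAt ℝ (⊤ : ℕ∞) (H m) z) {x : E3} (hx : x ∉ closure D)
    (hv : ∀ x', x' ∉ closure D → IsSrcIntegral P W D σ (v x') (fun m y => H m (x' - y)))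
    (hdiff : ∀ᵐ ω ∂P, DifferentiableAt ℝ (fun x => v x ω) x) (l : Fin 3) :
    IsSrcIntegral P W D σ (fun ω => RandomSource.pd l (fun x => v x ω) x)
      (fun m y => RandomSource.pd l (H m) (x - y)) := by
  obtain ⟨r, hr, hball⟩ := Metric.isOpen_iff.1 isClosed_closure.isOpen_compl x hx
  set ρ := r / 2 with hρ
  have hρ0 : 0 < ρ := by positivity
  have hsub : ∀ x' ∈ closedBall x ρ, x' ∉ closure D := fun x' hx' =>
    hball (closedBall_subset_ball (by linarith) hx')
  have hne : ∀ x' ∈ closedBall x ρ, ∀ y ∈ closure D, x' - y ≠ 0 := fun x' hx' y hy h => by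
    rw [sub_eq_zero] at h
    exact hsub x' hx' (h ▸ hy)
  -- a bound of the derivatives of the kernels near `x`
  have hcf : ∀ m, ContinuousOn (fun p : E3 × E3 => fderiv ℝ (H m) (p.1 - p.2))
      (closedBall x ρ ×ˢ closure D) := fun m p hp => by
    have h1 : ContinuousAt (fderiv ℝ (H m)) (p.1 - p.2) :=
      ((hH m _ (hne p.1 hp.1 p.2 hp.2)).fderiv_right (m := (⊤ : ℕ∞)) (by simp)).continuousAt
    exact (ContinuousAt.comp (f := fun p : E3 × E3 => p.1 - p.2) h1
      (by fun_prop)).continuousWithinAt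
  have hcomp : IsCompact (closedBall x ρ ×ˢ closure D) :=
    (isCompact_closedBall x ρ).prod hDb.isCompact_closure
  choose C hC using fun m => hcomp.exists_bound_of_continuousOn (hcf m)
  have hnorm : ‖unitVec l‖ = 1 := by simp [unitVec]
  -- step widths of the difference quotients
  set c : ℕ → ℝ := fun n => ρ * (1 / ((n : ℝ) + 1)) with hc
  have hc0 : ∀ n, 0 < c n := fun n => by positivity
  have hcρ : ∀ n, c n ≤ ρ := fun n => by
    have : 1 / ((n : ℝ) + 1) ≤ 1 := by
      rw [div_le_one (by positivity)]; linarith [(Nat.cast_nonneg n : (0 : ℝ) ≤ n)]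
    calc c n ≤ ρ * 1 := by simp only [hc]; gcongr
      _ = ρ := mul_one ρ
  have hclim : Tendsto c atTop (𝓝[≠] 0) := by
    refine tendsto_nhdsWithin_iff.2 ⟨?_, Eventually.of_forall fun n => (hc0 n).ne'⟩
    have h := (tendsto_one_div_add_atTop_nhds_zero_nat (𝕜 := ℝ)).const_mul ρ
    rwa [mul_zero] at h
  have hmem : ∀ n, x + c n • unitVec l ∈ closedBall x ρ := fun n => by
    rw [mem_closedBall, dist_self_add_left, norm_smul, hnorm, mul_one, Real.norm_of_nonneg (hc0 n).le]
    exact hcρ n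
  have hxm : x ∈ closedBall x ρ := mem_closedBall_self hρ0.le
  have hconvg : ∀ f : E3 → ℂ, DifferentiableAt ℝ f x → Tendsto (fun n =>
      ((c n)⁻¹ : ℂ) * (f (x + c n • unitVec l) - f x)) atTop (𝓝 (RandomSource.pd l f x)) :=
    fun f hf => by
      have h := (hf.hasFDerivAt.hasLineDerivAt (unitVec l)).tendsto_slope_zero.comp hclim
      refine h.congr fun n => ?_
      simp [Complex.real_smul]
  refine IsSrcIntegral.of_tendsto hW hD hDb hσ (Xn := fun n ω =>
      ((c n)⁻¹ : ℂ) * (v (x + c n • unitVec l) ω - v x ω)) (fn := fun n m y =>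
      ((c n)⁻¹ : ℂ) * (H m (x + c n • unitVec l - y) - H m (x - y))) (∑ m, |C m|)
    (fun n => ?_) (fun m => ?_) ?_ ?_ ?_
  · exact ((hv _ (hsub _ (hmem n))).sub hW hD hDb hσ (hv x hx)).const_mul hW hD hDb hσ _
  · intro y hy
    have h1 := (contDiffAt_pd (hH m _ (hne x hxm y hy)) l).continuousAt
    exact (ContinuousAt.comp (f := fun y : E3 => x - y) h1 (by fun_prop)).continuousWithinAt
  · intro n m y hy
    have hy' := subset_closure hy
    have hmv := (convex_closedBall x ρ).norm_image_sub_le_of_norm_fderiv_le (𝕜 := ℝ)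
      (f := fun x => H m (x - y)) (C := |C m|) (fun x' hx' => ?_) (fun x' hx' => ?_) hxm (hmem n)
    · rw [add_sub_cancel_left, norm_smul, hnorm, mul_one, Real.norm_of_nonneg (hc0 n).le] at hmv
      rw [norm_mul, norm_inv, Complex.norm_real, Real.norm_of_nonneg (hc0 n).le]
      calc (c n)⁻¹ * ‖H m (x + c n • unitVec l - y) - H m (x - y)‖
          ≤ (c n)⁻¹ * (|C m| * c n) := by
            have := (hc0 n).le
            gcongr
        _ = |C m| := by field_simp [(hc0 n).ne']
        _ ≤ ∑ m, |C m| := Finset.single_le_sum (f := fun m => |C m|) (fun i _ => abs_nonneg _)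
            (Finset.mem_univ m)
    · exact (differentiableAt_of_smooth (hH m _ (hne x' hx' y hy'))).comp
        (f := fun x => x - y) x' (by fun_prop)
    · rw [fderiv_comp_sub]
      exact (hC m (x', y) ⟨hx', hy'⟩).trans (le_abs_self _)
  · intro m y hy
    have h := hconvg (fun x => H m (x - y))
      ((differentiableAt_of_smooth (hH m _ (hne x hxm y (subset_closure hy)))).comp
        (f := fun x => x - y) x (by fun_prop))
    rwa [pd_comp_sub] at h
  · filter_upwards [hdiff] with ω hω
    exact hconvg _ hω

/-- Quadrature rules on the sphere that converge for all continuous functions: the integrals of the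
compositions with simple functions approximating the identity. -/
lemma exists_quadrature {R : ℝ} (hR : 0 < R) : ∃ (s : ℕ → Finset E3) (w : ℕ → E3 → ℝ),
    (∀ n, ∀ p ∈ s n, p ∈ sphere (0 : E3) R) ∧ (∀ n p, 0 ≤ w n p) ∧
    (∀ n, ∑ p ∈ s n, w n p = (surfaceMeasure R).real Set.univ) ∧
    ∀ g : E3 → ℂ, ContinuousOn g (sphere 0 R) →
      Tendsto (fun n => ∑ p ∈ s n, (w n p : ℂ) * g p) atTop (𝓝 (∫ x, g x ∂(surfaceMeasure R))) := by
  have hp0 : R • unitVec 0 ∈ sphere (0 : E3) R := by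
    simp [norm_smul, unitVec, abs_of_pos hR]
  have : (sphere (0 : E3) R).Nonempty := ⟨_, hp0⟩
  set q : ℕ → SimpleFunc E3 E3 := fun n =>
    SimpleFunc.approxOn id measurable_id (sphere (0 : E3) R) _ hp0 n with hq
  have hsum : ∀ n (g : E3 → ℂ), ∑ p ∈ (q n).range,
      (((surfaceMeasure R).real (q n ⁻¹' {p}) : ℝ) : ℂ) * g p =
        ∫ x, g (q n x) ∂(surfaceMeasure R) := by
    intro n g
    have e : ∀ x, g (q n x) = ∑ p ∈ (q n).range, (q n ⁻¹' {p}).indicator (fun _ => g p) x := by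
      intro x
      rw [Finset.sum_eq_single (q n x)]
      · simp
      · intro p _ hp
        rw [Set.indicator_of_notMem]
        simpa using hp.symm
      · intro h; exact absurd (SimpleFunc.mem_range_self _ _) h
    simp only [e]
    rw [integral_finsetSum]
    · refine Finset.sum_congr rfl fun p _ => ?_
      rw [integral_indicator_const _ ((q n).measurableSet_fiber p)]
      simp [Complex.real_smul]
    · intro p _
      exact (integrable_const (g p)).indicator ((q n).measurableSet_fiber p)
  have hqs : ∀ n x, q n x ∈ sphere (0 : E3) R := fun n x => SimpleFunc.approxOn_mem _ _ n x
  refine ⟨fun n => (q n).range, fun n p => (surfaceMeasure R).real (q n ⁻¹' {p}), ?_,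
    fun n p => measureReal_nonneg, ?_, ?_⟩
  · intro n p hp
    obtain ⟨x, rfl⟩ := SimpleFunc.mem_range.1 hp
    exact hqs n x
  · intro n
    have h := hsum n (fun _ => 1)
    simp only [mul_one, integral_const, Complex.real_smul] at h
    exact_mod_cast h
  · intro g hg
    simp only [hsum]
    obtain ⟨C, hC⟩ := (isCompact_sphere (0 : E3) R).exists_bound_of_continuousOn hg
    refine tendsto_integral_of_dominated_convergence (fun _ => C) (fun n => ?_)
      (integrable_const C) (fun n => Eventually.of_forall fun x => hC _ (hqs n x)) ?_
    · exact ((q n).map g).aestronglyMeasurable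
    · filter_upwards [ae_mem_sphere hR] with x hx
      have h1 : Tendsto (fun n => q n x) atTop (𝓝 x) :=
        SimpleFunc.tendsto_approxOn measurable_id hp0 (subset_closure hx)
      exact (hg x hx).tendsto.comp (tendsto_nhdsWithin_iff.2
        ⟨h1, Eventually.of_forall fun n => hqs n x⟩)

/-- Integration of a random field over the sphere (a Fubini theorem for Wiener integrals, through
quadrature rules). -/
lemma IsSrcIntegral.surface_integral (hW : IsWhiteNoise W P) (hD : IsOpen D)
    (hDb : Bornology.IsBounded D) (hσ : SqIntOn D σ) {R : ℝ} (hR : 0 < R) {Y : E3 → Ω → ℂ}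
    {F : Fin 3 → E3 → E3 → ℂ}
    (hF : ∀ m, ContinuousOn (fun p : E3 × E3 => F m p.1 p.2) (sphere (0 : E3) R ×ˢ closure D))
    (hY : ∀ x ∈ sphere (0 : E3) R, IsSrcIntegral P W D σ (Y x) (fun m y => F m x y))
    (hcont : ∀ᵐ ω ∂P, ContinuousOn (fun x => Y x ω) (sphere (0 : E3) R))
    {f : Fin 3 → E3 → ℂ} (hf : ∀ m, ContinuousOn (f m) (closure D))
    (hFf : ∀ m, ∀ y ∈ D, ∫ x, F m x y ∂(surfaceMeasure R) = f m y) :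
    IsSrcIntegral P W D σ (fun ω => ∫ x, Y x ω ∂(surfaceMeasure R)) f := by
  obtain ⟨s, w, hs, hw, hws, hlim⟩ := exists_quadrature hR
  have hcomp : IsCompact (sphere (0 : E3) R ×ˢ closure D) :=
    (isCompact_sphere 0 R).prod hDb.isCompact_closure
  choose C hC using fun m => hcomp.exists_bound_of_continuousOn (hF m)
  refine IsSrcIntegral.of_tendsto hW hD hDb hσ (Xn := fun n ω => ∑ p ∈ s n, (w n p : ℂ) * Y p ω)
    (fn := fun n m y => ∑ p ∈ s n, (w n p : ℂ) * F m p y)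
    ((surfaceMeasure R).real Set.univ * ∑ m, |C m|) (fun n => ?_) hf ?_ ?_ ?_
  · exact IsSrcIntegral.sum hW hD hDb hσ _ fun p hp =>
      (hY p (hs n p hp)).const_mul hW hD hDb hσ _
  · intro n m y hy
    rw [← hws n, Finset.sum_mul]
    refine (norm_sum_le _ _).trans (Finset.sum_le_sum fun p hp => ?_)
    rw [norm_mul, Complex.norm_real, Real.norm_of_nonneg (hw n p)]
    refine mul_le_mul_of_nonneg_left ?_ (hw n p)
    exact ((hC m (p, y) ⟨hs n p hp, subset_closure hy⟩).trans (le_abs_self _)).trans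
      (Finset.single_le_sum (f := fun m => |C m|) (fun i _ => abs_nonneg _) (Finset.mem_univ m))
  · intro m y hy
    rw [← hFf m y hy]
    refine hlim _ ?_
    exact (hF m).comp (f := fun x : E3 => (x, y)) (by fun_prop) fun x hx => ⟨hx, subset_closure hy⟩
  · filter_upwards [hcont] with ω hω
    exact hlim _ hω

end SourceKernel

/-! ### The boundary functionals of the wave field -/

section StochasticGreen

open Filter Topology Metric

variable {Ω : Type*} [MeasurableSpace Ω] {P : Measure Ω}
  {W : Fin 3 → Lp ℝ 2 (volume : Measure E3) → Ω → ℝ} {D : Set E3} {σ : Fin 3 → E3 → ℝ}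
  {lam mu κ : ℝ} {u : E3 → Ω → C3}

lemma IsMildSolution.isSrcIntegral (hu : IsMildSolution P lam mu κ D σ W u) {x : E3}
    (hx : x ∉ closure D) (i : Fin 3) :
    IsSrcIntegral P W D σ (fun ω => u x ω i) (fun m y => greenKernel lam mu κ i m (x - y)) := by
  constructor
  · intro m y hy
    have hne : x - y ≠ 0 := fun h => hx ((sub_eq_zero.1 h) ▸ hy)
    exact (ContinuousAt.comp (f := fun y : E3 => x - y)
      (contDiffAt_greenKernel lam mu κ i m hne).continuousAt (by fun_prop)).continuousWithinAt
  · filter_upwards [hu.mild x] with ω hω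
    rw [hω i]
    simp only [greenTensor_eq]
    rfl

lemma IsMildSolution.ae_contDiffAt (hu : IsMildSolution P lam mu κ D σ W u) :
    ∀ᵐ ω ∂P, ∀ x ∉ closure D, ContDiffAt ℝ 1 (fun x => u x ω) x := by
  filter_upwards [hu.regular] with ω hω x hx
  exact hω.contDiffAt (isClosed_closure.isOpen_compl.mem_nhds hx)

lemma contDiffAt_component {v : E3 → C3} {x : E3} {n : WithTop ℕ∞} (hv : ContDiffAt ℝ n v x)
    (i : Fin 3) : ContDiffAt ℝ n (fun x => v x i) x :=
  ((EuclideanSpace.proj i : C3 →L[ℂ] ℂ).restrictScalars ℝ).contDiff.contDiffAt.comp x hv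

lemma IsMildSolution.isSrcIntegral_pd (hu : IsMildSolution P lam mu κ D σ W u)
    (hW : IsWhiteNoise W P) (hD : IsOpen D) (hDb : Bornology.IsBounded D)
    (hσ : SqIntOn D σ) {x : E3} (hx : x ∉ closure D) (l i : Fin 3) :
    IsSrcIntegral P W D σ (fun ω => pd l (fun x => u x ω i) x)
      (fun m y => pd l (greenKernel lam mu κ i m) (x - y)) := by
  refine IsSrcIntegral.pd hW hD hDb hσ (v := fun x ω => u x ω i)
    (fun m z hz => contDiffAt_greenKernel lam mu κ i m hz) hx
    (fun x' hx' => hu.isSrcIntegral hx' i) ?_ l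
  filter_upwards [hu.ae_contDiffAt] with ω hω
  exact (contDiffAt_component (hω x hx) i).differentiableAt (by simp)

lemma IsMildSolution.isSrcIntegral_boundaryOp (hu : IsMildSolution P lam mu κ D σ W u)
    (hW : IsWhiteNoise W P) (hD : IsOpen D) (hDb : Bornology.IsBounded D)
    (hσ : SqIntOn D σ) {x : E3} (hx : x ∉ closure D) (j : Fin 3) :
    IsSrcIntegral P W D σ (fun ω => boundaryOp lam mu (fun y => u y ω) x j)
      (fun m y => traction lam mu (fun j x => greenKernel lam mu κ j m (x - y)) x j) := by
  have h : IsSrcIntegral P W D σ (fun ω => traction lam mu (fun j x => u x ω j) x j)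
      (fun m y => traction lam mu (fun j x => greenKernel lam mu κ j m (x - y)) x j) := by
    simp only [traction, pd_comp_sub]
    have h1 := fun l i => hu.isSrcIntegral_pd hW hD hDb hσ hx l i
    refine IsSrcIntegral.add hW hD hDb hσ ?_ ?_
    · exact (IsSrcIntegral.sum hW hD hDb hσ _ fun i _ =>
        (h1 i j).const_mul hW hD hDb hσ _).const_mul hW hD hDb hσ _
    · have h2 := ((IsSrcIntegral.sum hW hD hDb hσ Finset.univ fun i _ => h1 i i).const_mul hW hD hDb hσ
        (((lam + mu : ℝ) : ℂ))).const_mul hW hD hDb hσ ((‖x‖⁻¹ * x j : ℝ) : ℂ)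
      simpa only [mul_comm (((‖x‖⁻¹ * x j : ℝ) : ℂ))] using h2
  refine h.congr_ae ?_
  filter_upwards [hu.ae_contDiffAt] with ω hω
  exact (boundaryOp_eq_traction lam mu ((hω x hx).differentiableAt (by simp)) j).symm

lemma continuousAt_boundaryOp (lam mu : ℝ) {v : E3 → C3} {x : E3} (hx : x ≠ 0)
    (hv : ContDiffAt ℝ 1 v x) : ContinuousAt (boundaryOp lam mu v) x := by
  have h1 : ContinuousAt (fderiv ℝ v) x := (hv.fderiv_right (m := 0) (by simp)).continuousAt
  have h2 : ContinuousAt (fun x : E3 => ‖x‖⁻¹) x :=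
    continuousAt_id.norm.inv₀ (norm_ne_zero_iff.2 hx)
  have h3 : ContinuousAt (fun x : E3 => ‖x‖⁻¹ • x) x := h2.smul continuousAt_id
  have h4 : ∀ j : Fin 3, ContinuousAt (fun x => fderiv ℝ v x (unitVec j) j) x := fun j => by
    have h := h1.clm_apply (continuousAt_const (y := unitVec j))
    exact ((EuclideanSpace.proj j : C3 →L[ℂ] ℂ).continuous.continuousAt).comp
      (f := fun x => fderiv ℝ v x (unitVec j)) h
  have h5 : ContinuousAt (fun x : E3 => (WithLp.toLp 2 (fun j => ((‖x‖⁻¹ * x j : ℝ) : ℂ)) : C3)) x := by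
    have h : ContinuousAt (fun x : E3 => fun j : Fin 3 => ((‖x‖⁻¹ * x j : ℝ) : ℂ)) x :=
      continuousAt_pi.2 fun j => Complex.continuous_ofReal.continuousAt.comp
        (f := fun x : E3 => ‖x‖⁻¹ * x j) (h2.mul (by fun_prop))
    exact (PiLp.continuous_toLp 2 (fun _ : Fin 3 => ℂ)).continuousAt.comp h
  have h6 : ContinuousAt (fun x => fderiv ℝ v x (‖x‖⁻¹ • x)) x := h1.clm_apply h3
  have h7 : ContinuousAt (fun x => ∑ j, fderiv ℝ v x (unitVec j) j) x :=
    tendsto_finsetSum _ fun j _ => h4 j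
  have h8 := (h6.const_smul (mu : ℂ)).add
    (((continuousAt_const (y := ((lam + mu : ℝ) : ℂ))).mul h7).smul h5)
  exact h8

lemma contDiff_expSol (θ : Fin 3 → ℝ) (κs : ℝ) (ξ : E3) (k : Fin 3) (l : Fin 2) :
    ContDiff ℝ 1 (expSol θ κs ξ k l) := by
  rw [contDiff_piLp 2]
  intro j
  exact contDiff_const.mul ((contDiff_planeWave _).of_le (by simp))

lemma not_mem_closure_of_mem_sphere {R : ℝ} (hDR : closure D ⊆ ball 0 R) {x : E3}
    (hx : x ∈ sphere (0 : E3) R) : x ∉ closure D := fun h => by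
  have := hDR h
  rw [mem_ball_zero_iff] at this
  rw [mem_sphere_zero_iff_norm] at hx
  linarith

/-- Green's formula for the mild solution: the boundary functional of the exact data is the Wiener
integral of the exponential solution over the source region. -/
lemma IsMildSolution.isSrcIntegral_boundaryFunctional (hu : IsMildSolution P lam mu κ D σ W u)
    (hmu : 0 < mu) (hlam : 0 < lam + 2 * mu) (hκ : 0 < κ)
    (hW : IsWhiteNoise W P) (hD : IsOpen D) (hDb : Bornology.IsBounded D)
    (hσ : SqIntOn D σ) {R : ℝ} (hR : 0 < R) (hDR : closure D ⊆ ball 0 R) (θ : Fin 3 → ℝ) {ξ : E3}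
    (hξ : ‖ξ‖ < 2 * kappaS mu κ) (k : Fin 3) (l : Fin 2) :
    IsSrcIntegral P W D σ (fun ω => boundaryFunctional lam mu κ R θ ξ k l (fun y => u y ω)
        (fun x => boundaryOp lam mu (fun y => u y ω) x))
      (fun m y => expSol θ (kappaS mu κ) ξ k l y m) := by
  have hκs : 0 < kappaS mu κ := div_pos hκ (Real.sqrt_pos.2 hmu)
  have hUc : Continuous (expSol θ (kappaS mu κ) ξ k l) := (contDiff_expSol _ _ _ _ _).continuous
  have hUj : ∀ j, Continuous fun x => expSol θ (kappaS mu κ) ξ k l x j := fun j =>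
    (EuclideanSpace.proj j : C3 →L[ℂ] ℂ).continuous.comp hUc
  have hx0 : ∀ x ∈ sphere (0 : E3) R, x ≠ 0 := fun x hx h => by
    rw [mem_sphere_zero_iff_norm, h, norm_zero] at hx; linarith
  have hBc : ∀ j, ∀ x ∈ sphere (0 : E3) R,
      ContinuousAt (fun x => boundaryOp lam mu (expSol θ (kappaS mu κ) ξ k l) x j) x :=
    fun j x hx => ((EuclideanSpace.proj j : C3 →L[ℂ] ℂ).continuous.continuousAt).comp
      (continuousAt_boundaryOp lam mu (hx0 x hx) (contDiff_expSol _ _ _ _ _).contDiffAt)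
  have hcD := fun x hx => not_mem_closure_of_mem_sphere hDR (x := x) hx
  unfold boundaryFunctional
  refine IsSrcIntegral.surface_integral hW hD hDb hσ hR (F := fun m x y =>
    (∑ j, traction lam mu (fun j x => greenKernel lam mu κ j m (x - y)) x j *
      expSol θ (kappaS mu κ) ξ k l x j) -
    ∑ j, boundaryOp lam mu (expSol θ (kappaS mu κ) ξ k l) x j * greenKernel lam mu κ j m (x - y))
    ?_ ?_ ?_ ?_ ?_
  -- joint continuity of the kernel of the integrand
  · intro m p hp
    have hne : p.1 - p.2 ≠ 0 := fun h => hcD p.1 hp.1 ((sub_eq_zero.1 h) ▸ hp.2)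
    have hsubc : ContinuousAt (fun p : E3 × E3 => p.1 - p.2) p := by fun_prop
    have hg : ∀ j, ContinuousAt (fun p : E3 × E3 => greenKernel lam mu κ j m (p.1 - p.2)) p := fun j =>
      ContinuousAt.comp (f := fun p : E3 × E3 => p.1 - p.2)
        (contDiffAt_greenKernel lam mu κ j m hne).continuousAt hsubc
    have hdg : ∀ l j, ContinuousAt (fun p : E3 × E3 => pd l (greenKernel lam mu κ j m) (p.1 - p.2)) p :=
      fun l j => ContinuousAt.comp (f := fun p : E3 × E3 => p.1 - p.2)
        (contDiffAt_pd (contDiffAt_greenKernel lam mu κ j m hne) l).continuousAt hsubc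
    have hn : ∀ i : Fin 3, ContinuousAt (fun p : E3 × E3 => ((‖p.1‖⁻¹ * p.1 i : ℝ) : ℂ)) p := fun i =>
      Complex.continuous_ofReal.continuousAt.comp (f := fun p : E3 × E3 => ‖p.1‖⁻¹ * p.1 i)
        ((continuousAt_fst.norm.inv₀ (norm_ne_zero_iff.2 (hx0 _ hp.1))).mul (by fun_prop))
    have ht : ∀ j, ContinuousAt (fun p : E3 × E3 =>
        traction lam mu (fun j x => greenKernel lam mu κ j m (x - p.2)) p.1 j) p := fun j => by
      simp only [traction, pd_comp_sub]
      exact (continuousAt_const.mul (tendsto_finsetSum _ fun i _ => (hn i).mul (hdg i j))).add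
        ((continuousAt_const.mul (tendsto_finsetSum _ fun i _ => hdg i i)).mul (hn j))
    refine ContinuousAt.continuousWithinAt (ContinuousAt.sub
      (tendsto_finsetSum _ fun j _ => (ht j).mul ?_)
      (tendsto_finsetSum _ fun j _ => ContinuousAt.mul ?_ (hg j)))
    · exact ((hUj j).comp continuous_fst).continuousAt
    · exact ContinuousAt.comp (f := Prod.fst) (hBc j p.1 hp.1) continuousAt_fst
  -- at each point of the sphere the integrand is a Wiener integral
  · intro x hx
    refine IsSrcIntegral.sub hW hD hDb hσ (IsSrcIntegral.sum hW hD hDb hσ _ fun j _ => ?_)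
      (IsSrcIntegral.sum hW hD hDb hσ _ fun j _ =>
        (hu.isSrcIntegral (hcD x hx) j).const_mul hW hD hDb hσ _)
    have h := (hu.isSrcIntegral_boundaryOp hW hD hDb hσ (hcD x hx) j).const_mul hW hD hDb hσ
      (expSol θ (kappaS mu κ) ξ k l x j)
    simpa only [mul_comm (expSol θ (kappaS mu κ) ξ k l x j)] using h
  -- almost every path of the integrand is continuous
  · filter_upwards [hu.ae_contDiffAt] with ω hω x hx
    have hd := hω x (hcD x hx)
    refine ContinuousAt.continuousWithinAt (ContinuousAt.sub
      (tendsto_finsetSum _ fun j _ => ContinuousAt.mul ?_ (hUj j).continuousAt)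
      (tendsto_finsetSum _ fun j _ => (hBc j x hx).mul (contDiffAt_component hd j).continuousAt))
    exact ((EuclideanSpace.proj j : C3 →L[ℂ] ℂ).continuous.continuousAt).comp
      (continuousAt_boundaryOp lam mu (hx0 x hx) hd)
  · exact fun m => (hUj m).continuousOn
  -- the integrated kernel is the exponential solution
  · intro m y hy
    have hyR : ‖y‖ < R := mem_ball_zero_iff.1 (hDR (subset_closure hy))
    have h := green_navier hmu hlam hκ hR (norm_zetaVec θ k l hκs hξ) (inner_eta_zeta θ k l hκs hξ)
      hyR m
    rw [expSol_apply, ← h]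
    congr 1
    funext x
    simp only [boundaryOp_eq_traction lam mu (differentiableAt_expSol _ _ _ _ _ x)]
    rfl

end StochasticGreen

/-! ### Moments of the boundary functionals and Monte Carlo averages -/

section Moments

open Filter Topology Metric

variable {Ω : Type*} [MeasurableSpace Ω] {P : Measure Ω}

lemma integral_sq_average_sub_le [IsProbabilityMeasure P] {N : ℕ} (hN : 0 < N)
    {Z : Fin N → Ω → ℝ} (hZ : ∀ n, MemLp (Z n) 2 P)
    (hind : ∀ i j, i ≠ j → IndepFun (Z i) (Z j) P) {c : ℝ} (hmean : ∀ n, ∫ ω, Z n ω ∂P = c) :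
    ∫ ω, ((1 / (N : ℝ)) * ∑ n, Z n ω - c) ^ 2 ∂P ≤
      (1 / (N : ℝ)) ^ 2 * ∑ n, ∫ ω, Z n ω ^ 2 ∂P := by
  have hN' : (N : ℝ) ≠ 0 := by positivity
  have hsum : MemLp (fun ω => (1 / (N : ℝ)) * ∑ n, Z n ω) 2 P :=
    (memLp_finsetSum _ fun n _ => hZ n).const_mul _
  have hmean' : ∫ ω, (1 / (N : ℝ)) * ∑ n, Z n ω ∂P = c := by
    rw [integral_const_mul, integral_finsetSum _ fun n _ => (hZ n).integrable one_le_two]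
    simp only [hmean, Finset.sum_const, Finset.card_univ, Fintype.card_fin, nsmul_eq_mul]
    field_simp
  have hvar := variance_eq_integral hsum.1.aemeasurable
  rw [hmean'] at hvar
  rw [← hvar, variance_const_mul]
  gcongr
  have hs := IndepFun.variance_sum (s := Finset.univ) (X := Z) (fun i _ => hZ i)
    (fun i _ j _ hij => hind i j hij)
  have e : (∑ n, Z n) = fun ω => ∑ n, Z n ω := by funext ω; simp
  rw [e] at hs
  rw [hs]
  refine Finset.sum_le_sum fun n _ => ?_
  have := variance_le_expectation_sq (hZ n).1
  simpa using this

/-- The mean square error of a Monte Carlo average. -/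
lemma integral_norm_sq_average_sub_le [IsProbabilityMeasure P] {N : ℕ} (hN : 0 < N)
    {Z : Fin N → Ω → ℂ} (hZ : ∀ n, MemLp (Z n) 2 P) (hind : iIndepFun Z P) {c : ℂ}
    (hmean : ∀ n, ∫ ω, Z n ω ∂P = c) {B : ℝ} (hB : ∀ n, ∫ ω, ‖Z n ω‖ ^ 2 ∂P ≤ B) :
    ∫ ω, ‖(1 / (N : ℂ)) * ∑ n, Z n ω - c‖ ^ 2 ∂P ≤ B / N := by
  have hre : ∀ n, MemLp (fun ω => (Z n ω).re) 2 P := fun n => (hZ n).re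
  have him : ∀ n, MemLp (fun ω => (Z n ω).im) 2 P := fun n => (hZ n).im
  have hi : ∀ n, Integrable (Z n) P := fun n => (hZ n).integrable one_le_two
  have mre : ∀ n, ∫ ω, (Z n ω).re ∂P = c.re := fun n => by
    have := integral_re (hi n)
    rw [hmean n] at this
    simpa using this
  have mim : ∀ n, ∫ ω, (Z n ω).im ∂P = c.im := fun n => by
    have := integral_im (hi n)
    rw [hmean n] at this
    simpa using this
  have h1 := integral_sq_average_sub_le hN hre (fun i j hij =>
    (hind.indepFun hij).comp Complex.measurable_re Complex.measurable_re) mre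
  have h2 := integral_sq_average_sub_le hN him (fun i j hij =>
    (hind.indepFun hij).comp Complex.measurable_im Complex.measurable_im) mim
  have e : ∀ ω, ‖(1 / (N : ℂ)) * ∑ n, Z n ω - c‖ ^ 2 =
      ((1 / (N : ℝ)) * ∑ n, (Z n ω).re - c.re) ^ 2 +
        ((1 / (N : ℝ)) * ∑ n, (Z n ω).im - c.im) ^ 2 := fun ω => by
    rw [← Complex.normSq_eq_norm_sq, Complex.normSq_apply]
    have : (1 / (N : ℂ)) = ((1 / (N : ℝ) : ℝ) : ℂ) := by push_cast; rfl
    rw [this, Complex.sub_re, Complex.sub_im, Complex.re_ofReal_mul, Complex.im_ofReal_mul,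
      Complex.re_sum, Complex.im_sum]
    ring
  have m1 : MemLp (fun ω => (1 / (N : ℝ)) * ∑ n, (Z n ω).re - c.re) 2 P :=
    ((memLp_finsetSum _ fun n _ => hre n).const_mul _).sub (memLp_const _)
  have m2 : MemLp (fun ω => (1 / (N : ℝ)) * ∑ n, (Z n ω).im - c.im) 2 P :=
    ((memLp_finsetSum _ fun n _ => him n).const_mul _).sub (memLp_const _)
  simp only [e]
  rw [integral_add m1.integrable_sq m2.integrable_sq]
  refine (add_le_add h1 h2).trans ?_
  rw [← mul_add, ← Finset.sum_add_distrib]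
  have h3 : ∀ n, ∫ ω, (Z n ω).re ^ 2 ∂P + ∫ ω, (Z n ω).im ^ 2 ∂P ≤ B := fun n => by
    rw [← integral_add (hre n).integrable_sq (him n).integrable_sq]
    refine le_trans (le_of_eq ?_) (hB n)
    congr 1; funext ω
    rw [← Complex.normSq_eq_norm_sq, Complex.normSq_apply]; ring
  calc (1 / (N : ℝ)) ^ 2 * ∑ n, (∫ ω, (Z n ω).re ^ 2 ∂P + ∫ ω, (Z n ω).im ^ 2 ∂P)
      ≤ (1 / (N : ℝ)) ^ 2 * ∑ n : Fin N, B := by gcongr with n; exact h3 n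
    _ = B / N := by
      have hN' : (N : ℝ) ≠ 0 := by positivity
      simp only [Finset.sum_const, Finset.card_univ, Fintype.card_fin, nsmul_eq_mul]
      field_simp

variable {W : Fin 3 → Lp ℝ 2 (volume : Measure E3) → Ω → ℝ} {D : Set E3} {σ : Fin 3 → E3 → ℝ}

/-- The total intensity `∑_m ∫_D σ_m²` of the source. -/
def srcEnergy (D : Set E3) (σ : Fin 3 → E3 → ℝ) : ℝ := ∑ m, ∫ y in D, σ m y ^ 2

lemma energy_srcKernel_le (hD : IsOpen D) (hσ : SqIntOn D σ)
    {f : Fin 3 → E3 → ℂ} (hf : ∀ m y, ‖f m y‖ ≤ 1) :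
    energy (srcKernel D σ f) ≤ srcEnergy D σ := by
  refine Finset.sum_le_sum fun m _ => ?_
  have e : ∫ y in D, σ m y ^ 2 = ∫ y, ‖D.indicator (fun y => (σ m y : ℂ)) y‖ ^ 2 := by
    rw [← integral_indicator hD.measurableSet]
    congr 1; funext y
    by_cases hy : y ∈ D <;> simp [hy]
  rw [e]
  refine integral_mono_of_nonneg (Eventually.of_forall fun y => by positivity)
    ((hσ m).integrable_norm_pow two_ne_zero) (Eventually.of_forall fun y => ?_)
  have := norm_srcKernel_le (D := D) (σ := σ) (f := f) (C := 1) m (fun y _ => hf m y) y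
  rw [one_mul] at this
  simp only
  gcongr

/-- The Fourier transform `∫_D σ_j² e^{-i ξ · y} dy` of the variance. -/
def srcFourier (D : Set E3) (σ : Fin 3 → E3 → ℝ) (ξ : E3) (j : Fin 3) : ℂ :=
  ∫ y in D, ((σ j y ^ 2 : ℝ) : ℂ) * planeWave (-ξ) y

variable {lam mu κ : ℝ} {u : E3 → Ω → C3}

/-- The boundary functional of the exact data. -/
def exactFunctional (lam mu κ R : ℝ) (u : E3 → Ω → C3) (θ : Fin 3 → ℝ) (ξ : E3) (k : Fin 3)
    (l : Fin 2) (ω : Ω) : ℂ :=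
  boundaryFunctional lam mu κ R θ ξ k l (fun y => u y ω)
    (fun x => boundaryOp lam mu (fun y => u y ω) x)

lemma norm_expSol_apply_le (θ : Fin 3 → ℝ) {κs : ℝ} (hκ : 0 < κs) {ξ : E3} (hξ : ‖ξ‖ < 2 * κs)
    (k : Fin 3) (l : Fin 2) (y : E3) (m : Fin 3) : ‖expSol θ κs ξ k l y m‖ ≤ 1 := by
  rw [expSol_apply, norm_mul, norm_planeWave, mul_one, Complex.norm_real]
  exact (PiLp.norm_apply_le (etaVec θ κs ξ k l) m).trans (norm_etaVec θ k l hκ hξ).le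

/-- The hypotheses on one sample of the wave field. -/
structure IsSample (P : Measure Ω) (lam mu κ R : ℝ) (D : Set E3) (σ : Fin 3 → E3 → ℝ)
    (W : Fin 3 → Lp ℝ 2 (volume : Measure E3) → Ω → ℝ) (u : E3 → Ω → C3) : Prop where
  mu_pos : 0 < mu
  lam_pos : 0 < lam + 2 * mu
  kappa_pos : 0 < κ
  radius_pos : 0 < R
  isOpen : IsOpen D
  isBounded : Bornology.IsBounded D
  closure_subset : closure D ⊆ ball 0 R
  sqIntOn : SqIntOn D σ
  whiteNoise : IsWhiteNoise W P
  mild : IsMildSolution P lam mu κ D σ W u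

variable {R : ℝ}

lemma IsSample.kappaS_pos (h : IsSample P lam mu κ R D σ W u) : 0 < kappaS mu κ :=
  div_pos h.kappa_pos (Real.sqrt_pos.2 h.mu_pos)

lemma IsSample.isSrcIntegral (h : IsSample P lam mu κ R D σ W u) (θ : Fin 3 → ℝ) {ξ : E3}
    (hξ : ‖ξ‖ < 2 * kappaS mu κ) (k : Fin 3) (l : Fin 2) :
    IsSrcIntegral P W D σ (exactFunctional lam mu κ R u θ ξ k l)
      (fun m y => expSol θ (kappaS mu κ) ξ k l y m) :=
  h.mild.isSrcIntegral_boundaryFunctional h.mu_pos h.lam_pos h.kappa_pos h.whiteNoise h.isOpen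
    h.isBounded h.sqIntOn h.radius_pos h.closure_subset θ hξ k l

lemma IsSample.sqInt (h : IsSample P lam mu κ R D σ W u) (θ : Fin 3 → ℝ) {ξ : E3}
    (hξ : ‖ξ‖ < 2 * kappaS mu κ) (k : Fin 3) (l : Fin 2) :
    SqInt (srcKernel D σ (fun m y => expSol θ (kappaS mu κ) ξ k l y m)) :=
  sqInt_srcKernel h.isOpen h.isBounded h.sqIntOn (h.isSrcIntegral θ hξ k l).1

lemma IsSample.integrable_pow_four (h : IsSample P lam mu κ R D σ W u) (θ : Fin 3 → ℝ) {ξ : E3}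
    (hξ : ‖ξ‖ < 2 * kappaS mu κ) (k : Fin 3) (l : Fin 2) :
    Integrable (fun ω => ‖exactFunctional lam mu κ R u θ ξ k l ω‖ ^ 4) P := by
  refine (h.whiteNoise.integrable_norm_pow_four (h.sqInt θ hξ k l)).congr ?_
  filter_upwards [(h.isSrcIntegral θ hξ k l).2] with ω hω
  rw [hω]

lemma IsSample.memLp_two (h : IsSample P lam mu κ R D σ W u) (θ : Fin 3 → ℝ) {ξ : E3}
    (hξ : ‖ξ‖ < 2 * kappaS mu κ) (k : Fin 3) (l : Fin 2) :
    MemLp (exactFunctional lam mu κ R u θ ξ k l) 2 P :=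
  (h.whiteNoise.memLp_wienerSum (h.sqInt θ hξ k l)).ae_eq (h.isSrcIntegral θ hξ k l).2.symm

lemma IsSample.integral_norm_sq_le (h : IsSample P lam mu κ R D σ W u) (θ : Fin 3 → ℝ) {ξ : E3}
    (hξ : ‖ξ‖ < 2 * kappaS mu κ) (k : Fin 3) (l : Fin 2) :
    ∫ ω, ‖exactFunctional lam mu κ R u θ ξ k l ω‖ ^ 2 ∂P ≤ srcEnergy D σ := by
  refine le_trans (le_of_eq ?_) (energy_srcKernel_le h.isOpen h.sqIntOn
    (f := fun m y => expSol θ (kappaS mu κ) ξ k l y m)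
    (fun m y => norm_expSol_apply_le θ h.kappaS_pos hξ k l y m))
  rw [← h.whiteNoise.integral_norm_sq_wienerSum (h.sqInt θ hξ k l)]
  refine integral_congr_ae ?_
  filter_upwards [(h.isSrcIntegral θ hξ k l).2] with ω hω
  rw [hω]

lemma IsSample.integral_norm_pow_four_le (h : IsSample P lam mu κ R D σ W u) (θ : Fin 3 → ℝ)
    {ξ : E3} (hξ : ‖ξ‖ < 2 * kappaS mu κ) (k : Fin 3) (l : Fin 2) :
    ∫ ω, ‖exactFunctional lam mu κ R u θ ξ k l ω‖ ^ 4 ∂P ≤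
      216 * gaussFourth * srcEnergy D σ ^ 2 := by
  have e : ∫ ω, ‖exactFunctional lam mu κ R u θ ξ k l ω‖ ^ 4 ∂P =
      ∫ ω, ‖wienerSum W (srcKernel D σ (fun m y => expSol θ (kappaS mu κ) ξ k l y m)) ω‖ ^ 4 ∂P := by
    refine integral_congr_ae ?_
    filter_upwards [(h.isSrcIntegral θ hξ k l).2] with ω hω
    rw [hω]
  rw [e]
  refine (h.whiteNoise.integral_norm_pow_four_le (h.sqInt θ hξ k l)).trans ?_
  have h1 := energy_srcKernel_le h.isOpen h.sqIntOn
    (f := fun m y => expSol θ (kappaS mu κ) ξ k l y m)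
    (fun m y => norm_expSol_apply_le θ h.kappaS_pos hξ k l y m)
  have h2 := energy_nonneg (srcKernel D σ (fun m y => expSol θ (kappaS mu κ) ξ k l y m))
  have := gaussFourth_nonneg
  gcongr

/-- The product of the two boundary functionals: the correlation data of one sample. -/
def exactProduct (lam mu κ R : ℝ) (u : E3 → Ω → C3) (θ : Fin 3 → ℝ) (ξ : E3) (k : Fin 3)
    (ω : Ω) : ℂ :=
  exactFunctional lam mu κ R u θ ξ k 0 ω * exactFunctional lam mu κ R u θ ξ k 1 ω

/-- The Itô isometry turns correlations of the boundary data into Fourier coefficients of the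
variance, because `ζ_1 + ζ_2 = ξ`. -/
lemma IsSample.integral_exactProduct (h : IsSample P lam mu κ R D σ W u) (θ : Fin 3 → ℝ) {ξ : E3}
    (hξ : ‖ξ‖ < 2 * kappaS mu κ) (k : Fin 3) :
    ∫ ω, exactProduct lam mu κ R u θ ξ k ω ∂P =
      ∑ j, (coeffMatrix θ (kappaS mu κ) ξ k j : ℂ) * srcFourier D σ (-ξ) j := by
  have e : ∫ ω, exactProduct lam mu κ R u θ ξ k ω ∂P =
      ∫ ω, wienerSum W (srcKernel D σ (fun m y => expSol θ (kappaS mu κ) ξ k 0 y m)) ω *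
        wienerSum W (srcKernel D σ (fun m y => expSol θ (kappaS mu κ) ξ k 1 y m)) ω ∂P := by
    refine integral_congr_ae ?_
    filter_upwards [(h.isSrcIntegral θ hξ k 0).2, (h.isSrcIntegral θ hξ k 1).2] with ω h0 h1
    rw [exactProduct, h0, h1]
  rw [e, h.whiteNoise.integral_wienerSum_mul (h.sqInt θ hξ k 0) (h.sqInt θ hξ k 1)]
  refine Finset.sum_congr rfl fun j _ => ?_
  rw [srcFourier, ← integral_const_mul, ← integral_indicator h.isOpen.measurableSet]
  congr 1; funext y
  by_cases hy : y ∈ D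
  · have hz := zetaVec_add θ (kappaS mu κ) ξ k
    have hpw : planeWave ξ y = planeWave (zetaVec θ (kappaS mu κ) ξ k 0) y *
        planeWave (zetaVec θ (kappaS mu κ) ξ k 1) y := by
      have hin : inner ℝ ξ y = inner ℝ (zetaVec θ (kappaS mu κ) ξ k 0) y +
          inner ℝ (zetaVec θ (kappaS mu κ) ξ k 1) y := by rw [← inner_add_left, hz]
      rw [planeWave, planeWave, planeWave, ← Complex.exp_add, hin, Complex.ofReal_add, mul_add]
    simp only [srcKernel, hy, Set.indicator_of_mem, expSol_apply, neg_neg, coeffMatrix,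
      Matrix.of_apply, hpw]
    push_cast; ring
  · simp [srcKernel, hy]

lemma IsSample.aestronglyMeasurable (h : IsSample P lam mu κ R D σ W u) (θ : Fin 3 → ℝ) {ξ : E3}
    (hξ : ‖ξ‖ < 2 * kappaS mu κ) (k : Fin 3) (l : Fin 2) :
    AEStronglyMeasurable (exactFunctional lam mu κ R u θ ξ k l) P := (h.memLp_two θ hξ k l).1

lemma IsSample.memLp_exactProduct (h : IsSample P lam mu κ R D σ W u) (θ : Fin 3 → ℝ) {ξ : E3}
    (hξ : ‖ξ‖ < 2 * kappaS mu κ) (k : Fin 3) :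
    MemLp (exactProduct lam mu κ R u θ ξ k) 2 P ∧
      ∫ ω, ‖exactProduct lam mu κ R u θ ξ k ω‖ ^ 2 ∂P ≤ 216 * gaussFourth * srcEnergy D σ ^ 2 := by
  have hm : AEStronglyMeasurable (exactProduct lam mu κ R u θ ξ k) P :=
    (h.aestronglyMeasurable θ hξ k 0).mul (h.aestronglyMeasurable θ hξ k 1)
  have hi := ((h.integrable_pow_four θ hξ k 0).add (h.integrable_pow_four θ hξ k 1)).const_mul (1 / 2)
  have hle : ∀ ω, ‖exactProduct lam mu κ R u θ ξ k ω‖ ^ 2 ≤ 1 / 2 *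
      (‖exactFunctional lam mu κ R u θ ξ k 0 ω‖ ^ 4 +
        ‖exactFunctional lam mu κ R u θ ξ k 1 ω‖ ^ 4) := fun ω => by
    rw [exactProduct, norm_mul]
    nlinarith [sq_nonneg (‖exactFunctional lam mu κ R u θ ξ k 0 ω‖ ^ 2 -
      ‖exactFunctional lam mu κ R u θ ξ k 1 ω‖ ^ 2)]
  have hi2 : Integrable (fun ω => ‖exactProduct lam mu κ R u θ ξ k ω‖ ^ 2) P :=
    Integrable.mono' hi (hm.norm.pow 2) (Eventually.of_forall fun ω => by
      rw [Real.norm_of_nonneg (by positivity)]; exact hle ω)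
  refine ⟨(memLp_two_iff_integrable_sq_norm hm).2 hi2, ?_⟩
  refine (integral_mono hi2 hi hle).trans ?_
  have h0 := h.integral_norm_pow_four_le θ hξ k 0
  have h1 := h.integral_norm_pow_four_le θ hξ k 1
  simp only [Pi.add_apply]
  rw [integral_const_mul, integral_add (h.integrable_pow_four θ hξ k 0) (h.integrable_pow_four θ hξ k 1)]
  linarith

/-- Independence of the samples passes to their correlation data. -/
lemma iIndepFun_exactProduct {N : ℕ}
    {W : Fin N → Fin 3 → Lp ℝ 2 (volume : Measure E3) → Ω → ℝ} {u : Fin N → E3 → Ω → C3}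
    (hind : iIndepFun (fun (n : Fin N) (ω : Ω)
        (p : Fin 3 × Lp ℝ 2 (volume : Measure E3)) => W n p.1 p.2 ω) P)
    (h : ∀ n, IsSample P lam mu κ R D σ (W n) (u n)) (θ : Fin 3 → ℝ) {ξ : E3}
    (hξ : ‖ξ‖ < 2 * kappaS mu κ) (k : Fin 3) :
    iIndepFun (fun n => exactProduct lam mu κ R (u n) θ ξ k) P := by
  rcases Nat.eq_zero_or_pos N with rfl | hN
  · have hP := hind.isProbabilityMeasure
    exact iIndepFun.of_subsingleton
  · have hs : ∀ l, SqInt (srcKernel D σ (fun m y => expSol θ (kappaS mu κ) ξ k l y m)) :=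
      fun l => (h ⟨0, hN⟩).sqInt θ hξ k l
    -- the Wiener integral as a measurable functional of the noise, the same for all samples
    set ψ : Fin 2 → (Fin 3 × Lp ℝ 2 (volume : Measure E3) → ℝ) → ℂ := fun l w =>
      ∑ j, ((w (j, reLp (hs l j)) : ℂ) + (w (j, imLp (hs l j)) : ℂ) * Complex.I) with hψ
    have hψm : ∀ l, Measurable (ψ l) := fun l => by
      refine Finset.measurable_sum _ fun j _ => ?_
      exact (Complex.measurable_ofReal.comp (measurable_pi_apply _)).add
        ((Complex.measurable_ofReal.comp (measurable_pi_apply _)).mul_const _)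
    have h1 := hind.comp (fun _ w => ψ 0 w * ψ 1 w) (fun _ => (hψm 0).mul (hψm 1))
    refine h1.congr fun n => ?_
    have e : ∀ l ω, ψ l (fun p => W n p.1 p.2 ω) =
        wienerSum (W n) (srcKernel D σ (fun m y => expSol θ (kappaS mu κ) ξ k l y m)) ω :=
      fun l ω => by simp only [hψ, wienerSum, wienerIntegral_of_memLp _ (hs l _)]
    filter_upwards [((h n).isSrcIntegral θ hξ k 0).2, ((h n).isSrcIntegral θ hξ k 1).2]
      with ω h0 h2
    simp only [Function.comp_apply, e, exactProduct, h0, h2]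

/-- The sampling error of the exact correlation data. -/
lemma integral_norm_sq_sampling_error_le [IsProbabilityMeasure P] {N : ℕ} (hN : 0 < N)
    {W : Fin N → Fin 3 → Lp ℝ 2 (volume : Measure E3) → Ω → ℝ} {u : Fin N → E3 → Ω → C3}
    (hind : iIndepFun (fun (n : Fin N) (ω : Ω)
        (p : Fin 3 × Lp ℝ 2 (volume : Measure E3)) => W n p.1 p.2 ω) P)
    (h : ∀ n, IsSample P lam mu κ R D σ (W n) (u n)) (θ : Fin 3 → ℝ) {ξ : E3}
    (hξ : ‖ξ‖ < 2 * kappaS mu κ) (k : Fin 3) :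
    ∫ ω, ‖(1 / (N : ℂ)) * ∑ n, exactProduct lam mu κ R (u n) θ ξ k ω -
      ∑ j, (coeffMatrix θ (kappaS mu κ) ξ k j : ℂ) * srcFourier D σ (-ξ) j‖ ^ 2 ∂P ≤
      216 * gaussFourth * srcEnergy D σ ^ 2 / N :=
  integral_norm_sq_average_sub_le hN (fun n => ((h n).memLp_exactProduct θ hξ k).1)
    (iIndepFun_exactProduct hind h θ hξ k) (fun n => (h n).integral_exactProduct θ hξ k)
    (fun n => ((h n).memLp_exactProduct θ hξ k).2)

end Moments

/-! ### The effect of data errors -/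

section DataError

open Filter Topology Metric

variable {Ω : Type*} [MeasurableSpace Ω] {P : Measure Ω}
  {W : Fin 3 → Lp ℝ 2 (volume : Measure E3) → Ω → ℝ} {D : Set E3} {σ : Fin 3 → E3 → ℝ}
  {lam mu κ R : ℝ}

/-- Transversality removes the divergence term of the boundary operator. -/
lemma boundaryOp_expSol (lam mu : ℝ) (θ : Fin 3 → ℝ) {κs : ℝ} (hκ : 0 < κs) {ξ : E3}
    (hξ : ‖ξ‖ < 2 * κs) (k : Fin 3) (l : Fin 2) (x : E3) (j : Fin 3) :
    boundaryOp lam mu (expSol θ κs ξ k l) x j =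
      mu * (Complex.I * ((inner ℝ (‖x‖⁻¹ • x) (zetaVec θ κs ξ k l) : ℝ) : ℂ)) *
        expSol θ κs ξ k l x j := by
  rw [boundaryOp_eq_traction lam mu (differentiableAt_expSol _ _ _ _ _ x)]
  simp only [expSol_apply]
  rw [traction_planeWave, inner_eta_zeta θ k l hκ hξ, inner_cyclic _ _ 0]
  simp only [Fin.sum_univ_three, PiLp.smul_apply, smul_eq_mul]
  push_cast
  ring

lemma norm_boundaryOp_expSol_le (lam : ℝ) (hmu : 0 < mu) (θ : Fin 3 → ℝ) {κs : ℝ} (hκ : 0 < κs)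
    {ξ : E3} (hξ : ‖ξ‖ < 2 * κs) (k : Fin 3) (l : Fin 2) (x : E3) (j : Fin 3) :
    ‖boundaryOp lam mu (expSol θ κs ξ k l) x j‖ ≤ mu * κs := by
  rw [boundaryOp_expSol lam mu θ hκ hξ, norm_mul, norm_mul, norm_mul, Complex.norm_I, one_mul,
    Complex.norm_real, Complex.norm_real, Real.norm_of_nonneg hmu.le]
  have h1 : ‖inner ℝ (‖x‖⁻¹ • x) (zetaVec θ κs ξ k l)‖ ≤ κs := by
    refine (norm_inner_le_norm _ _).trans ?_
    rw [norm_zetaVec θ k l hκ hξ]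
    have : ‖‖x‖⁻¹ • x‖ ≤ 1 := by
      rw [norm_smul, norm_inv, norm_norm]
      by_cases hx : ‖x‖ = 0
      · simp [hx]
      · rw [inv_mul_cancel₀ hx]
    nlinarith
  calc mu * ‖inner ℝ (‖x‖⁻¹ • x) (zetaVec θ κs ξ k l)‖ * ‖expSol θ κs ξ k l x j‖
      ≤ mu * κs * 1 := by
        gcongr
        exact norm_expSol_apply_le θ hκ hξ k l x j
    _ = mu * κs := mul_one _

/-- The boundary functional is bounded with respect to the `L¹` norms of the data. -/
lemma norm_boundaryFunctional_sub_le (hR : 0 < R) (hmu : 0 < mu) (θ : Fin 3 → ℝ)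
    (hκ : 0 < kappaS mu κ) {ξ : E3} (hξ : ‖ξ‖ < 2 * kappaS mu κ) (k : Fin 3) (l : Fin 2)
    {v t v' t' : E3 → C3} {ε : ℝ} (hε : 0 ≤ ε)
    (hv : Integrable v (surfaceMeasure R)) (ht : Integrable t (surfaceMeasure R))
    (hv' : AEStronglyMeasurable v' (surfaceMeasure R))
    (ht' : AEStronglyMeasurable t' (surfaceMeasure R))
    (hvε : eLpNorm (fun x => v' x - v x) 1 (surfaceMeasure R) ≤ ENNReal.ofReal ε)
    (htε : eLpNorm (fun x => t' x - t x) 1 (surfaceMeasure R) ≤ ENNReal.ofReal ε) :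
    ‖boundaryFunctional lam mu κ R θ ξ k l v' t' - boundaryFunctional lam mu κ R θ ξ k l v t‖ ≤
      3 * (1 + mu * kappaS mu κ) * ε := by
  have hUc : Continuous (expSol θ (kappaS mu κ) ξ k l) := (contDiff_expSol _ _ _ _ _).continuous
  have hUj : ∀ j, Continuous fun x => expSol θ (kappaS mu κ) ξ k l x j := fun j =>
    (EuclideanSpace.proj j : C3 →L[ℂ] ℂ).continuous.comp hUc
  have hBm : ∀ j, AEStronglyMeasurable (fun x =>
      boundaryOp lam mu (expSol θ (kappaS mu κ) ξ k l) x j) (surfaceMeasure R) := fun j => by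
    simp only [boundaryOp_expSol lam mu θ hκ hξ]
    refine (ContinuousOn.integrable_surface hR fun x hx => ?_).1
    have hx0 : ‖x‖ ≠ 0 := by rw [mem_sphere_zero_iff_norm.1 hx]; exact hR.ne'
    have h1 : ContinuousAt (fun x : E3 => inner ℝ (‖x‖⁻¹ • x) (zetaVec θ (kappaS mu κ) ξ k l)) x :=
      ((continuousAt_id.norm.inv₀ hx0).smul continuousAt_id).inner continuousAt_const
    exact ((continuousAt_const.mul (continuousAt_const.mul
      (Complex.continuous_ofReal.continuousAt.comp h1))).mul (hUj j).continuousAt).continuousWithinAt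
  -- the exponential solution and its boundary derivative are bounded on the sphere
  have hΦ : ∀ {v t : E3 → C3}, Integrable v (surfaceMeasure R) → Integrable t (surfaceMeasure R) →
      Integrable (fun x => (∑ j, t x j * expSol θ (kappaS mu κ) ξ k l x j) -
        ∑ j, boundaryOp lam mu (expSol θ (kappaS mu κ) ξ k l) x j * v x j) (surfaceMeasure R) := by
    intro v t hv ht
    have hvj : ∀ j, Integrable (fun x => v x j) (surfaceMeasure R) := fun j =>
      (EuclideanSpace.proj j : C3 →L[ℂ] ℂ).integrable_comp hv
    have htj : ∀ j, Integrable (fun x => t x j) (surfaceMeasure R) := fun j =>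
      (EuclideanSpace.proj j : C3 →L[ℂ] ℂ).integrable_comp ht
    refine integrable_fun_sub (integrable_finsetSum _ fun j _ => ?_)
      (integrable_finsetSum _ fun j _ => ?_)
    · exact (htj j).mul_bdd (hUj j).aestronglyMeasurable
        (Eventually.of_forall fun x => norm_expSol_apply_le θ hκ hξ k l x j)
    · exact (hvj j).bdd_mul (hBm j)
        (Eventually.of_forall fun x => norm_boundaryOp_expSol_le lam hmu θ hκ hξ k l x j)
  have hdv : Integrable (fun x => v' x - v x) (surfaceMeasure R) :=
    memLp_one_iff_integrable.1 ⟨hv'.sub hv.1, hvε.trans_lt ENNReal.ofReal_lt_top⟩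
  have hdt : Integrable (fun x => t' x - t x) (surfaceMeasure R) :=
    memLp_one_iff_integrable.1 ⟨ht'.sub ht.1, htε.trans_lt ENNReal.ofReal_lt_top⟩
  have hv'i : Integrable v' (surfaceMeasure R) := by
    refine (hdv.add hv).congr (Eventually.of_forall fun x => ?_)
    simp
  have ht'i : Integrable t' (surfaceMeasure R) := by
    refine (hdt.add ht).congr (Eventually.of_forall fun x => ?_)
    simp
  have hn : ∀ {f : E3 → C3}, Integrable f (surfaceMeasure R) →
      eLpNorm f 1 (surfaceMeasure R) ≤ ENNReal.ofReal ε → ∫ x, ‖f x‖ ∂(surfaceMeasure R) ≤ ε := by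
    intro f hf h
    rw [eLpNorm_one_eq_lintegral_enorm, ← ofReal_integral_norm_eq_lintegral_enorm hf] at h
    exact (ENNReal.ofReal_le_ofReal_iff hε).1 h
  rw [boundaryFunctional, boundaryFunctional, ← integral_sub (hΦ hv'i ht'i) (hΦ hv ht)]
  have hc : (0 : ℝ) ≤ mu * kappaS mu κ := by positivity
  calc _ ≤ ∫ x, (3 * ‖t' x - t x‖ + 3 * (mu * kappaS mu κ) * ‖v' x - v x‖) ∂(surfaceMeasure R) := by
        refine norm_integral_le_of_norm_le ((hdt.norm.const_mul _).add (hdv.norm.const_mul _))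
          (Eventually.of_forall fun x => ?_)
        have e : ((∑ j, t' x j * expSol θ (kappaS mu κ) ξ k l x j) -
            ∑ j, boundaryOp lam mu (expSol θ (kappaS mu κ) ξ k l) x j * v' x j) -
            ((∑ j, t x j * expSol θ (kappaS mu κ) ξ k l x j) -
            ∑ j, boundaryOp lam mu (expSol θ (kappaS mu κ) ξ k l) x j * v x j) =
            (∑ j, (t' x - t x) j * expSol θ (kappaS mu κ) ξ k l x j) -
            ∑ j, boundaryOp lam mu (expSol θ (kappaS mu κ) ξ k l) x j * (v' x - v x) j := by
          simp only [PiLp.sub_apply, sub_mul, mul_sub, Finset.sum_sub_distrib]; ring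
        rw [e]
        refine (norm_sub_le _ _).trans (add_le_add ?_ ?_)
        · refine (norm_sum_le _ _).trans ?_
          calc ∑ j, ‖(t' x - t x) j * expSol θ (kappaS mu κ) ξ k l x j‖
              ≤ ∑ _j : Fin 3, ‖t' x - t x‖ := by
                refine Finset.sum_le_sum fun j _ => ?_
                rw [norm_mul]
                calc _ ≤ ‖t' x - t x‖ * 1 := by
                      gcongr
                      · exact PiLp.norm_apply_le _ j
                      · exact norm_expSol_apply_le θ hκ hξ k l x j
                  _ = _ := mul_one _
            _ = 3 * ‖t' x - t x‖ := by simp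
        · refine (norm_sum_le _ _).trans ?_
          calc ∑ j, ‖boundaryOp lam mu (expSol θ (kappaS mu κ) ξ k l) x j * (v' x - v x) j‖
              ≤ ∑ _j : Fin 3, (mu * kappaS mu κ) * ‖v' x - v x‖ := by
                refine Finset.sum_le_sum fun j _ => ?_
                rw [norm_mul]
                gcongr
                · exact norm_boundaryOp_expSol_le lam hmu θ hκ hξ k l x j
                · exact PiLp.norm_apply_le _ j
            _ = 3 * (mu * kappaS mu κ) * ‖v' x - v x‖ := by simp; ring
    _ = 3 * ∫ x, ‖t' x - t x‖ ∂(surfaceMeasure R) +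
        3 * (mu * kappaS mu κ) * ∫ x, ‖v' x - v x‖ ∂(surfaceMeasure R) := by
        rw [integral_add (hdt.norm.const_mul _) (hdv.norm.const_mul _), integral_const_mul,
          integral_const_mul]
    _ ≤ 3 * ε + 3 * (mu * kappaS mu κ) * ε := by
        gcongr
        · exact hn hdt htε
        · exact hn hdv hvε
    _ = 3 * (1 + mu * kappaS mu κ) * ε := by ring

/-- The hypotheses on the noisy data of one sample. -/
structure IsNoisyData (P : Measure Ω) (lam mu R ε : ℝ) (u uδ tδ : E3 → Ω → C3) : Prop where
  meas_u : AEStronglyMeasurable (Function.uncurry uδ) ((surfaceMeasure R).prod P)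
  meas_t : AEStronglyMeasurable (Function.uncurry tδ) ((surfaceMeasure R).prod P)
  err_u : ∀ᵐ ω ∂P, eLpNorm (fun x => uδ x ω - u x ω) 1 (surfaceMeasure R) ≤ ENNReal.ofReal ε
  err_t : ∀ᵐ ω ∂P, eLpNorm (fun x => tδ x ω - boundaryOp lam mu (fun y => u y ω) x) 1
    (surfaceMeasure R) ≤ ENNReal.ofReal ε

/-- The boundary functional of noisy data. -/
def noisyFunctional (lam mu κ R : ℝ) (uδ tδ : E3 → Ω → C3) (θ : Fin 3 → ℝ) (ξ : E3) (k : Fin 3)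
    (l : Fin 2) (ω : Ω) : ℂ :=
  boundaryFunctional lam mu κ R θ ξ k l (fun y => uδ y ω) (fun y => tδ y ω)

lemma IsNoisyData.ae_norm_sub_le [SFinite P] {u uδ tδ : E3 → Ω → C3} {ε : ℝ}
    (hd : IsNoisyData P lam mu R ε u uδ tδ) (hε : 0 ≤ ε) (h : IsSample P lam mu κ R D σ W u) :
    ∀ᵐ ω ∂P, ∀ (θ : Fin 3 → ℝ) (ξ : E3), ‖ξ‖ < 2 * kappaS mu κ → ∀ (k : Fin 3) (l : Fin 2),
      ‖noisyFunctional lam mu κ R uδ tδ θ ξ k l ω - exactFunctional lam mu κ R u θ ξ k l ω‖ ≤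
        3 * (1 + mu * kappaS mu κ) * ε := by
  filter_upwards [hd.err_u, hd.err_t, hd.meas_u.prod_swap.prodMk_left,
    hd.meas_t.prod_swap.prodMk_left, h.mild.ae_contDiffAt] with ω h1 h2 h3 h4 h5 θ ξ hξ k l
  have hcD := fun x hx => not_mem_closure_of_mem_sphere h.closure_subset (x := x) hx
  refine norm_boundaryFunctional_sub_le h.radius_pos h.mu_pos θ h.kappaS_pos hξ k l hε ?_ ?_ h3 h4
    h1 h2
  · exact ContinuousOn.integrable_surface h.radius_pos fun x hx =>
      (h5 x (hcD x hx)).continuousAt.continuousWithinAt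
  · refine ContinuousOn.integrable_surface h.radius_pos fun x hx =>
      (continuousAt_boundaryOp lam mu ?_ (h5 x (hcD x hx))).continuousWithinAt
    rintro rfl
    rw [mem_sphere_zero_iff_norm, norm_zero] at hx
    exact h.radius_pos.ne hx

/-- The mean square of an average of perturbed terms. -/
lemma norm_average_le {N : ℕ} (a b : Fin N → ℂ) (c : ℂ) {G : Fin N → ℝ}
    (hN : 0 < N) (hab : ∀ n, ‖a n - b n‖ ≤ G n) :
    ‖(1 / (N : ℂ)) * ∑ n, a n - c‖ ^ 2 ≤
      2 * ‖(1 / (N : ℂ)) * ∑ n, b n - c‖ ^ 2 + 2 * ((1 / (N : ℝ)) * ∑ n, G n ^ 2) := by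
  have hN' : (0 : ℝ) < N := by positivity
  have e : (1 / (N : ℂ)) * ∑ n, a n - c =
      ((1 / (N : ℂ)) * ∑ n, b n - c) + (1 / (N : ℂ)) * ∑ n, (a n - b n) := by
    rw [Finset.sum_sub_distrib]; ring
  have h1 : ‖(1 / (N : ℂ)) * ∑ n, (a n - b n)‖ ^ 2 ≤ (1 / (N : ℝ)) * ∑ n, G n ^ 2 := by
    have h2 : ‖∑ n, (a n - b n)‖ ≤ ∑ n, G n :=
      (norm_sum_le _ _).trans (Finset.sum_le_sum fun n _ => hab n)
    have h3 : (∑ n, G n) ^ 2 ≤ N * ∑ n, G n ^ 2 := by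
      simpa using sq_sum_le_card_mul_sum_sq (s := (Finset.univ : Finset (Fin N))) (f := G)
    rw [norm_mul, norm_div, norm_one, Complex.norm_natCast, mul_pow]
    calc (1 / (N : ℝ)) ^ 2 * ‖∑ n, (a n - b n)‖ ^ 2
        ≤ (1 / (N : ℝ)) ^ 2 * (N * ∑ n, G n ^ 2) := by
          gcongr
          exact (pow_le_pow_left₀ (norm_nonneg _) h2 2).trans h3
      _ = (1 / (N : ℝ)) * ∑ n, G n ^ 2 := by field_simp
  rw [e]
  have h4 := norm_add_le ((1 / (N : ℂ)) * ∑ n, b n - c) ((1 / (N : ℂ)) * ∑ n, (a n - b n))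
  nlinarith [sq_nonneg (‖(1 / (N : ℂ)) * ∑ n, b n - c‖ - ‖(1 / (N : ℂ)) * ∑ n, (a n - b n)‖),
    norm_nonneg ((1 / (N : ℂ)) * ∑ n, b n - c + (1 / (N : ℂ)) * ∑ n, (a n - b n))]

/-- The mean square error of the correlation data: a sampling error and a data error. -/
lemma lintegral_correlationData_sub_le [IsProbabilityMeasure P] {N : ℕ} (hN : 0 < N)
    {W : Fin N → Fin 3 → Lp ℝ 2 (volume : Measure E3) → Ω → ℝ} {u uδ tδ : Fin N → E3 → Ω → C3}
    (hind : iIndepFun (fun (n : Fin N) (ω : Ω)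
        (p : Fin 3 × Lp ℝ 2 (volume : Measure E3)) => W n p.1 p.2 ω) P)
    (h : ∀ n, IsSample P lam mu κ R D σ (W n) (u n)) {ε ε₀ : ℝ} (hε : 0 ≤ ε) (hε₀ : ε ≤ ε₀)
    (hd : ∀ n, IsNoisyData P lam mu R ε (u n) (uδ n) (tδ n)) (θ : Fin 3 → ℝ) {ξ : E3}
    (hξ : ‖ξ‖ < 2 * kappaS mu κ) (k : Fin 3) :
    ∫⁻ ω, ‖correlationData lam mu κ R θ (fun n y => uδ n y ω) (fun n y => tδ n y ω) ξ k -
      ∑ j, (coeffMatrix θ (kappaS mu κ) ξ k j : ℂ) * srcFourier D σ (-ξ) j‖ₑ ^ 2 ∂P ≤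
      ENNReal.ofReal (432 * gaussFourth * srcEnergy D σ ^ 2 / N +
        (12 * (3 * (1 + mu * kappaS mu κ)) ^ 2 * srcEnergy D σ +
          6 * (3 * (1 + mu * kappaS mu κ)) ^ 4 * ε₀ ^ 2) * ε ^ 2) := by
  set c := 3 * (1 + mu * kappaS mu κ) with hc
  set m := ∑ j, (coeffMatrix θ (kappaS mu κ) ξ k j : ℂ) * srcFourier D σ (-ξ) j with hm
  set X : Fin N → Fin 2 → Ω → ℂ := fun n l => exactFunctional lam mu κ R (u n) θ ξ k l with hX
  have hN' : (0 : ℝ) < N := by positivity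
  have hX2 : ∀ n l, Integrable (fun ω => ‖X n l ω‖ ^ 2) P := fun n l =>
    ((h n).memLp_two θ hξ k l).integrable_norm_pow two_ne_zero
  have hA2 : Integrable (fun ω => ‖(1 / (N : ℂ)) * ∑ n, exactProduct lam mu κ R (u n) θ ξ k ω - m‖ ^ 2)
      P := by
    have hml : MemLp (fun ω => (1 / (N : ℂ)) * ∑ n, exactProduct lam mu κ R (u n) θ ξ k ω - m) 2 P :=
      ((memLp_finsetSum _ fun n _ => ((h n).memLp_exactProduct θ hξ k).1).const_mul _).sub
        (memLp_const _)
    exact hml.integrable_norm_pow two_ne_zero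
  -- an integrable majorant: the sampling error, and the perturbation of the products
  set G : Ω → ℝ := fun ω => 2 * ‖(1 / (N : ℂ)) * ∑ n, exactProduct lam mu κ R (u n) θ ξ k ω - m‖ ^ 2 +
    2 * ((1 / (N : ℝ)) * ∑ n, (3 * (ε * c) ^ 2 * (‖X n 0 ω‖ ^ 2 + ‖X n 1 ω‖ ^ 2) +
      3 * (ε * c) ^ 4)) with hG
  have hXX : ∀ n, Integrable (fun ω => 3 * (ε * c) ^ 2 * (‖X n 0 ω‖ ^ 2 + ‖X n 1 ω‖ ^ 2)) P :=
    fun n => ((hX2 n 0).add (hX2 n 1)).const_mul _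
  have hGn : ∀ n, Integrable (fun ω => 3 * (ε * c) ^ 2 * (‖X n 0 ω‖ ^ 2 + ‖X n 1 ω‖ ^ 2) +
      3 * (ε * c) ^ 4) P := fun n =>
    (hXX n).add (integrable_const _)
  have hGi : Integrable G P :=
    (hA2.const_mul 2).add (((integrable_finsetSum _ fun n _ => hGn n).const_mul _).const_mul 2)
  have hG0 : ∀ ω, 0 ≤ G ω := fun ω => by positivity
  have hdom : ∀ᵐ ω ∂P, ‖correlationData lam mu κ R θ (fun n y => uδ n y ω) (fun n y => tδ n y ω) ξ k -
      m‖ ^ 2 ≤ G ω := by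
    filter_upwards [ae_all_iff.2 fun n => (hd n).ae_norm_sub_le hε (h n)] with ω hω
    have hGb : ∀ n, ‖noisyFunctional lam mu κ R (uδ n) (tδ n) θ ξ k 0 ω *
        noisyFunctional lam mu κ R (uδ n) (tδ n) θ ξ k 1 ω -
        exactProduct lam mu κ R (u n) θ ξ k ω‖ ≤
        ε * c * (‖X n 0 ω‖ + ‖X n 1 ω‖) + (ε * c) ^ 2 := fun n => by
      set d0 := noisyFunctional lam mu κ R (uδ n) (tδ n) θ ξ k 0 ω - X n 0 ω with hd0
      set d1 := noisyFunctional lam mu κ R (uδ n) (tδ n) θ ξ k 1 ω - X n 1 ω with hd1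
      have h0 : ‖d0‖ ≤ ε * c := by
        have := hω n θ ξ hξ k 0
        rwa [← hc, mul_comm] at this
      have h1 : ‖d1‖ ≤ ε * c := by
        have := hω n θ ξ hξ k 1
        rwa [← hc, mul_comm] at this
      have e : noisyFunctional lam mu κ R (uδ n) (tδ n) θ ξ k 0 ω *
          noisyFunctional lam mu κ R (uδ n) (tδ n) θ ξ k 1 ω -
          exactProduct lam mu κ R (u n) θ ξ k ω = d0 * X n 1 ω + X n 0 ω * d1 + d0 * d1 := by
        simp only [hd0, hd1, hX, exactProduct]; ring
      rw [e]
      refine (norm_add₃_le).trans ?_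
      rw [norm_mul, norm_mul, norm_mul]
      have := norm_nonneg d0
      have hεc : 0 ≤ ε * c := this.trans h0
      calc ‖d0‖ * ‖X n 1 ω‖ + ‖X n 0 ω‖ * ‖d1‖ + ‖d0‖ * ‖d1‖
          ≤ (ε * c) * ‖X n 1 ω‖ + ‖X n 0 ω‖ * (ε * c) + (ε * c) * (ε * c) := by gcongr
        _ = _ := by ring
    refine (norm_average_le _ _ m hN hGb).trans ?_
    simp only [hG]
    gcongr with n
    nlinarith [sq_nonneg (ε * c * (‖X n 0 ω‖ - ‖X n 1 ω‖)), sq_nonneg (ε * c * ‖X n 0 ω‖ - (ε * c) ^ 2),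
      sq_nonneg (ε * c * ‖X n 1 ω‖ - (ε * c) ^ 2)]
  calc _ ≤ ∫⁻ ω, ENNReal.ofReal (G ω) ∂P := by
        refine lintegral_mono_ae ?_
        filter_upwards [hdom] with ω hω
        rw [← ofReal_norm, ← ENNReal.ofReal_pow (norm_nonneg _)]
        exact ENNReal.ofReal_le_ofReal hω
    _ = ENNReal.ofReal (∫ ω, G ω ∂P) :=
        (ofReal_integral_eq_lintegral_ofReal hGi (Eventually.of_forall hG0)).symm
    _ ≤ _ := by
        refine ENNReal.ofReal_le_ofReal ?_
        simp only [hG]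
        rw [integral_add (hA2.const_mul 2)
          (((integrable_finsetSum _ fun n _ => hGn n).const_mul _).const_mul 2),
          integral_const_mul, integral_const_mul, integral_const_mul,
          integral_finsetSum _ fun n _ => hGn n]
        have hs := integral_norm_sq_sampling_error_le hN hind h θ hξ k
        have hn : ∀ n, ∫ ω, (3 * (ε * c) ^ 2 * (‖X n 0 ω‖ ^ 2 + ‖X n 1 ω‖ ^ 2) +
            3 * (ε * c) ^ 4) ∂P ≤ 6 * (ε * c) ^ 2 * srcEnergy D σ + 3 * (ε * c) ^ 4 := fun n => by
          rw [integral_add (hXX n) (integrable_const _), integral_const_mul,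
            integral_add (hX2 n 0) (hX2 n 1)]
          have h0 := (h n).integral_norm_sq_le θ hξ k 0
          have h1 := (h n).integral_norm_sq_le θ hξ k 1
          have h2 : 0 ≤ 3 * (ε * c) ^ 2 := by positivity
          simp only [integral_const, probReal_univ, one_smul]
          nlinarith [mul_le_mul_of_nonneg_left (add_le_add h0 h1) h2]
        have hsum : (1 / (N : ℝ)) * ∑ n, ∫ ω, (3 * (ε * c) ^ 2 * (‖X n 0 ω‖ ^ 2 + ‖X n 1 ω‖ ^ 2) +
            3 * (ε * c) ^ 4) ∂P ≤ 6 * (ε * c) ^ 2 * srcEnergy D σ + 3 * (ε * c) ^ 4 := by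
          calc _ ≤ (1 / (N : ℝ)) * ∑ n : Fin N, (6 * (ε * c) ^ 2 * srcEnergy D σ + 3 * (ε * c) ^ 4) := by
                gcongr with n; exact hn n
            _ = _ := by
                simp only [Finset.sum_const, Finset.card_univ, Fintype.card_fin, nsmul_eq_mul]
                field_simp
        have h4 : (ε * c) ^ 4 ≤ c ^ 4 * ε₀ ^ 2 * ε ^ 2 := by
          have : ε ^ 2 ≤ ε₀ ^ 2 := by gcongr
          have h5 : (ε * c) ^ 4 = c ^ 4 * ε ^ 2 * ε ^ 2 := by ring
          rw [h5]; gcongr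
        have h6 : 2 * (216 * gaussFourth * srcEnergy D σ ^ 2 / N) =
          432 * gaussFourth * srcEnergy D σ ^ 2 / N := by ring
        rw [← h6]
        nlinarith [hs, hsum, h4]

/-- Stability of the linear system for the Fourier coefficients at one frequency. -/
lemma norm_fourierRec_sub_le {N : ℕ} (hmu : 0 < mu) (hκ : 0 < κ) (θ : Fin 3 → ℝ) {β : ℝ}
    (hβ : β ∈ Set.Ioo (0 : ℝ) 2) {ξ : E3} (hξ0 : ξ ≠ 0) (hξ : ‖ξ‖ ≤ β * kappaS mu κ)
    (v t : Fin N → E3 → C3) :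
    ‖(WithLp.toLp 2 (fourierRec lam mu κ R θ v t ξ - srcFourier D σ ξ) : C3)‖ ^ 2 ≤
      sSup (amplification β) ^ 2 * ∑ k, ‖correlationData lam mu κ R θ v t (-ξ) k -
        ∑ j, (coeffMatrix θ (kappaS mu κ) (-ξ) k j : ℂ) * srcFourier D σ ξ j‖ ^ 2 := by
  have hκs : 0 < kappaS mu κ := div_pos hκ (Real.sqrt_pos.2 hmu)
  set A := coeffMatrix θ (kappaS mu κ) (-ξ) with hA
  have hlt : ‖-ξ‖ < 2 * kappaS mu κ := by
    rw [norm_neg]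
    exact hξ.trans_lt (by gcongr; exact hβ.2)
  have hu : IsUnit A := isUnit_coeffMatrix θ hκs hlt
  have hC := specNorm_inv_le_sSup θ hκs hβ (neg_ne_zero.2 hξ0) (by rwa [norm_neg])
  have hdet : IsUnit (A.map (fun a : ℝ => (a : ℂ))).det := by
    have h1 : (A.map (fun a : ℝ => (a : ℂ))).det = ((A.det : ℝ) : ℂ) :=
      (RingHom.map_det Complex.ofRealHom A).symm
    rw [h1, isUnit_iff_ne_zero]
    exact_mod_cast ((Matrix.isUnit_iff_isUnit_det A).1 hu).ne_zero
  have e : fourierRec lam mu κ R θ v t ξ - srcFourier D σ ξ =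
      (A⁻¹).map (fun a : ℝ => (a : ℂ)) *ᵥ (correlationData lam mu κ R θ v t (-ξ) -
        A.map (fun a : ℝ => (a : ℂ)) *ᵥ srcFourier D σ ξ) := by
    rw [← map_inv_coeffMatrix hu, Matrix.mulVec_sub, Matrix.mulVec_mulVec,
      Matrix.nonsing_inv_mul _ hdet, Matrix.one_mulVec, fourierRec]
  rw [e]
  have h1 := norm_map_mulVec_le (A⁻¹) (correlationData lam mu κ R θ v t (-ξ) -
        A.map (fun a : ℝ => (a : ℂ)) *ᵥ srcFourier D σ ξ)
  have h2 : ‖(WithLp.toLp 2 (correlationData lam mu κ R θ v t (-ξ) -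
      A.map (fun a : ℝ => (a : ℂ)) *ᵥ srcFourier D σ ξ) : C3)‖ ^ 2 =
      ∑ k, ‖correlationData lam mu κ R θ v t (-ξ) k -
        ∑ j, (A k j : ℂ) * srcFourier D σ ξ j‖ ^ 2 := by
    rw [EuclideanSpace.norm_sq_eq]
    rfl
  rw [← h2, ← mul_pow]
  refine pow_le_pow_left₀ (norm_nonneg _) (h1.trans ?_) 2
  gcongr

end DataError

/-! ### The Plancherel theorem for integrable functions -/

section Plancherel

open FourierTransform SchwartzMap
open scoped InnerProductSpace ContDiff

variable {F : Type*} [NormedAddCommGroup F] [InnerProductSpace ℂ F]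

lemma continuous_fourier_of_integrable {f : E3 → F} (hf : Integrable f) :
    Continuous (𝓕 f : E3 → F) :=
  VectorFourier.fourierIntegral_continuous Real.continuous_fourierChar
    (by exact continuous_inner) hf

lemma continuous_fourierInv_of_integrable {f : E3 → F} (hf : Integrable f) :
    Continuous (𝓕⁻ f : E3 → F) := by
  have e : (𝓕⁻ f : E3 → F) = fun x => 𝓕 f (-x) := by
    funext x; exact Real.fourierInv_eq_fourier_neg f x
  rw [e]
  exact (continuous_fourier_of_integrable hf).comp continuous_neg

variable [CompleteSpace F]

lemma integral_fourier_smul_eq_flip {f : E3 → F} (hf : Integrable f) (g : 𝓢(E3, ℂ)) :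
    ∫ x, (𝓕 g) x • f x = ∫ x, g x • 𝓕 f x := by
  simpa using! (VectorFourier.integral_fourierIntegral_smul_eq_flip (L := innerₗ E3)
      Real.continuous_fourierChar continuous_inner g.integrable hf)

lemma integral_fourierInv_smul_eq_flip {f : E3 → F} (hf : Integrable f) (g : 𝓢(E3, ℂ)) :
    ∫ x, (𝓕⁻ g) x • f x = ∫ x, g x • 𝓕⁻ f x := by
  have h := integral_fourier_smul_eq_flip hf.comp_neg g
  rw [Real.fourierInv_eq_fourier_comp_neg f, ← h, SchwartzMap.fourierInv_coe]
  rw [← integral_neg_eq_self]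
  congr 1; funext x
  rw [Real.fourierInv_eq_fourier_neg, neg_neg, SchwartzMap.fourier_coe]

lemma ae_eq_of_integral_schwartz_eq {f g : E3 → F} (hf : LocallyIntegrable f)
    (hg : LocallyIntegrable g) (h : ∀ φ : 𝓢(E3, ℂ), ∫ x, φ x • f x = ∫ x, φ x • g x) :
    f =ᵐ[volume] g := by
  refine ae_eq_of_integral_contDiff_smul_eq hf hg fun φ hφ hφc => ?_
  have hc : HasCompactSupport (fun x => (φ x : ℂ)) := hφc.comp_left (g := fun a : ℝ => (a : ℂ)) (by simp)
  have := h (hc.toSchwartzMap (Complex.ofRealCLM.contDiff.comp hφ))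
  have e : ∀ f : E3 → F, ∫ x, (hc.toSchwartzMap (Complex.ofRealCLM.contDiff.comp hφ)) x • f x =
      ∫ x, φ x • f x := fun f => by
    congr 1
  rwa [e, e] at this

/-- On `L¹ ∩ L²` the `L²` Fourier transform is given by the integral. -/
lemma coeFn_fourier_toLp {f : E3 → F} (h1 : Integrable f) (h2 : MemLp f 2 (volume : Measure E3)) :
    ((𝓕 (h2.toLp f) : Lp F 2 (volume : Measure E3)) : E3 → F) =ᵐ[volume] 𝓕 f := by
  refine ae_eq_of_integral_schwartz_eq ((Lp.memLp _).locallyIntegrable one_le_two)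
    (continuous_fourier_of_integrable h1).locallyIntegrable fun φ => ?_
  have e := congrArg (fun T => T φ) (Lp.fourier_toTemperedDistribution_eq (h2.toLp f))
  simp only [TemperedDistribution.fourier_apply, Lp.toTemperedDistribution_apply] at e
  rw [← e, ← integral_fourier_smul_eq_flip h1]
  refine integral_congr_ae ?_
  filter_upwards [h2.coeFn_toLp] with x hx
  rw [hx]

lemma coeFn_fourierInv_toLp {f : E3 → F} (h1 : Integrable f)
    (h2 : MemLp f 2 (volume : Measure E3)) :
    ((𝓕⁻ (h2.toLp f) : Lp F 2 (volume : Measure E3)) : E3 → F) =ᵐ[volume] 𝓕⁻ f := by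
  refine ae_eq_of_integral_schwartz_eq ((Lp.memLp _).locallyIntegrable one_le_two)
    (continuous_fourierInv_of_integrable h1).locallyIntegrable fun φ => ?_
  have e := congrArg (fun T => T φ) (Lp.fourierInv_toTemperedDistribution_eq (h2.toLp f))
  simp only [TemperedDistribution.fourierInv_apply, Lp.toTemperedDistribution_apply] at e
  rw [← e, ← integral_fourierInv_smul_eq_flip h1]
  refine integral_congr_ae ?_
  filter_upwards [h2.coeFn_toLp] with x hx
  rw [hx]

lemma eLpNorm_fourier {f : E3 → F} (h1 : Integrable f) (h2 : MemLp f 2 (volume : Measure E3)) :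
    eLpNorm (𝓕 f) 2 (volume : Measure E3) = eLpNorm f 2 (volume : Measure E3) := by
  rw [← eLpNorm_congr_ae (coeFn_fourier_toLp h1 h2), ← Lp.enorm_def, ← eLpNorm_congr_ae h2.coeFn_toLp,
    ← Lp.enorm_def, ← ofReal_norm, Lp.norm_fourier_eq, ofReal_norm]

/-- Plancherel's theorem for the distance of `f` to the inverse transform of `G`. -/
lemma eLpNorm_fourierInv_sub {f G : E3 → F} (hf1 : Integrable f)
    (hf2 : MemLp f 2 (volume : Measure E3)) (hG1 : Integrable G)
    (hG2 : MemLp G 2 (volume : Measure E3)) :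
    eLpNorm (fun x => 𝓕⁻ G x - f x) 2 (volume : Measure E3) =
      eLpNorm (fun w => G w - 𝓕 f w) 2 (volume : Measure E3) := by
  have e1 : ((𝓕⁻ (hG2.toLp G) - hf2.toLp f : Lp F 2 (volume : Measure E3)) : E3 → F) =ᵐ[volume]
      fun x => 𝓕⁻ G x - f x := by
    filter_upwards [Lp.coeFn_sub (𝓕⁻ (hG2.toLp G)) (hf2.toLp f), coeFn_fourierInv_toLp hG1 hG2,
      hf2.coeFn_toLp] with x h1 h2 h3
    rw [h1, Pi.sub_apply, h2, h3]
  have e2 : ((hG2.toLp G - 𝓕 (hf2.toLp f) : Lp F 2 (volume : Measure E3)) : E3 → F) =ᵐ[volume]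
      fun w => G w - 𝓕 f w := by
    filter_upwards [Lp.coeFn_sub (hG2.toLp G) (𝓕 (hf2.toLp f)), coeFn_fourier_toLp hf1 hf2,
      hG2.coeFn_toLp] with x h1 h2 h3
    rw [h1, Pi.sub_apply, h2, h3]
  rw [← eLpNorm_congr_ae e1, ← eLpNorm_congr_ae e2, ← Lp.enorm_def, ← Lp.enorm_def, ← ofReal_norm,
    ← ofReal_norm, ← Lp.norm_fourier_eq]
  congr 2
  have h := map_sub (Lp.fourierTransformₗᵢ E3 F) (𝓕⁻ (hG2.toLp G)) (hf2.toLp f)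
  refine h.trans ?_
  congr 1
  exact (Lp.fourierTransformₗᵢ E3 F).apply_symm_apply (hG2.toLp G)

end Plancherel

/-! ### Truncated Fourier inversion and the Sobolev tail -/

section Tail

open FourierTransform Set Metric Filter Topology
open scoped ENNReal

lemma eLpNorm_two_eq {α F : Type*} [MeasurableSpace α] [NormedAddCommGroup F] (f : α → F)
    (μ : Measure α) : eLpNorm f 2 μ = (∫⁻ x, ‖f x‖ₑ ^ 2 ∂μ) ^ (1 / 2 : ℝ) := by
  rw [eLpNorm_eq_lintegral_rpow_enorm_toReal two_ne_zero ENNReal.ofNat_ne_top]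
  simp

lemma eLpNorm_two_le {α F : Type*} [MeasurableSpace α] [NormedAddCommGroup F] {f : α → F}
    {μ : Measure α} {B : ℝ} (hB : 0 ≤ B) (h : ∫⁻ x, ‖f x‖ₑ ^ 2 ∂μ ≤ ENNReal.ofReal (B ^ 2)) :
    eLpNorm f 2 μ ≤ ENNReal.ofReal B := by
  rw [eLpNorm_two_eq]
  calc _ ≤ (ENNReal.ofReal (B ^ 2)) ^ (1 / 2 : ℝ) := by gcongr
    _ = ENNReal.ofReal B := by
      rw [ENNReal.ofReal_rpow_of_nonneg (by positivity) (by norm_num), ← Real.sqrt_eq_rpow,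
        Real.sqrt_sq hB]

lemma fourier_apply_component {f : E3 → C3} (hf : Integrable f) (w : E3) (j : Fin 3) :
    𝓕 f w j = 𝓕 (fun x => f x j) w := by
  rw [Real.fourier_eq, Real.fourier_eq]
  have hi : Integrable (fun v => Real.fourierChar (-inner ℝ v w) • f v) :=
    (Real.fourierIntegral_convergent_iff w).2 hf
  exact ((EuclideanSpace.proj j : C3 →L[ℂ] ℂ).integral_comp_comm hi).symm

/-- Truncated Fourier inversion with an approximate transform `h`: the error is bounded by the error of
the transform in the ball and the tail of the transform. The transform `𝓕` has the kernel
`e^{-2πi w · x}`, hence the substitution `ξ = 2π w` and the radius `ρ / 2π`. -/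
lemma eLpNorm_truncated_inverse_sub_le {h : E3 → Fin 3 → ℂ} {f : E3 → C3} (hf1 : Integrable f)
    (hf2 : MemLp f 2 (volume : Measure E3)) {ρ : ℝ}
    (hmeas : AEStronglyMeasurable (fun w => (WithLp.toLp 2 (h ((2 * Real.pi) • w)) : C3))
      (volume.restrict (closedBall (0 : E3) (ρ / (2 * Real.pi))))) :
    eLpNorm (fun x => (WithLp.toLp 2 (fun j => (1 / (2 * (Real.pi : ℂ)) ^ 3) *
      ∫ ξ in closedBall (0 : E3) ρ, h ξ j * Complex.exp (Complex.I * ((inner ℝ x ξ : ℝ) : ℂ))) : C3) -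
        f x) 2 (volume : Measure E3) ≤
    eLpNorm (fun w => (WithLp.toLp 2 (h ((2 * Real.pi) • w)) : C3) - 𝓕 f w) 2
      (volume.restrict (closedBall (0 : E3) (ρ / (2 * Real.pi)))) +
    eLpNorm (𝓕 f) 2 (volume.restrict (closedBall (0 : E3) (ρ / (2 * Real.pi)))ᶜ) := by
  have hpi : 0 < 2 * Real.pi := by positivity
  set B := closedBall (0 : E3) (ρ / (2 * Real.pi)) with hB
  have hBm : MeasurableSet B := isClosed_closedBall.measurableSet
  set H : E3 → C3 := fun w => WithLp.toLp 2 (h ((2 * Real.pi) • w)) with hH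
  have hFm : AEStronglyMeasurable (𝓕 f : E3 → C3) (volume : Measure E3) :=
    (continuous_fourier_of_integrable hf1).aestronglyMeasurable
  have hF2 : MemLp (𝓕 f : E3 → C3) 2 (volume : Measure E3) :=
    ⟨hFm, by rw [eLpNorm_fourier hf1 hf2]; exact hf2.2⟩
  -- no integrability of `h` is assumed: otherwise the right-hand side is infinite
  by_cases htop : eLpNorm (fun w => H w - 𝓕 f w) 2 (volume.restrict B) = ⊤
  · rw [htop]; simp
  have hq : MemLp (fun w => H w - 𝓕 f w) 2 (volume.restrict B) :=
    ⟨hmeas.sub hFm.restrict, lt_top_iff_ne_top.2 htop⟩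
  have hHB : MemLp H 2 (volume.restrict B) := by
    have := hq.add (hF2.restrict B)
    refine this.congr_norm hmeas (Eventually.of_forall fun w => ?_)
    simp
  set G : E3 → C3 := B.indicator H with hG
  have hG2 : MemLp G 2 (volume : Measure E3) := (memLp_indicator_iff_restrict hBm).2 hHB
  have hBfin : IsFiniteMeasure ((volume : Measure E3).restrict B) :=
    ⟨by rw [Measure.restrict_apply_univ]; exact measure_closedBall_lt_top⟩
  have hG1 : Integrable G := (integrable_indicator_iff hBm).2 (hHB.integrable one_le_two)
  have e : ∀ x, (WithLp.toLp 2 (fun j => (1 / (2 * (Real.pi : ℂ)) ^ 3) *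
      ∫ ξ in closedBall (0 : E3) ρ, h ξ j * Complex.exp (Complex.I * ((inner ℝ x ξ : ℝ) : ℂ))) : C3) =
      𝓕⁻ G x := by
    intro x
    ext j
    have hc : 𝓕⁻ G x j = 𝓕⁻ (fun w => G w j) x := by
      rw [Real.fourierInv_eq_fourier_neg, Real.fourierInv_eq_fourier_neg,
        fourier_apply_component hG1]
    rw [hc, Real.fourierInv_eq']
    have hs := Measure.integral_comp_smul_of_nonneg (volume : Measure E3)
      ((closedBall (0 : E3) ρ).indicator fun ξ => h ξ j *
        Complex.exp (Complex.I * ((inner ℝ x ξ : ℝ) : ℂ))) (2 * Real.pi) (hR := hpi.le)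
    rw [integral_indicator isClosed_closedBall.measurableSet] at hs
    have e1 : ∀ w : E3, (closedBall (0 : E3) ρ).indicator (fun ξ => h ξ j *
        Complex.exp (Complex.I * ((inner ℝ x ξ : ℝ) : ℂ))) ((2 * Real.pi) • w) =
        Complex.exp ((↑(2 * Real.pi * inner ℝ w x) * Complex.I)) • G w j := by
      intro w
      have hmem : (2 * Real.pi) • w ∈ closedBall (0 : E3) ρ ↔ w ∈ B := by
        rw [hB, mem_closedBall_zero_iff, mem_closedBall_zero_iff, norm_smul,
          Real.norm_of_nonneg hpi.le, le_div_iff₀ hpi, mul_comm]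
      by_cases hw : w ∈ B
      · rw [indicator_of_mem (hmem.2 hw), hG, indicator_of_mem hw, inner_smul_right,
          real_inner_comm, smul_eq_mul, mul_comm, mul_comm Complex.I]
      · rw [indicator_of_notMem (fun h => hw (hmem.1 h)), hG, indicator_of_notMem hw]
        simp
    simp only [e1] at hs
    rw [hs]
    simp only [finrank_euclideanSpace, Fintype.card_fin, Complex.real_smul]
    push_cast
    rw [one_div]
  simp only [e]
  rw [eLpNorm_fourierInv_sub hf1 hf2 hG1 hG2]
  have e2 : (fun w => G w - 𝓕 f w) =
      B.indicator (fun w => H w - 𝓕 f w) + Bᶜ.indicator (fun w => -(𝓕 f w)) := by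
    funext w
    by_cases hw : w ∈ B <;> simp [hG, hw]
  rw [e2]
  refine (eLpNorm_add_le ((memLp_indicator_iff_restrict hBm).2 hq).1
    ((hFm.neg).indicator hBm.compl) one_le_two).trans (le_of_eq ?_)
  rw [eLpNorm_indicator_eq_eLpNorm_restrict hBm, eLpNorm_indicator_eq_eLpNorm_restrict hBm.compl]
  congr 1
  exact eLpNorm_neg (𝓕 f) 2 _

/-- Smooth cutoff functions. -/
lemma exists_cutoff {K D : Set E3} (hK : IsCompact K) (hD : IsOpen D) (hKD : K ⊆ D) :
    ∃ χ : E3 → ℝ, ContDiff ℝ (⊤ : ℕ∞) χ ∧ HasCompactSupport χ ∧ tsupport χ ⊆ D ∧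
      (∀ x ∈ K, χ =ᶠ[𝓝 x] 1) ∧ ∀ x, χ x ∈ Icc (0 : ℝ) 1 := by
  obtain ⟨L, hL, hKL, hLD⟩ := exists_compact_between hK hD hKD
  obtain ⟨χ, h1, h0, hI⟩ := exists_contMDiffMap_one_nhds_of_subset_interior
    (modelWithCornersSelf ℝ E3) (n := (⊤ : ℕ∞)) hK.isClosed hKL
  have hsupp : tsupport (χ : E3 → ℝ) ⊆ L := closure_minimal (fun x hx => by
    by_contra hxL
    exact hx (h0 x hxL)) hL.isClosed
  refine ⟨χ, χ.contMDiff.contDiff, HasCompactSupport.of_support_subset_isCompact hL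
    ((subset_tsupport _).trans hsupp), hsupp.trans hLD, fun x hx => ?_, hI⟩
  exact (Filter.eventually_of_mem (h1 : _ ∈ 𝓝ˢ K) fun _ h => h).filter_mono (nhds_le_nhdsSet hx)

lemma cos_sin_fourier {D : Set E3} (hD : IsOpen D) {g : E3 → ℝ}
    (hg : IntegrableOn g D) (w : E3) :
    𝓕 (D.indicator fun y => (g y : ℂ)) w =
      ((∫ y in D, g y * Real.cos (2 * Real.pi * inner ℝ y w) : ℝ) : ℂ) -
        ((∫ y in D, g y * Real.sin (2 * Real.pi * inner ℝ y w) : ℝ) : ℂ) * Complex.I := by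
  have hc : IntegrableOn (fun y => g y * Real.cos (2 * Real.pi * inner ℝ y w)) D :=
    hg.mul_bdd (c := 1) (by fun_prop) (Eventually.of_forall fun y => Real.abs_cos_le_one _)
  have hs : IntegrableOn (fun y => g y * Real.sin (2 * Real.pi * inner ℝ y w)) D :=
    hg.mul_bdd (c := 1) (by fun_prop) (Eventually.of_forall fun y => Real.abs_sin_le_one _)
  rw [Real.fourier_eq', ← integral_complex_ofReal, ← integral_complex_ofReal, ← integral_mul_const,
    ← integral_sub hc.ofReal (hs.ofReal.mul_const _), ← integral_indicator hD.measurableSet]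
  congr 1; funext y
  by_cases hy : y ∈ D
  · simp only [indicator_of_mem hy, Complex.exp_mul_I, ← Complex.ofReal_cos, ← Complex.ofReal_sin,
      smul_eq_mul]
    rw [show -2 * Real.pi * inner ℝ y w = -(2 * Real.pi * inner ℝ y w) by ring, Real.cos_neg,
      Real.sin_neg]
    push_cast; ring
  · simp [hy]

/-- The Fourier transform of a weak derivative of a function that vanishes near the boundary. The
weak derivative enters only through a cutoff, so that its behaviour near the boundary does not
matter. -/
lemma fourier_weakGradient {D : Set E3} (hD : IsOpen D) {K : Set E3} {v : E3 → ℝ}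
    (hvK : ∀ x ∉ K, v x = 0) (hv : IntegrableOn v D) {w : Fin 3 → E3 → ℝ}
    (hw : ∀ i, IntegrableOn (w i) D) (hgrad : IsWeakGradient D v w) {χ : E3 → ℝ}
    (hχ : ContDiff ℝ (⊤ : ℕ∞) χ) (hχc : HasCompactSupport χ) (hχD : tsupport χ ⊆ D)
    (hχ1 : ∀ x ∈ K, χ =ᶠ[𝓝 x] 1) (hχI : ∀ x, χ x ∈ Icc (0 : ℝ) 1) (i : Fin 3) (p : E3) :
    𝓕 (D.indicator fun y => ((χ y * w i y : ℝ) : ℂ)) p =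
      (2 * Real.pi * p i) * Complex.I * 𝓕 (D.indicator fun y => (v y : ℂ)) p := by
  have hχw : IntegrableOn (fun y => χ y * w i y) D :=
    (hw i).bdd_mul (c := 1) hχ.continuous.aestronglyMeasurable
      (Eventually.of_forall fun y => by
        rw [Real.norm_of_nonneg (hχI y).1]; exact (hχI y).2)
  set a : E3 → ℝ := fun y => 2 * Real.pi * inner ℝ y p with ha
  have has : ContDiff ℝ (⊤ : ℕ∞) a := contDiff_const.mul (contDiff_id.inner ℝ contDiff_const)
  have hda : ∀ y, HasFDerivAt a ((2 * Real.pi) • (innerSL ℝ p)) y := fun y => by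
    have h := ((innerSL ℝ p).hasFDerivAt (x := y)).const_mul (2 * Real.pi)
    refine h.congr_of_eventuallyEq (Eventually.of_forall fun z => ?_)
    simp [ha, real_inner_comm]
  have hap : ((2 * Real.pi) • (innerSL ℝ p)) (unitVec i) = 2 * Real.pi * p i := by
    simp [unitVec, EuclideanSpace.inner_single_right]
  -- the weak formulation with the test function `χ · trig(a)`
  have key : ∀ (T T' : ℝ → ℝ), ContDiff ℝ (⊤ : ℕ∞) T → (∀ t, HasDerivAt T (T' t) t) →
      ∫ y in D, (χ y * w i y) * T (a y) = -(2 * Real.pi * p i * ∫ y in D, v y * T' (a y)) := by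
    intro T T' hT hT'
    have hφ : ContDiff ℝ (⊤ : ℕ∞) (fun y => χ y * T (a y)) := hχ.mul (hT.comp has)
    have h := hgrad i (fun y => χ y * T (a y)) hφ hχc.mul_right
      ((tsupport_mul_subset_left).trans hχD)
    have e1 : ∫ y in D, v y * fderiv ℝ (fun y => χ y * T (a y)) y (unitVec i) =
        2 * Real.pi * p i * ∫ y in D, v y * T' (a y) := by
      rw [← integral_const_mul]
      congr 1; funext y
      by_cases hy : y ∈ K
      · have hloc : (fun y => χ y * T (a y)) =ᶠ[𝓝 y] fun y => T (a y) := by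
          filter_upwards [hχ1 y hy] with z hz
          rw [hz, Pi.one_apply, one_mul]
        have hd : HasFDerivAt (fun y => T (a y)) (T' (a y) • ((2 * Real.pi) • (innerSL ℝ p))) y :=
          (hT' (a y)).comp_hasFDerivAt y (hda y)
        rw [hloc.fderiv_eq, hd.fderiv, _root_.smul_apply, hap, smul_eq_mul]
        ring
      · rw [hvK y hy]; ring
    rw [e1] at h
    have e2 : ∫ y in D, (χ y * w i y) * T (a y) = ∫ y in D, w i y * (χ y * T (a y)) := by
      congr 1; funext y; ring
    rw [e2, h, neg_neg]
  have kc := key Real.cos (fun t => -Real.sin t) Real.contDiff_cos Real.hasDerivAt_cos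
  have ks := key Real.sin Real.cos Real.contDiff_sin Real.hasDerivAt_sin
  simp only [mul_neg, integral_neg, neg_neg] at kc
  rw [cos_sin_fourier hD hχw, cos_sin_fourier hD hv, kc, ks]
  push_cast
  linear_combination ((2 * Real.pi * p i) * ((∫ y in D, v y * Real.sin (a y) : ℝ) : ℂ)) * Complex.I_sq

lemma integral_norm_sq_fourier {f : E3 → ℂ} (h1 : Integrable f)
    (h2 : MemLp f 2 (volume : Measure E3)) :
    Integrable (fun w => ‖𝓕 f w‖ ^ 2) ∧ ∫ w, ‖𝓕 f w‖ ^ 2 = ∫ x, ‖f x‖ ^ 2 := by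
  have hF2 : MemLp (𝓕 f : E3 → ℂ) 2 (volume : Measure E3) :=
    ⟨(continuous_fourier_of_integrable h1).aestronglyMeasurable,
      by rw [eLpNorm_fourier h1 h2]; exact h2.2⟩
  refine ⟨hF2.integrable_norm_pow two_ne_zero, ?_⟩
  have e := eLpNorm_fourier h1 h2
  rw [hF2.eLpNorm_eq_integral_rpow_norm two_ne_zero ENNReal.ofNat_ne_top,
    h2.eLpNorm_eq_integral_rpow_norm two_ne_zero ENNReal.ofNat_ne_top,
    ENNReal.ofReal_eq_ofReal_iff (by positivity) (by positivity)] at e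
  simp only [ENNReal.toReal_ofNat, Real.rpow_ofNat] at e
  have ha : 0 ≤ ∫ w, ‖𝓕 f w‖ ^ 2 := integral_nonneg fun _ => by positivity
  have hb : 0 ≤ ∫ x, ‖f x‖ ^ 2 := integral_nonneg fun _ => by positivity
  exact (Real.rpow_left_inj ha hb (by norm_num)).1 e

/-- The tail of the Fourier transform of a function in `H¹(D)` with support in `D`. -/
lemma lintegral_fourier_tail_le {D : Set E3} (hD : IsOpen D) (hDb : Bornology.IsBounded D)
    {K : Set E3} (hKD : K ⊆ D) (hK : IsCompact K) {v : E3 → ℝ}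
    (hvK : ∀ x ∉ K, v x = 0) {M : ℝ} (hM : H1NormLE D v M) {r : ℝ} (hr : 0 ≤ r) :
    ∫⁻ p in (closedBall (0 : E3) r)ᶜ, ‖𝓕 (D.indicator fun y => (v y : ℂ)) p‖ₑ ^ 2 ≤
      ENNReal.ofReal (M ^ 2 / (1 + (2 * Real.pi * r) ^ 2)) := by
  obtain ⟨hv2, w, hw2, hgrad, hnorm⟩ := hM
  obtain ⟨χ, hχ, hχc, hχD, hχ1, hχI⟩ := exists_cutoff hK hD hKD
  have hfin : IsFiniteMeasure ((volume : Measure E3).restrict D) :=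
    ⟨by rw [Measure.restrict_apply_univ]; exact hDb.measure_lt_top⟩
  have hM2 : (∫ x in D, v x ^ 2) + ∑ i, ∫ x in D, w i x ^ 2 ≤ M ^ 2 := by
    have h0 : 0 ≤ (∫ x in D, v x ^ 2) + ∑ i, ∫ x in D, w i x ^ 2 :=
      add_nonneg (integral_nonneg fun _ => sq_nonneg _)
        (Finset.sum_nonneg fun i _ => integral_nonneg fun _ => sq_nonneg _)
    have := pow_le_pow_left₀ (Real.sqrt_nonneg _) hnorm 2
    rwa [Real.sq_sqrt h0] at this
  have hχw2 : ∀ i, MemLp (fun y => χ y * w i y) 2 (volume.restrict D) := fun i =>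
    (hw2 i).mono (hχ.continuous.aestronglyMeasurable.mul (hw2 i).1) (Eventually.of_forall fun y => by
      rw [norm_mul, Real.norm_of_nonneg (hχI y).1]
      exact mul_le_of_le_one_left (norm_nonneg _) (hχI y).2)
  have hind : ∀ {g : E3 → ℝ}, MemLp g 2 (volume.restrict D) →
      Integrable (D.indicator fun y => (g y : ℂ)) ∧
      MemLp (D.indicator fun y => (g y : ℂ)) 2 (volume : Measure E3) ∧
      ∫ y, ‖D.indicator (fun y => (g y : ℂ)) y‖ ^ 2 = ∫ y in D, g y ^ 2 := by
    intro g hg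
    have hgc : MemLp (fun y => (g y : ℂ)) 2 (volume.restrict D) := hg.ofReal
    refine ⟨(integrable_indicator_iff hD.measurableSet).2 (hgc.integrable one_le_two),
      (memLp_indicator_iff_restrict hD.measurableSet).2 hgc, ?_⟩
    rw [← integral_indicator hD.measurableSet]
    congr 1; funext y
    by_cases hy : y ∈ D <;> simp [hy]
  obtain ⟨v1, v2, v3⟩ := hind hv2
  have hFv := integral_norm_sq_fourier v1 v2
  have hFw := fun i => integral_norm_sq_fourier (hind (hχw2 i)).1 (hind (hχw2 i)).2.1
  -- the density of the squared `H¹` norm on the frequency side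
  set T : E3 → ℝ := fun p => ‖𝓕 (D.indicator fun y => (v y : ℂ)) p‖ ^ 2 +
    ∑ i, ‖𝓕 (D.indicator fun y => ((χ y * w i y : ℝ) : ℂ)) p‖ ^ 2 with hT
  have hTi : Integrable T := hFv.1.add (integrable_finsetSum _ fun i _ => (hFw i).1)
  have hTint : ∫ p, T p ≤ M ^ 2 := by
    simp only [hT]
    rw [integral_add hFv.1 (integrable_finsetSum _ fun i _ => (hFw i).1),
      integral_finsetSum _ fun i _ => (hFw i).1, hFv.2, v3]
    refine le_trans (add_le_add le_rfl (Finset.sum_le_sum fun i _ => ?_)) hM2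
    rw [(hFw i).2, (hind (hχw2 i)).2.2]
    refine integral_mono (hχw2 i).integrable_sq (hw2 i).integrable_sq fun y => ?_
    simp only [mul_pow]
    have h1 := hχI y
    exact mul_le_of_le_one_left (sq_nonneg _) (pow_le_one₀ h1.1 h1.2)
  have hTeq : ∀ p, T p = (1 + (2 * Real.pi * ‖p‖) ^ 2) *
      ‖𝓕 (D.indicator fun y => (v y : ℂ)) p‖ ^ 2 := by
    intro p
    have e : ∀ i, ‖𝓕 (D.indicator fun y => ((χ y * w i y : ℝ) : ℂ)) p‖ ^ 2 =
        (2 * Real.pi) ^ 2 * p i ^ 2 * ‖𝓕 (D.indicator fun y => (v y : ℂ)) p‖ ^ 2 := fun i => by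
      rw [fourier_weakGradient hD hvK (hv2.integrable one_le_two)
        (fun i => (hw2 i).integrable one_le_two) hgrad hχ hχc hχD hχ1 hχI i p, norm_mul, norm_mul,
        Complex.norm_I, mul_one, mul_pow]
      congr 1
      have : (2 * (Real.pi : ℂ) * p i) = ((2 * Real.pi * p i : ℝ) : ℂ) := by push_cast; ring
      rw [this, Complex.norm_real, Real.norm_eq_abs, sq_abs]
      ring
    simp only [hT, e]
    rw [← Finset.sum_mul, ← Finset.mul_sum, mul_pow _ ‖p‖, EuclideanSpace.real_norm_sq_eq]
    ring
  have hpos : 0 < 1 + (2 * Real.pi * r) ^ 2 := by positivity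
  calc ∫⁻ p in (closedBall (0 : E3) r)ᶜ, ‖𝓕 (D.indicator fun y => (v y : ℂ)) p‖ₑ ^ 2
      ≤ ∫⁻ p in (closedBall (0 : E3) r)ᶜ, ENNReal.ofReal (T p / (1 + (2 * Real.pi * r) ^ 2)) := by
        refine setLIntegral_mono' isClosed_closedBall.measurableSet.compl fun p hp => ?_
        rw [mem_compl_iff, mem_closedBall_zero_iff, not_le] at hp
        rw [← ofReal_norm, ← ENNReal.ofReal_pow (norm_nonneg _)]
        refine ENNReal.ofReal_le_ofReal ?_
        rw [le_div_iff₀ hpos, hTeq, mul_comm]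
        have := Real.pi_pos
        gcongr
    _ ≤ ∫⁻ p, ENNReal.ofReal (T p / (1 + (2 * Real.pi * r) ^ 2)) := setLIntegral_le_lintegral _ _
    _ = ENNReal.ofReal (∫ p, T p / (1 + (2 * Real.pi * r) ^ 2)) :=
        (ofReal_integral_eq_lintegral_ofReal (hTi.div_const _)
          (Eventually.of_forall fun p => by positivity)).symm
    _ ≤ _ := by
        rw [integral_div]
        gcongr

end Tail

/-! ### Joint measurability of the reconstruction -/

section JointMeasurability

open Filter Topology Metric

lemma aestronglyMeasurable_toLp {α : Type*} [MeasurableSpace α] {μ : Measure α} {f : α → Fin 3 → ℂ}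
    (hf : ∀ j, AEStronglyMeasurable (fun a => f a j) μ) :
    AEStronglyMeasurable (fun a => (WithLp.toLp 2 (f a) : C3)) μ :=
  (PiLp.continuous_toLp 2 (fun _ : Fin 3 => ℂ)).comp_aestronglyMeasurable
    (aemeasurable_pi_iff.2 fun j => (hf j).aemeasurable).aestronglyMeasurable

lemma measurable_alphaVec (θ : Fin 3 → ℝ) (k m : Fin 3) :
    Measurable (fun ξ : E3 => alphaVec θ ξ k m) := by
  have hc : ∀ i : Fin 3, Measurable (fun ξ : E3 => ξ i) := fun i => by fun_prop
  have hs : MeasurableSet {ξ : E3 | ξ (k + 1) = 0 ∧ ξ (k + 2) = 0} :=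
    (hc _ (measurableSet_singleton 0)).inter (hc _ (measurableSet_singleton 0))
  simp only [alphaVec]
  refine Measurable.ite (MeasurableSet.const _) measurable_const ?_
  refine Measurable.ite hs measurable_const ?_
  refine Measurable.div (Measurable.ite (MeasurableSet.const _) (hc _).neg (hc _)) ?_
  exact (((hc _).pow_const 2).add ((hc _).pow_const 2)).sqrt

lemma measurable_zetaVec (θ : Fin 3 → ℝ) (κs : ℝ) (k : Fin 3) (l : Fin 2) (m : Fin 3) :
    Measurable (fun ξ : E3 => zetaVec θ κs ξ k l m) := by
  simp only [zetaVec, PiLp.add_apply, PiLp.smul_apply, smul_eq_mul]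
  have hc : Measurable (fun ξ : E3 => ξ m) := by fun_prop
  have hn : Measurable (fun ξ : E3 => √(κs ^ 2 - ‖ξ‖ ^ 2 / 4)) := by fun_prop
  exact (hc.const_mul _).add ((hn.const_mul _).mul (measurable_alphaVec θ k m))

lemma measurable_etaVec (θ : Fin 3 → ℝ) (κs : ℝ) (k : Fin 3) (l : Fin 2) (m : Fin 3) :
    Measurable (fun ξ : E3 => etaVec θ κs ξ k l m) := by
  simp only [etaVec, PiLp.smul_apply, smul_eq_mul]
  have h : ∀ j, Measurable (fun ξ : E3 => κs⁻¹ * zetaVec θ κs ξ k l j) := fun j =>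
    (measurable_zetaVec θ κs k l j).const_mul _
  refine Measurable.mul ?_ (Measurable.ite (MeasurableSet.const _) ?_ ?_)
  · exact ((((h k).pow_const 2).const_sub 1).sqrt).const_div 1
  · exact ((h k).pow_const 2).const_sub 1
  · exact (h k).neg.mul (h m)

lemma measurable_inner_zetaVec (θ : Fin 3 → ℝ) (κs : ℝ) (k : Fin 3) (l : Fin 2) :
    Measurable (fun p : E3 × E3 => inner ℝ p.2 (zetaVec θ κs p.1 k l)) := by
  simp only [inner_cyclic _ _ 0]
  have hc : ∀ i : Fin 3, Measurable (fun p : E3 × E3 => p.2 i) := fun i => by fun_prop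
  have hz : ∀ i : Fin 3, Measurable (fun p : E3 × E3 => zetaVec θ κs p.1 k l i) := fun i =>
    (measurable_zetaVec θ κs k l i).comp measurable_fst
  exact (((hc _).mul (hz _)).add ((hc _).mul (hz _))).add ((hc _).mul (hz _))

lemma measurable_expSol (θ : Fin 3 → ℝ) (κs : ℝ) (k : Fin 3) (l : Fin 2) (j : Fin 3) :
    Measurable (fun p : E3 × E3 => expSol θ κs p.1 k l p.2 j) := by
  have e : (fun p : E3 × E3 => expSol θ κs p.1 k l p.2 j) = fun p =>
      (etaVec θ κs p.1 k l j : ℂ) * Complex.exp (Complex.I *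
        ((inner ℝ p.2 (zetaVec θ κs p.1 k l) : ℝ) : ℂ)) := by
    funext p; rw [expSol_apply, planeWave, real_inner_comm]
  rw [e]
  refine Measurable.mul (Complex.measurable_ofReal.comp
    ((measurable_etaVec θ κs k l j).comp measurable_fst)) ?_
  exact Complex.measurable_exp.comp ((Complex.measurable_ofReal.comp
    (measurable_inner_zetaVec θ κs k l)).const_mul _)

lemma measurable_inv_coeffMatrix (θ : Fin 3 → ℝ) (κs : ℝ) (i j : Fin 3) :
    Measurable (fun ξ : E3 => ((coeffMatrix θ κs ξ).map (fun a : ℝ => (a : ℂ)))⁻¹ i j) := by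
  have h1 : Measurable (fun a : Fin 3 → Fin 3 → ℂ => (Matrix.of a)⁻¹ i j) := by
    have e : (fun a : Fin 3 → Fin 3 → ℂ => (Matrix.of a)⁻¹ i j) =
        fun a => ((Matrix.of a).det)⁻¹ * (Matrix.of a).adjugate i j := by
      funext a
      rw [Matrix.inv_def, Matrix.smul_apply, smul_eq_mul, Ring.inverse_eq_inv']
    have hid : Continuous (fun a : Fin 3 → Fin 3 → ℂ => Matrix.of a) := continuous_id
    rw [e]
    exact (hid.matrix_det.measurable.inv).mul (hid.matrix_adjugate.matrix_elem i j).measurable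
  have h2 : Measurable (fun (ξ : E3) (k j : Fin 3) => (coeffMatrix θ κs ξ k j : ℂ)) := by
    refine measurable_pi_lambda _ fun k => measurable_pi_lambda _ fun j => ?_
    simp only [coeffMatrix, Matrix.of_apply]
    exact Complex.measurable_ofReal.comp ((measurable_etaVec θ κs k 0 j).mul
      (measurable_etaVec θ κs k 1 j))
  exact h1.comp h2

variable {Ω : Type*} [MeasurableSpace Ω] {P : Measure Ω} {lam mu κ R ε : ℝ}

lemma IsNoisyData.aestronglyMeasurable_functional [SFinite P] {u uδ tδ : E3 → Ω → C3}
    (hd : IsNoisyData P lam mu R ε u uδ tδ) (hκ : 0 < kappaS mu κ) (θ : Fin 3 → ℝ) {s : ℝ}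
    {ν : Measure E3} [SFinite ν] (hν : ∀ᵐ w ∂ν, ‖s • w‖ < 2 * kappaS mu κ) (k : Fin 3) (l : Fin 2) :
    AEStronglyMeasurable (fun p : E3 × Ω => noisyFunctional lam mu κ R uδ tδ θ (s • p.1) k l p.2)
      (ν.prod P) := by
  have hqmp : Measure.QuasiMeasurePreserving (Prod.map Prod.snd id : (E3 × Ω) × E3 → Ω × E3)
      ((ν.prod P).prod (surfaceMeasure R)) (P.prod (surfaceMeasure R)) :=
    MeasureTheory.QuasiMeasurePreserving.prodMap Measure.quasiMeasurePreserving_snd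
      (Measure.QuasiMeasurePreserving.id _)
  have hv : AEStronglyMeasurable (fun p : (E3 × Ω) × E3 => uδ p.2 p.1.2)
      ((ν.prod P).prod (surfaceMeasure R)) := hd.meas_u.prod_swap.comp_quasiMeasurePreserving hqmp
  have ht : AEStronglyMeasurable (fun p : (E3 × Ω) × E3 => tδ p.2 p.1.2)
      ((ν.prod P).prod (surfaceMeasure R)) := hd.meas_t.prod_swap.comp_quasiMeasurePreserving hqmp
  have hproj : ∀ {f : (E3 × Ω) × E3 → C3}, AEStronglyMeasurable f ((ν.prod P).prod (surfaceMeasure R)) →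
      ∀ j, AEStronglyMeasurable (fun p => f p j) ((ν.prod P).prod (surfaceMeasure R)) :=
    fun hf j => (EuclideanSpace.proj j : C3 →L[ℂ] ℂ).continuous.comp_aestronglyMeasurable hf
  have hm : Measurable (fun p : (E3 × Ω) × E3 => (s • p.1.1, p.2)) := by fun_prop
  have hm' : Measurable (fun p : (E3 × Ω) × E3 => (s • p.1.1, ‖p.2‖⁻¹ • p.2)) := by fun_prop
  have hU : ∀ j, AEStronglyMeasurable (fun p : (E3 × Ω) × E3 =>
      expSol θ (kappaS mu κ) (s • p.1.1) k l p.2 j) ((ν.prod P).prod (surfaceMeasure R)) := fun j =>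
    ((measurable_expSol θ (kappaS mu κ) k l j).comp hm).aestronglyMeasurable
  have hI : AEStronglyMeasurable (fun p : (E3 × Ω) × E3 =>
      (mu : ℂ) * (Complex.I * ((inner ℝ (‖p.2‖⁻¹ • p.2)
        (zetaVec θ (kappaS mu κ) (s • p.1.1) k l) : ℝ) : ℂ))) ((ν.prod P).prod (surfaceMeasure R)) :=
    (((Complex.measurable_ofReal.comp ((measurable_inner_zetaVec θ (kappaS mu κ) k l).comp
      hm')).const_mul _).const_mul _).aestronglyMeasurable
  have hΨ : AEStronglyMeasurable (fun p : (E3 × Ω) × E3 =>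
      (∑ j, tδ p.2 p.1.2 j * expSol θ (kappaS mu κ) (s • p.1.1) k l p.2 j) -
        ∑ j, (mu : ℂ) * (Complex.I * ((inner ℝ (‖p.2‖⁻¹ • p.2)
          (zetaVec θ (kappaS mu κ) (s • p.1.1) k l) : ℝ) : ℂ)) *
          expSol θ (kappaS mu κ) (s • p.1.1) k l p.2 j * uδ p.2 p.1.2 j)
      ((ν.prod P).prod (surfaceMeasure R)) := by
    refine AEStronglyMeasurable.sub (Finset.aestronglyMeasurable_fun_sum _ fun j _ => ?_)
      (Finset.aestronglyMeasurable_fun_sum _ fun j _ => ?_)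
    · exact (hproj ht j).mul (hU j)
    · exact (hI.mul (hU j)).mul (hproj hv j)
  refine hΨ.integral_prod_right'.congr ?_
  have hν' : ∀ᵐ p ∂(ν.prod P), ‖s • p.1‖ < 2 * kappaS mu κ :=
    Measure.quasiMeasurePreserving_fst.ae hν
  filter_upwards [hν'] with p hp
  rw [noisyFunctional, boundaryFunctional]
  simp only [boundaryOp_expSol lam mu θ hκ hp]

lemma aestronglyMeasurable_correlationData [SFinite P] {N : ℕ} {u uδ tδ : Fin N → E3 → Ω → C3}
    (hd : ∀ n, IsNoisyData P lam mu R ε (u n) (uδ n) (tδ n)) (hκ : 0 < kappaS mu κ)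
    (θ : Fin 3 → ℝ) {s : ℝ} {ν : Measure E3} [SFinite ν]
    (hν : ∀ᵐ w ∂ν, ‖s • w‖ < 2 * kappaS mu κ) (k : Fin 3) :
    AEStronglyMeasurable (fun p : E3 × Ω => correlationData lam mu κ R θ
      (fun n y => uδ n y p.2) (fun n y => tδ n y p.2) (s • p.1) k) (ν.prod P) := by
  simp only [correlationData]
  refine (Finset.aestronglyMeasurable_fun_sum _ fun n _ => ?_).const_mul _
  exact ((hd n).aestronglyMeasurable_functional hκ θ hν k 0).mul
    ((hd n).aestronglyMeasurable_functional hκ θ hν k 1)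

lemma aestronglyMeasurable_fourierRec [SFinite P] {N : ℕ} {u uδ tδ : Fin N → E3 → Ω → C3}
    (hd : ∀ n, IsNoisyData P lam mu R ε (u n) (uδ n) (tδ n)) (hκ : 0 < kappaS mu κ)
    (θ : Fin 3 → ℝ) {s : ℝ} {ν : Measure E3} [SFinite ν]
    (hν : ∀ᵐ w ∂ν, ‖s • w‖ < 2 * kappaS mu κ) (j : Fin 3) :
    AEStronglyMeasurable (fun p : E3 × Ω => fourierRec lam mu κ R θ
      (fun n y => uδ n y p.2) (fun n y => tδ n y p.2) (s • p.1) j) (ν.prod P) := by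
  simp only [fourierRec, Matrix.mulVec, dotProduct]
  refine Finset.aestronglyMeasurable_fun_sum _ fun k _ => AEStronglyMeasurable.mul ?_ ?_
  · have hm : Measurable (fun p : E3 × Ω => -(s • p.1)) := by fun_prop
    exact ((measurable_inv_coeffMatrix θ (kappaS mu κ) j k).comp hm).aestronglyMeasurable
  · have hν' : ∀ᵐ w ∂ν, ‖(-s) • w‖ < 2 * kappaS mu κ := by
      filter_upwards [hν] with w hw
      rwa [neg_smul, norm_neg]
    simpa only [neg_smul] using aestronglyMeasurable_correlationData hd hκ θ hν' k

/-- The reconstruction error is a random variable. -/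
lemma aemeasurable_recError [SFinite P] {N : ℕ} {u uδ tδ : Fin N → E3 → Ω → C3}
    (hd : ∀ n, IsNoisyData P lam mu R ε (u n) (uδ n) (tδ n)) (hκ : 0 < kappaS mu κ)
    (θ : Fin 3 → ℝ) {ρ : ℝ} (hρ : ρ < 2 * kappaS mu κ) {D : Set E3} {σ : Fin 3 → E3 → ℝ}
    (hσ : AEStronglyMeasurable (varianceVec σ) (volume.restrict D)) :
    AEMeasurable (fun ω => recError lam mu κ R D σ θ ρ
      (fun n y => uδ n y ω) (fun n y => tδ n y ω)) P := by
  set ν : Measure E3 := volume.restrict (closedBall (0 : E3) ρ) with hν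
  have hν1 : ∀ᵐ w ∂ν, ‖(1 : ℝ) • w‖ < 2 * kappaS mu κ := by
    filter_upwards [ae_restrict_mem isClosed_closedBall.measurableSet] with w hw
    rw [one_smul]
    exact (mem_closedBall_zero_iff.1 hw).trans_lt hρ
  have hF := fun j => aestronglyMeasurable_fourierRec (lam := lam) hd hκ θ hν1 j
  simp only [one_smul] at hF
  have hqmp : Measure.QuasiMeasurePreserving (fun p : (Ω × E3) × E3 => (p.2, p.1.1))
      ((P.prod (volume.restrict D)).prod ν) (ν.prod P) :=
    Measure.measurePreserving_swap.quasiMeasurePreserving.comp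
      (MeasureTheory.QuasiMeasurePreserving.prodMap Measure.quasiMeasurePreserving_fst
        (Measure.QuasiMeasurePreserving.id _))
  have hV : ∀ j, AEStronglyMeasurable (fun p : Ω × E3 => varianceRec lam mu κ R θ ρ
      (fun n y => uδ n y p.1) (fun n y => tδ n y p.1) p.2 j) (P.prod (volume.restrict D)) := fun j => by
    simp only [varianceRec]
    refine AEStronglyMeasurable.const_mul ?_ _
    have h1 : AEStronglyMeasurable (fun p : (Ω × E3) × E3 => fourierRec lam mu κ R θ
        (fun n y => uδ n y p.1.1) (fun n y => tδ n y p.1.1) p.2 j *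
        Complex.exp (Complex.I * ((inner ℝ p.1.2 p.2 : ℝ) : ℂ)))
        ((P.prod (volume.restrict D)).prod ν) := by
      refine ((hF j).comp_quasiMeasurePreserving hqmp).mul ?_
      have : Measurable (fun p : (Ω × E3) × E3 =>
          Complex.exp (Complex.I * ((inner ℝ p.1.2 p.2 : ℝ) : ℂ))) := by fun_prop
      exact this.aestronglyMeasurable
    exact h1.integral_prod_right'
  have hVv : AEStronglyMeasurable (fun p : Ω × E3 => varianceRec lam mu κ R θ ρ
      (fun n y => uδ n y p.1) (fun n y => tδ n y p.1) p.2) (P.prod (volume.restrict D)) := by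
    exact aestronglyMeasurable_toLp hV
  have hdiff := (hVv.sub hσ.comp_snd).enorm.pow_const 2
  simp only [recError, eLpNorm_two_eq]
  exact hdiff.lintegral_prod_right'.pow_const _

end JointMeasurability

/-! ### The variance of the source -/

section Source

open Filter Topology Metric FourierTransform
open scoped ENNReal

variable {D : Set E3} {σ : Fin 3 → E3 → ℝ} {M : ℝ}

lemma H1NormLE.nonneg {v : E3 → ℝ} (h : H1NormLE D v M) : 0 ≤ M := by
  obtain ⟨_, w, _, _, hw⟩ := h
  exact (Real.sqrt_nonneg _).trans hw

lemma H1NormLE.integral_sq_le {v : E3 → ℝ} (h : H1NormLE D v M) : ∫ x in D, v x ^ 2 ≤ M ^ 2 := by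
  obtain ⟨_, w, _, _, hw⟩ := h
  have h1 : 0 ≤ ∫ x in D, v x ^ 2 := integral_nonneg fun _ => sq_nonneg _
  have h2 : 0 ≤ ∑ i, ∫ x in D, w i x ^ 2 :=
    Finset.sum_nonneg fun i _ => integral_nonneg fun _ => sq_nonneg _
  have := pow_le_pow_left₀ (Real.sqrt_nonneg _) hw 2
  rw [Real.sq_sqrt (add_nonneg h1 h2)] at this
  linarith

lemma isFiniteMeasure_restrict_of_isBounded (hDb : Bornology.IsBounded D) :
    IsFiniteMeasure ((volume : Measure E3).restrict D) :=
  ⟨by rw [Measure.restrict_apply_univ]; exact hDb.measure_lt_top⟩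

/-- The strength is square integrable, because its square is integrable on the bounded set `D`. -/
lemma sqIntOn_of_H1 (hD : IsOpen D) (hDb : Bornology.IsBounded D) (hσ0 : ∀ j x, 0 ≤ σ j x)
    (hσ : ∀ j, H1NormLE D (fun x => σ j x ^ 2) M) : SqIntOn D σ := by
  intro j
  have := isFiniteMeasure_restrict_of_isBounded hDb
  have h2 : MemLp (fun x => σ j x ^ 2) 2 (volume.restrict D) := (hσ j).1
  have hm : AEStronglyMeasurable (σ j) (volume.restrict D) := by
    refine (Real.continuous_sqrt.comp_aestronglyMeasurable h2.1).congr
      (Eventually.of_forall fun x => ?_)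
    exact Real.sqrt_sq (hσ0 j x)
  have h3 : MemLp (σ j) 2 (volume.restrict D) :=
    (memLp_two_iff_integrable_sq hm).2 (h2.integrable one_le_two)
  exact (memLp_indicator_iff_restrict hD.measurableSet).2 h3.ofReal

/-- From `s ≤ (1 + s²) / 2` with `s = σ_j²`. -/
lemma srcEnergy_le (hDb : Bornology.IsBounded D) (hσ : ∀ j, H1NormLE D (fun x => σ j x ^ 2) M) :
    srcEnergy D σ ≤ 3 / 2 * (volume.real D + M ^ 2) := by
  have := isFiniteMeasure_restrict_of_isBounded hDb
  have h : ∀ j, ∫ y in D, σ j y ^ 2 ≤ 1 / 2 * (volume.real D + M ^ 2) := fun j => by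
    have h2 : MemLp (fun x => σ j x ^ 2) 2 (volume.restrict D) := (hσ j).1
    have h3 := (hσ j).integral_sq_le
    calc ∫ y in D, σ j y ^ 2 ≤ ∫ y in D, 1 / 2 * (1 + (σ j y ^ 2) ^ 2) := by
          refine integral_mono (h2.integrable one_le_two)
            (((integrable_const 1).add h2.integrable_sq).const_mul _) fun y => ?_
          simp only
          nlinarith [sq_nonneg (σ j y ^ 2 - 1)]
      _ = 1 / 2 * (volume.real D + ∫ y in D, (σ j y ^ 2) ^ 2) := by
          rw [integral_const_mul, integral_add (integrable_const 1) h2.integrable_sq]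
          simp
      _ ≤ _ := by gcongr
  calc srcEnergy D σ ≤ ∑ _j : Fin 3, 1 / 2 * (volume.real D + M ^ 2) :=
        Finset.sum_le_sum fun j _ => h j
    _ = _ := by simp; ring

lemma srcEnergy_nonneg : 0 ≤ srcEnergy D σ :=
  Finset.sum_nonneg fun _ _ => integral_nonneg fun _ => sq_nonneg _

lemma varianceVec_component (hσD : ∀ j, tsupport (σ j) ⊆ D) (j : Fin 3) :
    (fun x => varianceVec σ x j) = D.indicator fun x => ((σ j x ^ 2 : ℝ) : ℂ) := by
  funext x
  by_cases hx : x ∈ D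
  · simp [varianceVec, hx]
  · have : σ j x = 0 := image_eq_zero_of_notMem_tsupport fun h => hx (hσD j h)
    simp [varianceVec, hx, this]

lemma memLp_varianceVec (hD : IsOpen D) (hDb : Bornology.IsBounded D)
    (hσD : ∀ j, tsupport (σ j) ⊆ D) (hσ : ∀ j, H1NormLE D (fun x => σ j x ^ 2) M) :
    Integrable (varianceVec σ) ∧ MemLp (varianceVec σ) 2 (volume : Measure E3) := by
  have := isFiniteMeasure_restrict_of_isBounded hDb
  have hc : ∀ j, MemLp (fun x => ((σ j x ^ 2 : ℝ) : ℂ)) 2 (volume.restrict D) := fun j =>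
    (hσ j).1.ofReal
  have h2 : ∀ j, MemLp (fun x => varianceVec σ x j) 2 (volume : Measure E3) := fun j => by
    rw [varianceVec_component hσD]
    exact (memLp_indicator_iff_restrict hD.measurableSet).2 (hc j)
  have h1 : ∀ j, MemLp (fun x => varianceVec σ x j) 1 (volume : Measure E3) := fun j => by
    rw [varianceVec_component hσD]
    exact (memLp_indicator_iff_restrict hD.measurableSet).2 ((hc j).mono_exponent one_le_two)
  have key : ∀ {p : ℝ≥0∞}, (∀ j, MemLp (fun x => varianceVec σ x j) p (volume : Measure E3)) →
      MemLp (varianceVec σ) p (volume : Measure E3) := fun {p} h => by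
    have e : varianceVec σ = fun x => ∑ j, varianceVec σ x j • (EuclideanSpace.single j 1 : C3) := by
      funext x
      ext i
      simp [Finset.sum_apply, Pi.single_apply]
    rw [e]
    refine memLp_finsetSum Finset.univ fun j _ => ?_
    refine MemLp.of_le (h j) ((h j).1.smul_const _) (Eventually.of_forall fun x => ?_)
    rw [norm_smul]
    simp
  exact ⟨memLp_one_iff_integrable.1 (key h1), key h2⟩

lemma fourier_varianceVec (hD : IsOpen D) (hDb : Bornology.IsBounded D)
    (hσD : ∀ j, tsupport (σ j) ⊆ D) (hσ : ∀ j, H1NormLE D (fun x => σ j x ^ 2) M) (w : E3) :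
    𝓕 (varianceVec σ) w = WithLp.toLp 2 (srcFourier D σ ((2 * Real.pi) • w)) := by
  ext j
  change _ = srcFourier D σ ((2 * Real.pi) • w) j
  rw [fourier_apply_component (memLp_varianceVec hD hDb hσD hσ).1, varianceVec_component hσD,
    Real.fourier_eq', srcFourier, ← integral_indicator hD.measurableSet]
  congr 1; funext y
  by_cases hy : y ∈ D
  · simp only [Set.indicator_of_mem hy, planeWave, inner_neg_left, inner_smul_left, smul_eq_mul,
      real_inner_comm w y]
    rw [mul_comm]
    congr 2
    simp
    ring
  · simp [hy]

/-- The tail of the transform of the variance. -/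
lemma eLpNorm_fourier_varianceVec_tail_le (hD : IsOpen D) (hDb : Bornology.IsBounded D)
    (hσD : ∀ j, tsupport (σ j) ⊆ D) (hσ : ∀ j, H1NormLE D (fun x => σ j x ^ 2) M) {ρ : ℝ}
    (hρ : 0 ≤ ρ) :
    eLpNorm (𝓕 (varianceVec σ)) 2
      (volume.restrict (closedBall (0 : E3) (ρ / (2 * Real.pi)))ᶜ) ≤
      ENNReal.ofReal (√3 * M / √(1 + ρ ^ 2)) := by
  have hM : 0 ≤ M := (hσ 0).nonneg
  have hpi : 0 < 2 * Real.pi := by positivity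
  refine eLpNorm_two_le (by positivity) ?_
  have hcont : ∀ j, Continuous (𝓕 (fun x => varianceVec σ x j) : E3 → ℂ) := fun j =>
    continuous_fourier_of_integrable ((EuclideanSpace.proj j : C3 →L[ℂ] ℂ).integrable_comp
      (memLp_varianceVec hD hDb hσD hσ).1)
  have e : ∀ p, ‖𝓕 (varianceVec σ) p‖ₑ ^ 2 = ∑ j, ‖𝓕 (fun x => varianceVec σ x j) p‖ₑ ^ 2 := by
    intro p
    simp only [← ofReal_norm, ← ENNReal.ofReal_pow (norm_nonneg _)]
    rw [EuclideanSpace.norm_sq_eq, ENNReal.ofReal_sum_of_nonneg fun _ _ => by positivity]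
    simp only [fourier_apply_component (memLp_varianceVec hD hDb hσD hσ).1]
  simp only [e]
  rw [lintegral_finsetSum _ fun j _ => ((hcont j).measurable.enorm.pow_const 2)]
  have h : ∀ j, ∫⁻ p in (closedBall (0 : E3) (ρ / (2 * Real.pi)))ᶜ,
      ‖𝓕 (fun x => varianceVec σ x j) p‖ₑ ^ 2 ≤ ENNReal.ofReal (M ^ 2 / (1 + ρ ^ 2)) := fun j => by
    have hK : IsCompact (tsupport (σ j)) :=
      Metric.isCompact_of_isClosed_isBounded (isClosed_tsupport _) (hDb.subset (hσD j))
    have := lintegral_fourier_tail_le hD hDb (hσD j) hK (v := fun x => σ j x ^ 2)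
      (fun x hx => by simp [image_eq_zero_of_notMem_tsupport hx]) (hσ j)
      (r := ρ / (2 * Real.pi)) (by positivity)
    rw [mul_div_cancel₀ _ hpi.ne'] at this
    rw [varianceVec_component hσD]
    exact this
  calc _ ≤ ∑ _j : Fin 3, ENNReal.ofReal (M ^ 2 / (1 + ρ ^ 2)) := Finset.sum_le_sum fun j _ => h j
    _ = ENNReal.ofReal ((√3 * M / √(1 + ρ ^ 2)) ^ 2) := by
      rw [Finset.sum_const, Finset.card_univ, Fintype.card_fin, nsmul_eq_mul, div_pow, mul_pow,
        Real.sq_sqrt (by norm_num), Real.sq_sqrt (by positivity), mul_div_assoc,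
        ENNReal.ofReal_mul (by norm_num)]
      simp

end Source

/-! ### The error estimate -/

section Estimate

open Filter Topology Metric FourierTransform
open scoped ENNReal

variable {D : Set E3} {σ : Fin 3 → E3 → ℝ} {M : ℝ}
variable {Ω : Type*} [MeasurableSpace Ω] {P : Measure Ω} {lam mu κ R ε : ℝ}

/-- Jensen's inequality for the expectation of an `L²` norm, together with Tonelli's theorem. -/
lemma lintegral_eLpNorm_le [IsProbabilityMeasure P] {ν : Measure E3} [SFinite ν]
    {q : E3 → Ω → C3} (hq : AEStronglyMeasurable (Function.uncurry q) (ν.prod P)) {B : ℝ≥0∞}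
    (hB : ∀ᵐ w ∂ν, ∫⁻ ω, ‖q w ω‖ₑ ^ 2 ∂P ≤ B) :
    ∫⁻ ω, eLpNorm (fun w => q w ω) 2 ν ∂P ≤ (B * ν Set.univ) ^ (1 / 2 : ℝ) := by
  have hq2 : AEMeasurable (fun p : E3 × Ω => ‖q p.1 p.2‖ₑ ^ 2) (ν.prod P) := hq.enorm.pow_const 2
  have hm : AEMeasurable (fun ω => ∫⁻ w, ‖q w ω‖ₑ ^ 2 ∂ν) P := hq2.lintegral_prod_left'
  have hJ := ENNReal.lintegral_mul_le_Lp_mul_Lq P Real.HolderConjugate.two_two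
    (f := fun ω => (∫⁻ w, ‖q w ω‖ₑ ^ 2 ∂ν) ^ (1 / 2 : ℝ)) (g := fun _ => 1) (hm.pow_const _)
    aemeasurable_const
  have e : ∀ x : ℝ≥0∞, (x ^ (1 / 2 : ℝ)) ^ (2 : ℝ) = x := fun x => by
    rw [← ENNReal.rpow_mul]; norm_num
  simp only [Pi.mul_apply, mul_one, e, ENNReal.one_rpow, lintegral_const, measure_univ] at hJ
  simp only [eLpNorm_two_eq]
  refine hJ.trans ?_
  gcongr
  rw [lintegral_lintegral_swap (hq2.prod_swap)]
  calc ∫⁻ w, ∫⁻ ω, ‖q w ω‖ₑ ^ 2 ∂P ∂ν ≤ ∫⁻ _w, B ∂ν := lintegral_mono_ae hB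
    _ = B * ν Set.univ := lintegral_const B

/-- The mean square error of the reconstructed Fourier transform at almost every frequency. -/
lemma lintegral_fourierRec_sub_le [IsProbabilityMeasure P] {N : ℕ} (hN : 0 < N)
    {W : Fin N → Fin 3 → Lp ℝ 2 (volume : Measure E3) → Ω → ℝ} {u uδ tδ : Fin N → E3 → Ω → C3}
    (hind : iIndepFun (fun (n : Fin N) (ω : Ω)
        (p : Fin 3 × Lp ℝ 2 (volume : Measure E3)) => W n p.1 p.2 ω) P)
    (h : ∀ n, IsSample P lam mu κ R D σ (W n) (u n)) {ε₀ : ℝ} (hε : 0 ≤ ε) (hε₀ : ε ≤ ε₀)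
    (hd : ∀ n, IsNoisyData P lam mu R ε (u n) (uδ n) (tδ n)) (θ : Fin 3 → ℝ) {β : ℝ}
    (hβ : β ∈ Set.Ioo (0 : ℝ) 2) {s : ℝ} {ν : Measure E3} [SFinite ν]
    (hν : ∀ᵐ w ∂ν, s • w ≠ 0 ∧ ‖s • w‖ ≤ β * kappaS mu κ) :
    ∀ᵐ w ∂ν, ∫⁻ ω, ‖(WithLp.toLp 2 (fourierRec lam mu κ R θ (fun n y => uδ n y ω)
        (fun n y => tδ n y ω) (s • w)) : C3) - WithLp.toLp 2 (srcFourier D σ (s • w))‖ₑ ^ 2 ∂P ≤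
      ENNReal.ofReal (3 * sSup (amplification β) ^ 2 * (432 * gaussFourth * srcEnergy D σ ^ 2 / N +
        (12 * (3 * (1 + mu * kappaS mu κ)) ^ 2 * srcEnergy D σ +
          6 * (3 * (1 + mu * kappaS mu κ)) ^ 4 * ε₀ ^ 2) * ε ^ 2)) := by
  set K := 432 * gaussFourth * srcEnergy D σ ^ 2 / N +
        (12 * (3 * (1 + mu * kappaS mu κ)) ^ 2 * srcEnergy D σ +
          6 * (3 * (1 + mu * kappaS mu κ)) ^ 4 * ε₀ ^ 2) * ε ^ 2 with hK
  have hκ := (h ⟨0, hN⟩).kappaS_pos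
  have hν' : ∀ᵐ w ∂ν, ‖(-s) • w‖ < 2 * kappaS mu κ := by
    filter_upwards [hν] with w hw
    rw [neg_smul, norm_neg]
    exact hw.2.trans_lt (by gcongr; exact hβ.2)
  have hmeas := fun k => (aestronglyMeasurable_correlationData (lam := lam) hd hκ θ hν' k).prodMk_left
  filter_upwards [hν, hν', ae_all_iff.2 hmeas] with w hw hw' hm
  rw [neg_smul] at hw'
  simp only [neg_smul] at hm
  set b : Fin 3 → Ω → ℂ := fun k ω => correlationData lam mu κ R θ (fun n y => uδ n y ω)
    (fun n y => tδ n y ω) (-(s • w)) k - ∑ j, (coeffMatrix θ (kappaS mu κ) (-(s • w)) k j : ℂ) *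
      srcFourier D σ (s • w) j with hb
  have hbk : ∀ k, ∫⁻ ω, ‖b k ω‖ₑ ^ 2 ∂P ≤ ENNReal.ofReal K := fun k => by
    have := lintegral_correlationData_sub_le hN hind h hε hε₀ hd θ hw' k
    rwa [neg_neg] at this
  have hbm : ∀ k, AEMeasurable (fun ω => ‖b k ω‖ₑ ^ 2) P := fun k =>
    (((hm k).sub aestronglyMeasurable_const).enorm).pow_const 2
  calc _ ≤ ∫⁻ ω, ENNReal.ofReal (sSup (amplification β) ^ 2) * ∑ k, ‖b k ω‖ₑ ^ 2 ∂P := by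
        refine lintegral_mono fun ω => ?_
        have h1 := norm_fourierRec_sub_le (lam := lam) (R := R) (D := D) (σ := σ)
          (h ⟨0, hN⟩).mu_pos (h ⟨0, hN⟩).kappa_pos θ hβ hw.1 hw.2 (fun n y => uδ n y ω)
          (fun n y => tδ n y ω)
        simp only [← ofReal_norm, ← ENNReal.ofReal_pow (norm_nonneg _)]
        rw [← ENNReal.ofReal_sum_of_nonneg fun _ _ => by positivity,
          ← ENNReal.ofReal_mul (by positivity)]
        exact ENNReal.ofReal_le_ofReal h1
    _ = ENNReal.ofReal (sSup (amplification β) ^ 2) * ∑ k, ∫⁻ ω, ‖b k ω‖ₑ ^ 2 ∂P := by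
        rw [lintegral_const_mul'' _ (Finset.aemeasurable_fun_sum _ fun k _ => hbm k),
          lintegral_finsetSum' _ fun k _ => hbm k]
    _ ≤ ENNReal.ofReal (sSup (amplification β) ^ 2) * ∑ _k : Fin 3, ENNReal.ofReal K := by
        gcongr with k
        exact hbk k
    _ = ENNReal.ofReal (3 * sSup (amplification β) ^ 2 * K) := by
        rw [Finset.sum_const, Finset.card_univ, Fintype.card_fin, nsmul_eq_mul,
          mul_comm 3 (sSup (amplification β) ^ 2), mul_assoc, ENNReal.ofReal_mul (by positivity),
          ENNReal.ofReal_mul (by norm_num)]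
        simp

/-- The constant of the sampling error. The term `3 / 2 * (|D| + M²)` bounds `∑_j ∫_D σ_j²`, see
`srcEnergy_le`. -/
def samplingConst (D : Set E3) (M : ℝ) : ℝ :=
  √(1296 * gaussFourth) * (3 / 2 * (volume.real D + M ^ 2))

/-- The constant of the data error; `3 * (1 + μ κ_s)` is the norm of the boundary functional with respect
to the data in `norm_boundaryFunctional_sub_le`, and the bound `ε₀` of the noise level controls the
term quadratic in the noise. -/
def dataConst (D : Set E3) (mu ε₀ M κs : ℝ) : ℝ :=
  √(36 * (3 * (1 + mu * κs)) ^ 2 * (3 / 2 * (volume.real D + M ^ 2)) +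
    18 * (3 * (1 + mu * κs)) ^ 4 * ε₀ ^ 2)

/-- The factor `(2π)⁻³` in the volume of the frequency ball is not needed and is dropped. -/
lemma volume_frequency_ball_le {ρ : ℝ} (hρ : 0 ≤ ρ) :
    volume (closedBall (0 : E3) (ρ / (2 * Real.pi))) ≤ ENNReal.ofReal (4 * Real.pi / 3 * ρ ^ 3) := by
  have h1 : ρ / (2 * Real.pi) ≤ ρ := div_le_self hρ (by linarith [Real.pi_gt_three])
  refine (measure_mono (closedBall_subset_closedBall h1)).trans (le_of_eq ?_)
  rw [EuclideanSpace.volume_closedBall_fin_three, ← ENNReal.ofReal_pow hρ,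
    ← ENNReal.ofReal_mul (by positivity)]
  congr 1; ring

lemma sqrt_meanSquare_le {ρ C S V ε₀ mu κs : ℝ} (hρ : 0 ≤ ρ) (hC : 0 ≤ C) (hS : 0 ≤ S)
    (hSV : S ≤ 3 / 2 * V) {N : ℕ} (hN : 0 < N) (hε : 0 ≤ ε) :
    √(3 * C ^ 2 * (432 * gaussFourth * S ^ 2 / N +
        (12 * (3 * (1 + mu * κs)) ^ 2 * S + 6 * (3 * (1 + mu * κs)) ^ 4 * ε₀ ^ 2) * ε ^ 2) *
          (4 * Real.pi / 3 * ρ ^ 3)) ≤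
      √(4 * Real.pi / 3) * ρ ^ (3 / 2 : ℝ) * C * (√(1296 * gaussFourth) * (3 / 2 * V) / √(N : ℝ) +
        √(36 * (3 * (1 + mu * κs)) ^ 2 * (3 / 2 * V) + 18 * (3 * (1 + mu * κs)) ^ 4 * ε₀ ^ 2) * ε) := by
  have hg := gaussFourth_nonneg
  have hN' : (0 : ℝ) < N := by positivity
  have hV : 0 ≤ 3 / 2 * V := hS.trans hSV
  set c := 3 * (1 + mu * κs) with hc
  have hX : (0 : ℝ) ≤ 36 * c ^ 2 * (3 / 2 * V) + 18 * c ^ 4 * ε₀ ^ 2 := by positivity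
  have hY : (0 : ℝ) ≤ 1296 * gaussFourth := by positivity
  refine Real.sqrt_le_iff.2 ⟨by positivity, ?_⟩
  have hρ3 : (ρ ^ (3 / 2 : ℝ)) ^ 2 = ρ ^ 3 := by
    rw [← Real.rpow_natCast, ← Real.rpow_mul hρ, ← Real.rpow_natCast]; norm_num
  set a := √(1296 * gaussFourth) * (3 / 2 * V) / √(N : ℝ) with ha
  set b := √(36 * c ^ 2 * (3 / 2 * V) + 18 * c ^ 4 * ε₀ ^ 2) * ε with hb
  have ha2 : a ^ 2 = 1296 * gaussFourth * (3 / 2 * V) ^ 2 / N := by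
    rw [ha, div_pow, mul_pow, Real.sq_sqrt hY, Real.sq_sqrt hN'.le]
  have hb2 : b ^ 2 = (36 * c ^ 2 * (3 / 2 * V) + 18 * c ^ 4 * ε₀ ^ 2) * ε ^ 2 := by
    rw [hb, mul_pow, Real.sq_sqrt hX]
  have hab : 0 ≤ a * b := by positivity
  have e3 : (√(4 * Real.pi / 3) * ρ ^ (3 / 2 : ℝ) * C * (a + b)) ^ 2 =
      4 * Real.pi / 3 * ρ ^ 3 * C ^ 2 * (a + b) ^ 2 := by
    rw [mul_pow, mul_pow, mul_pow, Real.sq_sqrt (by positivity), hρ3]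
  rw [e3]
  have h1 : 3 * (432 * gaussFourth * S ^ 2 / N +
      (12 * c ^ 2 * S + 6 * c ^ 4 * ε₀ ^ 2) * ε ^ 2) ≤ (a + b) ^ 2 := by
    have h2 : 3 * (432 * gaussFourth * S ^ 2 / N + (12 * c ^ 2 * S + 6 * c ^ 4 * ε₀ ^ 2) * ε ^ 2) ≤
        a ^ 2 + b ^ 2 := by
      rw [ha2, hb2]
      have e : 3 * (432 * gaussFourth * S ^ 2 / N + (12 * c ^ 2 * S + 6 * c ^ 4 * ε₀ ^ 2) * ε ^ 2) =
        1296 * gaussFourth * S ^ 2 / N + (36 * c ^ 2 * S + 18 * c ^ 4 * ε₀ ^ 2) * ε ^ 2 := by ring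
      rw [e]
      gcongr
    nlinarith
  calc 3 * C ^ 2 * (432 * gaussFourth * S ^ 2 / N + (12 * c ^ 2 * S + 6 * c ^ 4 * ε₀ ^ 2) * ε ^ 2) *
          (4 * Real.pi / 3 * ρ ^ 3)
      = (4 * Real.pi / 3 * ρ ^ 3 * C ^ 2) * (3 * (432 * gaussFourth * S ^ 2 / N +
          (12 * c ^ 2 * S + 6 * c ^ 4 * ε₀ ^ 2) * ε ^ 2)) := by ring
    _ ≤ (4 * Real.pi / 3 * ρ ^ 3 * C ^ 2) * (a + b) ^ 2 := by gcongr

/-- The expectation of the reconstruction error. -/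
lemma lintegral_recError_le [IsProbabilityMeasure P] {N : ℕ} (hN : 0 < N)
    {W : Fin N → Fin 3 → Lp ℝ 2 (volume : Measure E3) → Ω → ℝ} {u uδ tδ : Fin N → E3 → Ω → C3}
    (hind : iIndepFun (fun (n : Fin N) (ω : Ω)
        (p : Fin 3 × Lp ℝ 2 (volume : Measure E3)) => W n p.1 p.2 ω) P)
    (h : ∀ n, IsSample P lam mu κ R D σ (W n) (u n)) {ε₀ : ℝ} (hε : 0 ≤ ε) (hε₀ : ε ≤ ε₀)
    (hd : ∀ n, IsNoisyData P lam mu R ε (u n) (uδ n) (tδ n)) (θ : Fin 3 → ℝ) {β : ℝ}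
    (hβ : β ∈ Set.Ioo (0 : ℝ) 2)
    (hσD : ∀ j, tsupport (σ j) ⊆ D) (hσ : ∀ j, H1NormLE D (fun x => σ j x ^ 2) M) {ρ : ℝ}
    (hρ : ρ = β * kappaS mu κ) :
    ∫⁻ ω, recError lam mu κ R D σ θ ρ (fun n y => uδ n y ω) (fun n y => tδ n y ω) ∂P ≤
      ENNReal.ofReal (√(4 * Real.pi / 3) * ρ ^ (3 / 2 : ℝ) * sSup (amplification β) *
        (samplingConst D M / √(N : ℝ) + dataConst D mu ε₀ M (kappaS mu κ) * ε) +
          √3 * M / √(1 + ρ ^ 2)) := by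
  have hs := h ⟨0, hN⟩
  have hκ := hs.kappaS_pos
  have hD := hs.isOpen
  have hDb := hs.isBounded
  have hpi : 0 < 2 * Real.pi := by positivity
  have hρ0 : 0 ≤ ρ := by rw [hρ]; exact mul_nonneg hβ.1.le hκ.le
  have hM : 0 ≤ M := (hσ 0).nonneg
  obtain ⟨hf1, hf2⟩ := memLp_varianceVec hD hDb hσD hσ
  set B := closedBall (0 : E3) (ρ / (2 * Real.pi)) with hB
  set ν : Measure E3 := volume.restrict B with hν
  have hBm : MeasurableSet B := isClosed_closedBall.measurableSet
  have hνb : ∀ᵐ w ∂ν, (2 * Real.pi) • w ≠ 0 ∧ ‖(2 * Real.pi) • w‖ ≤ β * kappaS mu κ := by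
    have h0 : ∀ᵐ w ∂ν, w ≠ (0 : E3) := by
      refine ae_restrict_of_ae ?_
      exact (measure_eq_zero_iff_ae_notMem.1 (measure_singleton (0 : E3))).mono fun w hw => hw
    filter_upwards [h0, ae_restrict_mem hBm] with w hw0 hw
    refine ⟨smul_ne_zero hpi.ne' hw0, ?_⟩
    rw [hB, mem_closedBall_zero_iff, le_div_iff₀ hpi] at hw
    rw [norm_smul, Real.norm_of_nonneg hpi.le, ← hρ]
    linarith
  have hνlt : ∀ᵐ w ∂ν, ‖(2 * Real.pi) • w‖ < 2 * kappaS mu κ := by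
    filter_upwards [hνb] with w hw
    exact hw.2.trans_lt (by gcongr; exact hβ.2)
  set H : E3 → Ω → C3 := fun w ω => WithLp.toLp 2 (fourierRec lam mu κ R θ (fun n y => uδ n y ω)
    (fun n y => tδ n y ω) ((2 * Real.pi) • w)) with hH
  have hHm : AEStronglyMeasurable (Function.uncurry H) (ν.prod P) :=
    aestronglyMeasurable_toLp fun j => aestronglyMeasurable_fourierRec hd hκ θ hνlt j
  have hFm : Continuous (𝓕 (varianceVec σ) : E3 → C3) := continuous_fourier_of_integrable hf1
  have hqm : AEStronglyMeasurable (Function.uncurry fun w ω => H w ω - 𝓕 (varianceVec σ) w)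
      (ν.prod P) := hHm.sub (hFm.measurable.comp measurable_fst).aestronglyMeasurable
  have hpoint : ∀ᵐ ω ∂P, recError lam mu κ R D σ θ ρ (fun n y => uδ n y ω) (fun n y => tδ n y ω) ≤
      eLpNorm (fun w => H w ω - 𝓕 (varianceVec σ) w) 2 ν +
        ENNReal.ofReal (√3 * M / √(1 + ρ ^ 2)) := by
    filter_upwards [hHm.prod_swap.prodMk_left] with ω hω
    refine (eLpNorm_mono_measure _ Measure.restrict_le_self).trans ?_
    refine (eLpNorm_truncated_inverse_sub_le hf1 hf2 hω).trans ?_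
    exact add_le_add le_rfl (eLpNorm_fourier_varianceVec_tail_le hD hDb hσD hσ hρ0)
  have hsq := lintegral_fourierRec_sub_le hN hind h hε hε₀ hd θ hβ hνb
  simp only [← fourier_varianceVec hD hDb hσD hσ] at hsq
  have hmain := lintegral_eLpNorm_le hqm hsq
  have hC : 0 ≤ sSup (amplification β) := by
    have hne : (EuclideanSpace.single (0 : Fin 3) (β : ℝ) : E3) ≠ 0 := by simp [hβ.1.ne']
    exact (norm_nonneg _).trans (specNorm_inv_le_sSup θ one_pos hβ hne (by simp [abs_of_pos hβ.1]))
  calc _ ≤ ∫⁻ ω, (eLpNorm (fun w => H w ω - 𝓕 (varianceVec σ) w) 2 ν +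
        ENNReal.ofReal (√3 * M / √(1 + ρ ^ 2))) ∂P := lintegral_mono_ae hpoint
    _ = ∫⁻ ω, eLpNorm (fun w => H w ω - 𝓕 (varianceVec σ) w) 2 ν ∂P +
        ENNReal.ofReal (√3 * M / √(1 + ρ ^ 2)) := by
      rw [lintegral_add_right _ measurable_const, lintegral_const, measure_univ, mul_one]
    _ ≤ _ := by
      rw [ENNReal.ofReal_add (by unfold samplingConst dataConst; positivity) (by positivity)]
      gcongr
      refine hmain.trans ?_
      have hvol : ν Set.univ ≤ ENNReal.ofReal (4 * Real.pi / 3 * ρ ^ 3) := by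
        rw [hν, Measure.restrict_apply_univ]
        exact volume_frequency_ball_le hρ0
      refine le_trans (ENNReal.rpow_le_rpow (mul_le_mul_right hvol _) (by norm_num)) ?_
      have hg := gaussFourth_nonneg
      have hS : 0 ≤ srcEnergy D σ := srcEnergy_nonneg
      rw [← ENNReal.ofReal_mul (by positivity),
        ENNReal.ofReal_rpow_of_nonneg (by positivity) (by norm_num), ← Real.sqrt_eq_rpow]
      exact ENNReal.ofReal_le_ofReal (sqrt_meanSquare_le hρ0 hC hS (srcEnergy_le hDb hσ) hN hε)

end Estimate

end RandomSource

end

theorem mainTheorem1 :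
    ∃ C₁ : ℝ → ℝ,
      (∀ β ∈ Set.Ioo (0 : ℝ) 2,
        (∀ (κs : ℝ) (θ : Fin 3 → ℝ) (ξ : RandomSource.E3), 0 < κs → ξ ≠ 0 → ‖ξ‖ ≤ β * κs →
          IsUnit (RandomSource.coeffMatrix θ κs ξ)) ∧
        IsLUB (RandomSource.amplification β) (C₁ β)) ∧
      ∀ D : Set RandomSource.E3, IsOpen D → Bornology.IsBounded D →
      ∃ C₂ : ℝ → ℝ → ℝ, ∀ mu ε₀ : ℝ, 0 < mu →
      ∃ C₃ : ℝ → ℝ → ℝ,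
      ∀ (lam κ R M β ε : ℝ) (θ : Fin 3 → ℝ) (σ : Fin 3 → RandomSource.E3 → ℝ) (N : ℕ)
        (Ω : Type*) [MeasurableSpace Ω] (P : Measure Ω) [IsProbabilityMeasure P]
        (W : Fin N → Fin 3 → Lp ℝ 2 (volume : Measure RandomSource.E3) → Ω → ℝ)
        (u uδ tδ : Fin N → RandomSource.E3 → Ω → RandomSource.C3),
      -- the physical parameters, the ball and the cutoff parameter
      0 < lam + 2 * mu → 0 < κ → 0 < R → closure D ⊆ Metric.ball 0 R → β ∈ Set.Ioo (0 : ℝ) 2 →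
      -- the strength of the source
      (∀ j x, 0 ≤ σ j x) → (∀ j, tsupport (σ j) ⊆ D) →
      (∀ j, RandomSource.H1NormLE D (fun x => σ j x ^ 2) M) →
      -- `N` independent samples of the white noise and of the wave field
      0 < N → (∀ n, RandomSource.IsWhiteNoise (W n) P) →
      iIndepFun (fun (n : Fin N) (ω : Ω)
        (p : Fin 3 × Lp ℝ 2 (volume : Measure RandomSource.E3)) => W n p.1 p.2 ω) P →
      (∀ n, RandomSource.IsMildSolution P lam mu κ D σ (W n) (u n)) →
      -- the noisy data `uδ` of `u` and `tδ` of `Du` on the sphere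
      0 ≤ ε → ε ≤ ε₀ →
      (∀ n, AEStronglyMeasurable (Function.uncurry (uδ n))
        ((RandomSource.surfaceMeasure R).prod P)) →
      (∀ n, AEStronglyMeasurable (Function.uncurry (tδ n))
        ((RandomSource.surfaceMeasure R).prod P)) →
      (∀ n, ∀ᵐ ω ∂P, eLpNorm (fun x => uδ n x ω - u n x ω) 1
        (RandomSource.surfaceMeasure R) ≤ ENNReal.ofReal ε) →
      (∀ n, ∀ᵐ ω ∂P, eLpNorm
        (fun x => tδ n x ω - RandomSource.boundaryOp lam mu (fun y => u n y ω) x) 1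
        (RandomSource.surfaceMeasure R) ≤ ENNReal.ofReal ε) →
      -- the error of the reconstruction in `L²(D)` and its expectation
      ∀ κs ξmax : ℝ, κs = RandomSource.kappaS mu κ → ξmax = β * κs →
      AEMeasurable (fun ω => RandomSource.recError lam mu κ R D σ θ ξmax
          (fun n y => uδ n y ω) (fun n y => tδ n y ω)) P ∧
      ∫⁻ ω, RandomSource.recError lam mu κ R D σ θ ξmax
          (fun n y => uδ n y ω) (fun n y => tδ n y ω) ∂P ≤ ENNReal.ofReal
        (√(4 * Real.pi / 3) * ξmax ^ (3 / 2 : ℝ) * C₁ β * (C₂ M κs / √(N : ℝ) + C₃ M κs * ε) +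
          √3 * M / √(1 + ξmax ^ 2)) := by
  refine ⟨fun β => sSup (RandomSource.amplification β), fun β hβ =>
    ⟨fun κs θ ξ hκ _ hξ => RandomSource.isUnit_coeffMatrix θ hκ
      (hξ.trans_lt (mul_lt_mul_of_pos_right hβ.2 hκ)), RandomSource.isLUB_amplification hβ⟩,
    fun D hD hDb => ⟨fun M _ => RandomSource.samplingConst D M, fun mu ε₀ hmu =>
      ⟨fun M κs => RandomSource.dataConst D mu ε₀ M κs, ?_⟩⟩⟩
  intro lam κ R M β ε θ σ N Ω _ P _ W u uδ tδ hlam hκ hR hDR hβ hσ0 hσD hσ hN hW hind hu hε hε₀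
    hmeas_u hmeas_t herr_u herr_t κs ξmax hκs hξ
  subst hκs
  have hs : ∀ n, RandomSource.IsSample P lam mu κ R D σ (W n) (u n) := fun n =>
    ⟨hmu, hlam, hκ, hR, hD, hDb, hDR, RandomSource.sqIntOn_of_H1 hD hDb hσ0 hσ, hW n, hu n⟩
  have hd : ∀ n, RandomSource.IsNoisyData P lam mu R ε (u n) (uδ n) (tδ n) := fun n =>
    ⟨hmeas_u n, hmeas_t n, herr_u n, herr_t n⟩
  have hκs := (hs ⟨0, hN⟩).kappaS_pos
  exact ⟨RandomSource.aemeasurable_recError hd hκs θ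
      (hξ.trans_lt (mul_lt_mul_of_pos_right hβ.2 hκs))
      (RandomSource.memLp_varianceVec hD hDb hσD hσ).1.aestronglyMeasurable.restrict,
    RandomSource.lintegral_recError_le hN hind hs hε hε₀ hd θ hβ hσD hσ hξ⟩
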